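/- Let $(M,g)$ be a compact smooth Riemannian manifold without boundary, of dimension $N\ge 1$, with volume measure $dv_g$. Put $2^*=\frac{2N}{N-2}$ if $N\ge 3$ and $2^*=\infty$ if $N\in\{1,2\}$. Let $W\colon\mathbb R\to[0,\infty)$ be a function of class $C^2$ such that: (a) the global minimum points of $W$ are exactly $s=0$ and $s=1$, the only local maximum point of $W$ is $s=\frac12$, and $W(0)=W'(0)=W(1)=W'(1)=0$, $W''(0)>0$, $W''(1)>0$; (b) there are constants $A,B>0$ and $p<2^*$ with $|W'(s)|\le A+B|s|^{p-1}$ for all $s\in\mathbb R$; (c) for some $\delta>0$, $W'(s)>0$ for all $s\in(1,1+\delta]$; (d) there are $c_1,c_2,t_0>0$ and exponents $p_1,p_2$ with $2<p_1<\frac12 2^*+1$ and $p_1\le p_2\le 2(p_1-1)$ such that $c_1|t|^{p_1}<W(t)<c_2|t|^{p_2}$ whenever $|t|\ge t_0$. Let $H^1(M)$ be the Sobolev space, i.e. the completion of $C^\infty(M)$ in the norm $\|u\|^2=\int_M u^2\,dv_g+\int_M|\nabla u|^2\,dv_g$. For $\varepsilon>0$ let $$E_\varepsilon(u)=\frac{\varepsilon}{2}\int_M|\nabla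 u|^2\,dv_g+\frac1\varepsilon\int_M W(u)\,dv_g,\qquad u\in H^1(M),$$ and for $V>0$ let $\mathfrak M^V=\{u\in H^1(M):\int_M u\,dv_g=V\}$, a closed affine subspace of $H^1(M)$ whose tangent space at every point is $T=\{v\in H^1(M):\int_M v\,dv_g=0\}$ with the norm of $H^1(M)$. Then, for all $\varepsilon,V>0$, $E_\varepsilon$ is well defined (that is, $W(u)\in L^1(M)$ for all $u\in H^1(M)$) and of class $C^1$ on $H^1(M)$, and its restriction $J=E_\varepsilon|_{\mathfrak M^V}$ satisfies the Palais–Smale condition: if $(u_n)$ is a sequence in $\mathfrak M^V$ such that $J(u_n)\to c$ for some $c\in\mathbb R$ and $\|dJ(u_n)\|_{T^*}\to 0$, then $(u_n)$ has a subsequence that converges in $\mathfrak M^V$ with respect to the $H^1$ norm. -/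

import Mathlib

open Set Filter MeasureTheory Bundle
open scoped Manifold ContDiff Topology

noncomputable section

namespace CahnHilliard

section Riemannian

variable {N : ℕ} {M : Type*} [TopologicalSpace M] [ChartedSpace (EuclideanSpace ℝ (Fin N)) M]
  [IsManifold (𝓡 N) ∞ M]

/-- Smooth Riemannian metrics on the `N`-dimensional smooth manifold `M` (without boundary). -/
abbrev RMetric (N : ℕ) (M : Type*) [TopologicalSpace M]
    [ChartedSpace (EuclideanSpace ℝ (Fin N)) M] [IsManifold (𝓡 N) ∞ M] :=
  ContMDiffRiemannianMetric (𝓡 N) ∞ (EuclideanSpace ℝ (Fin N))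
    (fun x : M ↦ TangentSpace (𝓡 N) x)

/-! ### The Riemannian volume measure -/

/-- The coordinate vector field `∂ᵢ` of the chart around `x₀`, at the point with coordinates `z`. -/
def coordVec (x₀ : M) (z : EuclideanSpace ℝ (Fin N)) (i : Fin N) :
    TangentSpace (𝓡 N) ((extChartAt (𝓡 N) x₀).symm z) :=
  mfderiv 𝓘(ℝ, EuclideanSpace ℝ (Fin N)) (𝓡 N) (extChartAt (𝓡 N) x₀).symm z
    (EuclideanSpace.single i (1 : ℝ) : EuclideanSpace ℝ (Fin N))

/-- The matrix `g_{ij} = g(∂ᵢ, ∂ⱼ)` of the metric in the chart around `x₀`. -/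
def gram (g : RMetric N M) (x₀ : M) (z : EuclideanSpace ℝ (Fin N)) : Matrix (Fin N) (Fin N) ℝ :=
  Matrix.of fun i j ↦ g.inner ((extChartAt (𝓡 N) x₀).symm z) (coordVec x₀ z i) (coordVec x₀ z j)

/-- The volume density `√det (g_{ij})` in the chart around `x₀`. -/
def volDensity (g : RMetric N M) (x₀ : M) (z : EuclideanSpace ℝ (Fin N)) : ℝ :=
  √(gram g x₀ z).det

variable (N M) in
/-- A smooth partition of unity `(ρ_{x₀})` subordinate to the charts around the points of `M`. -/
def partition [T2Space M] [CompactSpace M] : SmoothPartitionOfUnity M (𝓡 N) M univ :=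
  (SmoothPartitionOfUnity.exists_isSubordinate_chartAt_source (𝓡 N) M).choose

/-- The Riemannian volume measure `dv_g`, through a partition of unity:
`∫ f dv_g = ∑_{x₀} ∫_{chart around x₀} (ρ_{x₀} f) √det (g_{ij}) dz`
(the sum has only finitely many non-zero terms). -/
def vol [T2Space M] [CompactSpace M] [MeasurableSpace M] (g : RMetric N M) : Measure M :=
  Measure.sum fun x₀ : M ↦
    (((volume : Measure (EuclideanSpace ℝ (Fin N))).restrict (extChartAt (𝓡 N) x₀).target).withDensity
      fun z ↦ ENNReal.ofReal
        (partition N M x₀ ((extChartAt (𝓡 N) x₀).symm z) * volDensity g x₀ z)).map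
      (extChartAt (𝓡 N) x₀).symm

/-! ### Gradients -/

/-- The Riemannian gradient of `φ`: the vector with `g(∇φ(x), v) = dφ(x) v` for all `v`. -/
def gradient (g : RMetric N M) (φ : M → ℝ) (x : M) : TangentSpace (𝓡 N) x :=
  letI : RiemannianBundle (fun x : M ↦ TangentSpace (𝓡 N) x) := ⟨g.toRiemannianMetric⟩
  haveI : FiniteDimensional ℝ (TangentSpace (𝓡 N) x) :=
    inferInstanceAs (FiniteDimensional ℝ (EuclideanSpace ℝ (Fin N)))
  haveI : CompleteSpace (TangentSpace (𝓡 N) x) := FiniteDimensional.complete ℝ _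
  (InnerProductSpace.toDual ℝ (TangentSpace (𝓡 N) x)).symm
    (mfderiv (𝓡 N) 𝓘(ℝ, ℝ) φ x : TangentSpace (𝓡 N) x →L[ℝ] ℝ)

theorem inner_gradient (g : RMetric N M) (φ : M → ℝ) (x : M) (v : TangentSpace (𝓡 N) x) :
    g.inner x (gradient g φ x) v = (mfderiv (𝓡 N) 𝓘(ℝ, ℝ) φ x : TangentSpace (𝓡 N) x →L[ℝ] ℝ) v := by
  let _ : RiemannianBundle (fun x : M ↦ TangentSpace (𝓡 N) x) := ⟨g.toRiemannianMetric⟩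
  have : FiniteDimensional ℝ (TangentSpace (𝓡 N) x) :=
    inferInstanceAs (FiniteDimensional ℝ (EuclideanSpace ℝ (Fin N)))
  have : CompleteSpace (TangentSpace (𝓡 N) x) := FiniteDimensional.complete ℝ _
  exact InnerProductSpace.toDual_symm_apply (𝕜 := ℝ) (E := TangentSpace (𝓡 N) x) (x := v)
    (y := (mfderiv (𝓡 N) 𝓘(ℝ, ℝ) φ x : TangentSpace (𝓡 N) x →L[ℝ] ℝ))

/-- The vector field on the chart domain around `x₀` with constant coordinates `v`. -/
def constSec (x₀ : M) (v : EuclideanSpace ℝ (Fin N)) (y : M) : TangentSpace (𝓡 N) y :=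
  (trivializationAt (EuclideanSpace ℝ (Fin N)) (TangentSpace (𝓡 N) : M → Type _) x₀).symmL ℝ y v

theorem continuousOn_constSec (x₀ : M) (v : EuclideanSpace ℝ (Fin N)) :
    ContinuousOn (fun y : M ↦ (⟨y, constSec x₀ v y⟩ : TangentBundle (𝓡 N) M))
      (chartAt (EuclideanSpace ℝ (Fin N)) x₀).source := by
  have h := (trivializationAt (EuclideanSpace ℝ (Fin N)) (TangentSpace (𝓡 N) : M → Type _)
    x₀).continuousOn_symm
  have h2 : ContinuousOn (fun y : M ↦ (y, v)) (chartAt (EuclideanSpace ℝ (Fin N)) x₀).source := by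
    fun_prop
  refine (h.comp h2 fun y hy ↦ ?_).congr fun y hy ↦ ?_
  · simpa using hy
  · have hy' : y ∈ (trivializationAt (EuclideanSpace ℝ (Fin N))
        (TangentSpace (𝓡 N) : M → Type _) x₀).baseSet := by simpa using hy
    rw [constSec, Trivialization.symmL_apply _ hy']
    rfl

theorem continuousOn_inner_constSec (g : RMetric N M) (x₀ : M) (v w : EuclideanSpace ℝ (Fin N)) :
    ContinuousOn (fun y : M ↦ g.inner y (constSec x₀ v y) (constSec x₀ w y))
      (chartAt (EuclideanSpace ℝ (Fin N)) x₀).source := by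
  let _ : RiemannianBundle (fun x : M ↦ TangentSpace (𝓡 N) x) := ⟨g.toRiemannianMetric⟩
  have : IsContinuousRiemannianBundle (EuclideanSpace ℝ (Fin N))
      (fun x : M ↦ TangentSpace (𝓡 N) x) := ⟨g.inner, g.contMDiff.continuous, fun _ _ _ ↦ rfl⟩
  exact ContinuousOn.inner_bundle (continuousOn_constSec x₀ v) (continuousOn_constSec x₀ w)

theorem continuousOn_mfderiv_constSec {φ : M → ℝ} (hφ : ContMDiff (𝓡 N) 𝓘(ℝ, ℝ) ∞ φ) (x₀ : M)
    (v : EuclideanSpace ℝ (Fin N)) :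
    ContinuousOn (fun y : M ↦
      (mfderiv (𝓡 N) 𝓘(ℝ, ℝ) φ y : TangentSpace (𝓡 N) y →L[ℝ] ℝ) (constSec x₀ v y))
      (chartAt (EuclideanSpace ℝ (Fin N)) x₀).source := by
  have h1 : Continuous (tangentMap (𝓡 N) 𝓘(ℝ, ℝ) φ) := hφ.continuous_tangentMap (by simp)
  have h2 : Continuous (fun p : TangentBundle 𝓘(ℝ, ℝ) ℝ ↦ (tangentBundleModelSpaceHomeomorph 𝓘(ℝ, ℝ) p).2) :=
    continuous_snd.comp (tangentBundleModelSpaceHomeomorph 𝓘(ℝ, ℝ)).continuous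
  exact (h2.comp h1).comp_continuousOn (continuousOn_constSec x₀ v)

/-- The matrix of the metric in the coordinate frame around `x₀`, as a function on `M`. -/
def frameGram (g : RMetric N M) (x₀ y : M) : Matrix (Fin N) (Fin N) ℝ :=
  Matrix.of fun i j ↦ g.inner y (constSec x₀ (EuclideanSpace.single i 1) y)
    (constSec x₀ (EuclideanSpace.single j 1) y)

theorem constSec_sum (x₀ y : M) (c : Fin N → ℝ) :
    ∑ i, c i • constSec x₀ (EuclideanSpace.single i 1) y = constSec x₀ (WithLp.toLp 2 c) y := by
  have hc : (WithLp.toLp 2 c : EuclideanSpace ℝ (Fin N)) =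
      ∑ i, c i • EuclideanSpace.single i (1 : ℝ) := by
    ext j
    simp [Finset.sum_apply, Pi.single_apply]
  simp only [constSec]
  rw [hc, map_sum]
  simp

theorem exists_constSec (x₀ : M) {y : M} (hy : y ∈ (chartAt (EuclideanSpace ℝ (Fin N)) x₀).source)
    (X : TangentSpace (𝓡 N) y) :
    ∃ c : Fin N → ℝ, X = ∑ i, c i • constSec x₀ (EuclideanSpace.single i 1) y := by
  let t := trivializationAt (EuclideanSpace ℝ (Fin N)) (TangentSpace (𝓡 N) : M → Type _) x₀
  refine ⟨(t.continuousLinearMapAt ℝ y X : EuclideanSpace ℝ (Fin N)).ofLp, ?_⟩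
  rw [constSec_sum]
  have := t.symmL_continuousLinearMapAt (R := ℝ) (b := y) (by simpa [t] using hy) X
  exact this.symm

theorem constSec_eq_zero (x₀ : M) {y : M}
    (hy : y ∈ (chartAt (EuclideanSpace ℝ (Fin N)) x₀).source)
    (v : EuclideanSpace ℝ (Fin N)) (h : constSec x₀ v y = 0) : v = 0 := by
  let t := trivializationAt (EuclideanSpace ℝ (Fin N)) (TangentSpace (𝓡 N) : M → Type _) x₀
  have := t.continuousLinearMapAt_symmL (R := ℝ) (b := y) (by simpa [t] using hy) v
  rw [← this]
  have h' : t.symmL ℝ y v = 0 := h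
  rw [h', map_zero]

theorem frameGram_posDef (g : RMetric N M) (x₀ : M) {y : M}
    (hy : y ∈ (chartAt (EuclideanSpace ℝ (Fin N)) x₀).source) : (frameGram g x₀ y).PosDef := by
  refine Matrix.PosDef.of_dotProduct_mulVec_pos ?_ fun c hc ↦ ?_
  · ext i j
    simp [frameGram, g.symm y]
  · have h : star c ⬝ᵥ (frameGram g x₀ y).mulVec c =
        g.inner y (∑ i, c i • constSec x₀ (EuclideanSpace.single i 1) y)
          (∑ i, c i • constSec x₀ (EuclideanSpace.single i 1) y) := by
      simp [dotProduct, Matrix.mulVec, frameGram, Finset.mul_sum, sum_apply]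
      refine Finset.sum_congr rfl fun i _ ↦ Finset.sum_congr rfl fun j _ ↦ by
        rw [g.symm]; ring
    rw [h, constSec_sum]
    refine g.pos y _ fun h0 ↦ hc ?_
    have := constSec_eq_zero x₀ hy _ h0
    simpa using congrArg WithLp.ofLp this

/-- The differential of `φ` in the coordinate frame around `x₀`. -/
def frameDiff (φ : M → ℝ) (x₀ y : M) : Fin N → ℝ := fun i ↦
  (mfderiv (𝓡 N) 𝓘(ℝ, ℝ) φ y : TangentSpace (𝓡 N) y →L[ℝ] ℝ)
    (constSec x₀ (EuclideanSpace.single i 1) y)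

theorem inner_gradient_eq (g : RMetric N M) (φ ψ : M → ℝ) (x₀ : M) {y : M}
    (hy : y ∈ (chartAt (EuclideanSpace ℝ (Fin N)) x₀).source) :
    g.inner y (gradient g φ y) (gradient g ψ y) =
      frameDiff φ x₀ y ⬝ᵥ (frameGram g x₀ y)⁻¹.mulVec (frameDiff ψ x₀ y) := by
  obtain ⟨c, hc⟩ := exists_constSec x₀ hy (gradient g ψ y)
  have hA : (frameGram g x₀ y).mulVec c = frameDiff ψ x₀ y := by
    ext i
    rw [frameDiff, ← inner_gradient g ψ y, hc, g.symm]
    simp [Matrix.mulVec, dotProduct, frameGram, mul_comm]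
  have hu : IsUnit (frameGram g x₀ y).det := (frameGram_posDef g x₀ hy).det_pos.ne'.isUnit
  rw [← hA, Matrix.mulVec_mulVec, Matrix.nonsing_inv_mul _ hu, Matrix.one_mulVec, inner_gradient, hc]
  simp [dotProduct, frameDiff]
  exact Finset.sum_congr rfl fun i _ ↦ mul_comm _ _

theorem continuous_inner_gradient (g : RMetric N M) {φ ψ : M → ℝ}
    (hφ : ContMDiff (𝓡 N) 𝓘(ℝ, ℝ) ∞ φ) (hψ : ContMDiff (𝓡 N) 𝓘(ℝ, ℝ) ∞ ψ) :
    Continuous fun y ↦ g.inner y (gradient g φ y) (gradient g ψ y) := by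
  rw [continuous_iff_continuousAt]
  intro x₀
  have hs : (chartAt (EuclideanSpace ℝ (Fin N)) x₀).source ∈ 𝓝 x₀ := chart_source_mem_nhds _ _
  refine ContinuousOn.continuousAt (s := (chartAt (EuclideanSpace ℝ (Fin N)) x₀).source) ?_ hs
  have key : ContinuousOn (fun y ↦
      frameDiff φ x₀ y ⬝ᵥ (frameGram g x₀ y)⁻¹.mulVec (frameDiff ψ x₀ y))
      (chartAt (EuclideanSpace ℝ (Fin N)) x₀).source := by
    have h1 : Continuous ((chartAt (EuclideanSpace ℝ (Fin N)) x₀).source.domRestrict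
        (frameGram g x₀)) := by
      refine continuous_matrix fun i j ↦ ?_
      exact (continuousOn_inner_constSec g x₀ _ _).domRestrict
    have h2 : Continuous ((chartAt (EuclideanSpace ℝ (Fin N)) x₀).source.domRestrict
        (frameDiff φ x₀)) :=
      continuous_pi fun i ↦ (continuousOn_mfderiv_constSec hφ x₀ _).domRestrict
    have h3 : Continuous ((chartAt (EuclideanSpace ℝ (Fin N)) x₀).source.domRestrict
        (frameDiff ψ x₀)) :=
      continuous_pi fun i ↦ (continuousOn_mfderiv_constSec hψ x₀ _).domRestrict
    rw [continuousOn_iff_continuous_domRestrict]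
    have h4 : Continuous fun y : (chartAt (EuclideanSpace ℝ (Fin N)) x₀).source ↦
        (frameGram g x₀ y)⁻¹ := by
      simp only [Matrix.inv_def, Ring.inverse_eq_inv']
      refine Continuous.smul (Continuous.inv₀ h1.matrix_det fun y ↦ ?_) h1.matrix_adjugate
      exact (frameGram_posDef g x₀ y.2).det_pos.ne'
    exact h2.dotProduct (h4.matrix_mulVec h3)
  exact key.congr fun y hy ↦ inner_gradient_eq g φ ψ x₀ hy

theorem coordVec_eq (x₀ : M) {z : EuclideanSpace ℝ (Fin N)} (hz : z ∈ (extChartAt (𝓡 N) x₀).target)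
    (i : Fin N) : coordVec x₀ z i =
      constSec x₀ (EuclideanSpace.single i 1) ((extChartAt (𝓡 N) x₀).symm z) := by
  have hs : (extChartAt (𝓡 N) x₀).symm z ∈ (chartAt (EuclideanSpace ℝ (Fin N)) x₀).source := by
    simpa using (extChartAt (𝓡 N) x₀).map_target hz
  have h := TangentBundle.symmL_trivializationAt (I := 𝓡 N) hs
  rw [ModelWithCorners.range_eq_univ, mfderivWithin_univ,
    (extChartAt (𝓡 N) x₀).right_inv hz] at h
  exact (congrArg (fun L ↦ L (EuclideanSpace.single i (1 : ℝ))) h).symm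

theorem continuousOn_volDensity (g : RMetric N M) (x₀ : M) :
    ContinuousOn (volDensity g x₀) (extChartAt (𝓡 N) x₀).target := by
  have h1 : ContinuousOn (fun y ↦ √(frameGram g x₀ y).det)
      (chartAt (EuclideanSpace ℝ (Fin N)) x₀).source := by
    rw [continuousOn_iff_continuous_domRestrict]
    refine Real.continuous_sqrt.comp (Continuous.matrix_det (continuous_matrix fun i j ↦ ?_))
    exact (continuousOn_inner_constSec g x₀ _ _).domRestrict
  have h2 := h1.comp (continuousOn_extChartAt_symm (I := 𝓡 N) x₀) fun z hz ↦ by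
    simpa using (extChartAt (𝓡 N) x₀).map_target hz
  refine h2.congr fun z hz ↦ ?_
  have : gram g x₀ z = frameGram g x₀ ((extChartAt (𝓡 N) x₀).symm z) := by
    ext i j
    simp [gram, frameGram, coordVec_eq x₀ hz]
  simp [volDensity, this]

/-- The Riemannian volume of a compact manifold is finite. -/
instance isFiniteMeasure_vol [T2Space M] [CompactSpace M] [MeasurableSpace M] [BorelSpace M]
    (g : RMetric N M) : IsFiniteMeasure (vol g) := by
  have hfin := (partition N M).locallyFinite.finite_nonempty_of_compact
  have hz : ∀ x₀ : M, x₀ ∉ hfin.toFinset →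
      (((volume : Measure (EuclideanSpace ℝ (Fin N))).restrict
        (extChartAt (𝓡 N) x₀).target).withDensity fun z ↦ ENNReal.ofReal
        (partition N M x₀ ((extChartAt (𝓡 N) x₀).symm z) * volDensity g x₀ z)).map
      (extChartAt (𝓡 N) x₀).symm univ = 0 := by
    intro x₀ hx₀
    have h0 : ∀ y, partition N M x₀ y = 0 := by
      simpa [Set.not_nonempty_iff_eq_empty, Function.support_eq_empty_iff, funext_iff] using hx₀
    simp [h0]
  have hf : ∀ x₀ : M, IsFiniteMeasure
      ((((volume : Measure (EuclideanSpace ℝ (Fin N))).restrict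
        (extChartAt (𝓡 N) x₀).target).withDensity fun z ↦ ENNReal.ofReal
        (partition N M x₀ ((extChartAt (𝓡 N) x₀).symm z) * volDensity g x₀ z)).map
      (extChartAt (𝓡 N) x₀).symm) := by
    intro x₀
    have hsub := (SmoothPartitionOfUnity.exists_isSubordinate_chartAt_source
      (𝓡 N) M).choose_spec x₀
    have hK : IsCompact (extChartAt (𝓡 N) x₀ '' tsupport (partition N M x₀)) :=
      (isClosed_tsupport _).isCompact.image_of_continuousOn
        ((continuousOn_extChartAt x₀).mono (by simpa [partition] using hsub))
    have hKt : extChartAt (𝓡 N) x₀ '' tsupport (partition N M x₀) ⊆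
        (extChartAt (𝓡 N) x₀).target := by
      rintro _ ⟨y, hy, rfl⟩
      exact (extChartAt (𝓡 N) x₀).map_source (by simpa using hsub hy)
    have hc : ContinuousOn (fun z ↦
        partition N M x₀ ((extChartAt (𝓡 N) x₀).symm z) * volDensity g x₀ z)
        (extChartAt (𝓡 N) x₀).target :=
      ((partition N M x₀).contMDiff.continuous.comp_continuousOn
        (continuousOn_extChartAt_symm x₀)).mul (continuousOn_volDensity g x₀)
    have hi := ((hc.mono hKt).integrableOn_compact hK
      (μ := (volume : Measure (EuclideanSpace ℝ (Fin N))))).of_forall_sdiff_eq_zero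
      (isOpen_extChartAt_target (I := 𝓡 N) x₀).measurableSet fun z hz ↦ by
        have : partition N M x₀ ((extChartAt (𝓡 N) x₀).symm z) = 0 := by
          refine image_eq_zero_of_notMem_tsupport fun h ↦ hz.2 ⟨_, h, ?_⟩
          exact (extChartAt (𝓡 N) x₀).right_inv hz.1
        rw [this, zero_mul]
    have := isFiniteMeasure_withDensity_ofReal hi.2
    infer_instance
  refine ⟨?_⟩
  rw [vol, Measure.sum_apply _ MeasurableSet.univ, tsum_eq_sum hz]
  exact ENNReal.sum_lt_top.2 fun x₀ _ ↦ (hf x₀).measure_univ_lt_top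

/-! ### The Sobolev space `H¹(M)` -/

/-- The space `C^∞(M)` of smooth real functions, which will carry the `H¹` norm of `g`. -/
def SmoothFn (_g : RMetric N M) : Type _ := ContMDiffMap (𝓡 N) 𝓘(ℝ, ℝ) M ℝ ∞

instance (g : RMetric N M) : AddCommGroup (SmoothFn g) :=
  inferInstanceAs (AddCommGroup (ContMDiffMap (𝓡 N) 𝓘(ℝ, ℝ) M ℝ ∞))

instance (g : RMetric N M) : Module ℝ (SmoothFn g) :=
  inferInstanceAs (Module ℝ (ContMDiffMap (𝓡 N) 𝓘(ℝ, ℝ) M ℝ ∞))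

/-- The function underlying an element of `C^∞(M)`. -/
def SmoothFn.fn {g : RMetric N M} (φ : SmoothFn g) : M → ℝ :=
  (show ContMDiffMap (𝓡 N) 𝓘(ℝ, ℝ) M ℝ ∞ from φ)

theorem SmoothFn.contMDiff {g : RMetric N M} (φ : SmoothFn g) :
    ContMDiff (𝓡 N) 𝓘(ℝ, ℝ) ∞ φ.fn :=
  ContMDiffMap.contMDiff _

theorem gradient_unique (g : RMetric N M) (φ : M → ℝ) (x : M) (X : TangentSpace (𝓡 N) x)
    (h : ∀ v : TangentSpace (𝓡 N) x,
      g.inner x X v = (mfderiv (𝓡 N) 𝓘(ℝ, ℝ) φ x : TangentSpace (𝓡 N) x →L[ℝ] ℝ) v) :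
    gradient g φ x = X := by
  by_contra hne
  have h1 := g.pos x (gradient g φ x - X) (sub_ne_zero.2 hne)
  have h2 : g.inner x (gradient g φ x) = g.inner x X :=
    ContinuousLinearMap.ext fun v ↦ (inner_gradient g φ x v).trans (h v).symm
  rw [map_sub (g.inner x), h2, sub_self] at h1
  exact h1.false

theorem gradient_add (g : RMetric N M) (φ ψ : SmoothFn g) (x : M) :
    gradient g (φ + ψ).fn x = gradient g φ.fn x + gradient g ψ.fn x := by
  refine gradient_unique g _ x _ fun v ↦ ?_
  rw [map_add, add_apply, inner_gradient, inner_gradient]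
  have h := mfderiv_add (φ.contMDiff.mdifferentiable (by simp) x)
    (ψ.contMDiff.mdifferentiable (by simp) x)
  exact (DFunLike.congr_fun h v).symm

theorem gradient_smul (g : RMetric N M) (c : ℝ) (φ : SmoothFn g) (x : M) :
    gradient g (c • φ).fn x = c • gradient g φ.fn x := by
  refine gradient_unique g _ x _ fun v ↦ ?_
  rw [map_smul, smul_apply, inner_gradient]
  have h := const_smul_mfderiv (φ.contMDiff.mdifferentiable (by simp) x) c
  exact (DFunLike.congr_fun h v).symm

theorem metric_self_nonneg (g : RMetric N M) (x : M) (v : TangentSpace (𝓡 N) x) :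
    0 ≤ g.inner x v v := by
  rcases eq_or_ne v 0 with rfl | hv
  · simp
  · exact (g.pos x v hv).le

variable [T2Space M] [CompactSpace M] [MeasurableSpace M] [BorelSpace M]

theorem integrable_of_continuous (g : RMetric N M) {f : M → ℝ} (hf : Continuous f) :
    Integrable f (vol g) :=
  hf.integrable_of_hasCompactSupport (HasCompactSupport.of_compactSpace f)

/-- The `H¹` scalar product `⟨φ, ψ⟩ = ∫ φ ψ dv_g + ∫ g(∇φ, ∇ψ) dv_g` of smooth functions. -/
def sobolevInner (g : RMetric N M) (φ ψ : SmoothFn g) : ℝ :=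
  ∫ x, φ.fn x * ψ.fn x ∂(vol g) + ∫ x, g.inner x (gradient g φ.fn x) (gradient g ψ.fn x) ∂(vol g)

/-- The positive semidefinite form underlying the `H¹` norm on `C^∞(M)`. -/
@[reducible] def sobolevCore (g : RMetric N M) : PreInnerProductSpace.Core ℝ (SmoothFn g) where
  inner := sobolevInner g
  conj_inner_symm φ ψ := by
    simp only [sobolevInner, conj_trivial]
    congr 1
    · exact integral_congr_ae (.of_forall fun x ↦ mul_comm _ _)
    · exact integral_congr_ae (.of_forall fun x ↦ g.symm x _ _)
  re_inner_nonneg φ := by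
    refine add_nonneg (integral_nonneg fun x ↦ mul_self_nonneg _) (integral_nonneg fun x ↦ ?_)
    exact metric_self_nonneg g x _
  add_left φ ψ χ := by
    have h1 : ∫ x, (φ + ψ).fn x * χ.fn x ∂(vol g) =
        ∫ x, φ.fn x * χ.fn x ∂(vol g) + ∫ x, ψ.fn x * χ.fn x ∂(vol g) := by
      rw [← integral_add]
      · exact integral_congr_ae (.of_forall fun x ↦ add_mul (φ.fn x) (ψ.fn x) (χ.fn x))
      · exact integrable_of_continuous g (φ.contMDiff.continuous.mul χ.contMDiff.continuous)
      · exact integrable_of_continuous g (ψ.contMDiff.continuous.mul χ.contMDiff.continuous)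
    have h2 : ∫ x, g.inner x (gradient g (φ + ψ).fn x) (gradient g χ.fn x) ∂(vol g) =
        ∫ x, g.inner x (gradient g φ.fn x) (gradient g χ.fn x) ∂(vol g) +
        ∫ x, g.inner x (gradient g ψ.fn x) (gradient g χ.fn x) ∂(vol g) := by
      rw [← integral_add]
      · exact integral_congr_ae (.of_forall fun x ↦ by simp [gradient_add])
      · exact integrable_of_continuous g (continuous_inner_gradient g φ.contMDiff χ.contMDiff)
      · exact integrable_of_continuous g (continuous_inner_gradient g ψ.contMDiff χ.contMDiff)
    simp only [sobolevInner, h1, h2]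
    ring
  smul_left φ ψ c := by
    have h1 : ∫ x, (c • φ).fn x * ψ.fn x ∂(vol g) = c * ∫ x, φ.fn x * ψ.fn x ∂(vol g) := by
      rw [← integral_const_mul]
      exact integral_congr_ae (.of_forall fun x ↦ mul_assoc c (φ.fn x) (ψ.fn x))
    have h2 : ∫ x, g.inner x (gradient g (c • φ).fn x) (gradient g ψ.fn x) ∂(vol g) =
        c * ∫ x, g.inner x (gradient g φ.fn x) (gradient g ψ.fn x) ∂(vol g) := by
      rw [← integral_const_mul]
      exact integral_congr_ae (.of_forall fun x ↦ by simp [gradient_smul])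
    simp only [sobolevInner, h1, h2, conj_trivial]
    ring

instance (g : RMetric N M) : SeminormedAddCommGroup (SmoothFn g) :=
  @InnerProductSpace.Core.toSeminormedAddCommGroup ℝ (SmoothFn g) _ _ _ (sobolevCore g)

instance (g : RMetric N M) : InnerProductSpace ℝ (SmoothFn g) :=
  InnerProductSpace.ofCore (sobolevCore g)

/-- The Sobolev space `H¹(M)`: the Hilbert space completion of `C^∞(M)` for the norm
`‖φ‖² = ∫ φ² dv_g + ∫ |∇φ|² dv_g`. Its elements are functions on `M` through `H1.fn` below. -/
abbrev H1 (g : RMetric N M) : Type _ := UniformSpace.Completion (SmoothFn g)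

theorem norm_sq_smoothFn (g : RMetric N M) (φ : SmoothFn g) :
    ‖φ‖ ^ 2 = ∫ x, φ.fn x ^ 2 ∂(vol g) +
      ∫ x, g.inner x (gradient g φ.fn x) (gradient g φ.fn x) ∂(vol g) := by
  rw [← real_inner_self_eq_norm_sq]
  simp only [sq]
  rfl

theorem memLp_smoothFn (g : RMetric N M) (φ : SmoothFn g) : MemLp φ.fn 2 (vol g) :=
  φ.contMDiff.continuous.memLp_of_hasCompactSupport (HasCompactSupport.of_compactSpace _)

theorem norm_sq_toLp (g : RMetric N M) (φ : SmoothFn g) :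
    ‖(memLp_smoothFn g φ).toLp‖ ^ 2 = ∫ x, φ.fn x ^ 2 ∂(vol g) := by
  rw [← real_inner_self_eq_norm_sq, L2.inner_def]
  refine integral_congr_ae ?_
  filter_upwards [(memLp_smoothFn g φ).coeFn_toLp] with x hx
  simp [hx, sq]

/-- The inclusion of `C^∞(M)`, with the `H¹` norm, into `L²(M)`. -/
def smoothToL2 (g : RMetric N M) : SmoothFn g →L[ℝ] Lp ℝ 2 (vol g) :=
  LinearMap.mkContinuous
    { toFun := fun φ ↦ (memLp_smoothFn g φ).toLp
      map_add' := fun φ ψ ↦ MemLp.toLp_add (memLp_smoothFn g φ) (memLp_smoothFn g ψ)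
      map_smul' := fun c φ ↦ MemLp.toLp_const_smul c (memLp_smoothFn g φ) } 1 fun φ ↦ by
    rw [one_mul]
    refine le_of_sq_le_sq ?_ (norm_nonneg _)
    change ‖(memLp_smoothFn g φ).toLp‖ ^ 2 ≤ _
    rw [norm_sq_toLp, norm_sq_smoothFn]
    exact le_add_of_nonneg_right (integral_nonneg fun x ↦ metric_self_nonneg g x _)

/-- The inclusion `H¹(M) → L²(M)`: the continuous extension of the inclusion of `C^∞(M)`. -/
def toL2 (g : RMetric N M) : H1 g →L[ℝ] Lp ℝ 2 (vol g) :=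
  (smoothToL2 g).extend UniformSpace.Completion.toComplL

theorem toL2_coe (g : RMetric N M) (φ : SmoothFn g) :
    toL2 g (φ : H1 g) = (memLp_smoothFn g φ).toLp :=
  ContinuousLinearMap.extend_eq (smoothToL2 g)
    UniformSpace.Completion.denseRange_coe
    (UniformSpace.Completion.isUniformInducing_coe _) φ

/-- The function (defined almost everywhere) underlying an element of `H¹(M)`. -/
def H1.fn {g : RMetric N M} (u : H1 g) : M → ℝ := toL2 g u

/-- The integral `∫ |∇u|² dv_g` of an element of `H¹(M)`, i.e. `‖u‖²_{H¹} - ‖u‖²_{L²}`. It is the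
continuous extension to `H¹(M)` of the Dirichlet integral of smooth functions. -/
def dirichlet (g : RMetric N M) (u : H1 g) : ℝ := ‖u‖ ^ 2 - ‖toL2 g u‖ ^ 2

theorem dirichlet_coe (g : RMetric N M) (φ : SmoothFn g) :
    dirichlet g (φ : H1 g) =
      ∫ x, g.inner x (gradient g φ.fn x) (gradient g φ.fn x) ∂(vol g) := by
  rw [dirichlet, UniformSpace.Completion.norm_coe, toL2_coe, norm_sq_toLp, norm_sq_smoothFn]
  ring

theorem continuous_dirichlet (g : RMetric N M) : Continuous (dirichlet g) := by
  unfold dirichlet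
  fun_prop

/-! ### The energy and the constraint -/

/-- The energy `E_ε(u) = ε/2 ∫ |∇u|² dv_g + 1/ε ∫ W(u) dv_g`. -/
def energy (g : RMetric N M) (W : ℝ → ℝ) (ε : ℝ) (u : H1 g) : ℝ :=
  ε / 2 * dirichlet g u + 1 / ε * ∫ x, W (H1.fn u x) ∂(vol g)

/-- The constraint manifold `𝔐^V = {u ∈ H¹(M) : ∫ u dv_g = V}`, an affine subspace of `H¹(M)`. -/
def constraint (g : RMetric N M) (V : ℝ) : AffineSubspace ℝ (H1 g) where
  carrier := {u | ∫ x, H1.fn u x ∂(vol g) = V}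
  smul_vsub_vadd_mem' := by
    intro c u v w hu hv hw
    have hi (u : H1 g) : Integrable (H1.fn u) (vol g) :=
      (Lp.memLp (toL2 g u)).integrable (by norm_num)
    have h : H1.fn (c • (u -ᵥ v) +ᵥ w) =ᵐ[vol g]
        fun x ↦ c * (H1.fn u x - H1.fn v x) + H1.fn w x := by
      simp only [H1.fn, vsub_eq_sub, vadd_eq_add, map_add, map_smul, map_sub]
      filter_upwards [Lp.coeFn_add (c • (toL2 g u - toL2 g v)) (toL2 g w),
        Lp.coeFn_smul c (toL2 g u - toL2 g v), Lp.coeFn_sub (toL2 g u) (toL2 g v)] with x h1 h2 h3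
      rw [h1, Pi.add_apply, h2, Pi.smul_apply, h3, Pi.sub_apply, smul_eq_mul]
    change ∫ x, H1.fn u x ∂(vol g) = V at hu
    change ∫ x, H1.fn v x ∂(vol g) = V at hv
    change ∫ x, H1.fn w x ∂(vol g) = V at hw
    change ∫ x, H1.fn (c • (u -ᵥ v) +ᵥ w) x ∂(vol g) = V
    have h1 : ∫ x, (H1.fn u x - H1.fn v x) ∂(vol g) = V - V :=
      (integral_sub (hi u) (hi v)).trans (congrArg₂ (· - ·) hu hv)
    have h2 : Integrable (fun x ↦ c * (H1.fn u x - H1.fn v x)) (vol g) :=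
      ((hi u).sub (hi v)).const_mul c
    rw [integral_congr_ae h, integral_add h2 (hi w), integral_const_mul, h1, hw]
    ring

end Riemannian

section PalaisSmale

variable {H : Type*} [NormedAddCommGroup H] [InnerProductSpace ℝ H]

/-- The differential `dJ(u) ∈ T_u^* A` of a functional `J` on an affine subspace `A` of a Hilbert
space: `T_u A` is the direction of `A`, with the norm of `H`, and `w ↦ u + w` is a chart of `A`. -/
def differential (A : AffineSubspace ℝ H) (J : A → ℝ) (u : A) : A.direction →L[ℝ] ℝ :=
  fderiv ℝ (fun w : A.direction ↦
    J ⟨(w : H) +ᵥ (u : H), A.vadd_mem_of_mem_direction w.2 u.2⟩) 0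

/-- Palais–Smale sequences of `J`: `J(u_n) → c` for some `c ∈ ℝ`, and `‖dJ(u_n)‖ → 0` in the dual
norms of the tangent spaces. -/
def IsPalaisSmaleSeq (A : AffineSubspace ℝ H) (J : A → ℝ) (u : ℕ → A) : Prop :=
  (∃ c : ℝ, Tendsto (fun n ↦ J (u n)) atTop (𝓝 c)) ∧
    Tendsto (fun n ↦ ‖differential A J (u n)‖) atTop (𝓝 0)

/-- The Palais–Smale condition: each Palais–Smale sequence has a subsequence that converges
in `A`. -/
def PalaisSmale (A : AffineSubspace ℝ H) (J : A → ℝ) : Prop :=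
  ∀ u : ℕ → A, IsPalaisSmaleSeq A J u →
    ∃ (v : A) (k : ℕ → ℕ), StrictMono k ∧ Tendsto (fun n ↦ u (k n)) atTop (𝓝 v)

end PalaisSmale

/-- The assumptions on the double well potential `W : ℝ → [0, ∞)`, in dimension `N`. The critical
exponent `2* = 2N / (N - 2)` is `∞` for `N ≤ 2`, so that bounds by it are only imposed
for `3 ≤ N`. -/
structure DoubleWell (N : ℕ) (W : ℝ → ℝ) : Prop where
  contDiff : ContDiff ℝ 2 W
  nonneg : ∀ s, 0 ≤ W s
  globalMin : ∀ s, (∀ t, W s ≤ W t) ↔ s = 0 ∨ s = 1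
  localMax : ∀ s, IsLocalMax W s ↔ s = 1 / 2
  zero_zero : W 0 = 0
  deriv_zero : deriv W 0 = 0
  zero_one : W 1 = 0
  deriv_one : deriv W 1 = 0
  deriv2_zero : 0 < iteratedDeriv 2 W 0
  deriv2_one : 0 < iteratedDeriv 2 W 1
  /-- subcritical growth: `|W'(s)| ≤ A + B |s|^(p-1)` for some `p < 2*` -/
  growth : ∃ p A B : ℝ, (3 ≤ N → p < 2 * N / ((N : ℝ) - 2)) ∧ 0 < A ∧ 0 < B ∧
    ∀ s, |deriv W s| ≤ A + B * |s| ^ (p - 1)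
  barrier : ∃ δ > 0, ∀ s ∈ Ioc (1 : ℝ) (1 + δ), 0 < deriv W s
  /-- `c₁|t|^p₁ < W(t) < c₂|t|^p₂` for `|t| ≥ t₀`, with `2 < p₁ < 2*/2 + 1` and
  `p₁ ≤ p₂ ≤ 2(p₁ - 1)` -/
  bounds : ∃ c₁ c₂ t₀ p₁ p₂ : ℝ, 0 < c₁ ∧ 0 < c₂ ∧ 0 < t₀ ∧ 2 < p₁ ∧
    (3 ≤ N → p₁ < 1 / 2 * (2 * N / ((N : ℝ) - 2)) + 1) ∧ p₁ ≤ p₂ ∧ p₂ ≤ 2 * (p₁ - 1) ∧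
    ∀ t, t₀ ≤ |t| → c₁ * |t| ^ p₁ < W t ∧ W t < c₂ * |t| ^ p₂

end CahnHilliard

end

noncomputable section

namespace CahnHilliard

/-! ### Translation estimates and a quantitative Rellich inequality in Euclidean space. -/

section Euclidean

open scoped ENNReal NNReal

/-! The growth exponent of W' may be enlarged, so one can fix 2 < p < q with q subcritical and
|W'(s)| ≤ C(1 + |s|^(p-1)) (`DoubleWell.exists_exponents`). The energy then factors as ε/2 times the
Dirichlet integral plus Φ(T u), where T : H¹ → L^p is the Sobolev embedding (`exists_clm_toLp`) and
Φ is a multiple of the integral functional of W, which is C¹ on L^p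
(`contDiff_one_integral_superposition`). Integrability of W(u) and C¹ regularity follow at once.

For the Palais–Smale condition, the superquadratic lower bound on W at infinity makes energy
sublevels bounded in H¹ (`norm_le_of_energy_le`). By Rellich (`exists_subseq_cauchySeq_toL2`) a
subsequence is Cauchy in L², and by interpolation against the L^q bound it is Cauchy in L^p
(`cauchySeq_toLp_of_cauchySeq_toL2`). Hence Φ'(T u_n) is Cauchy in the dual of L^p. The difference w
= u_n - u_m is tangent to the constraint, and evaluating dJ(u_n) - dJ(u_m) on w gives ε times the
Dirichlet integral of w plus a term controlled by Φ'(T u_n) - Φ'(T u_m). So the gradients are Cauchy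
too, and the sequence converges in H¹ to a point of the closed constraint
(`palaisSmale_of_compact`).

The Sobolev and Rellich theorems on M are reduced to Euclidean space by the partition of unity that
defines the volume. Only upper bounds between the volume and the chart Lebesgue measures on compact
sets, in both directions, are needed (`exists_vol_restrict_le`, `exists_chartMeasure_restrict_le`).
Rellich is carried by an inequality rather than by sequences: the L² norm is at most η times the H¹
norm plus a combination of finitely many continuous functionals (`HasCompactBound`), namely
integrals over small balls in the charts. Such bounds pass through finite sums and imply total
boundedness of images of balls. -/

theorem sq_lintegral_le {α : Type*} [MeasurableSpace α] (μ : Measure α) {f : α → ℝ≥0∞}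
    (hf : AEMeasurable f μ) : (∫⁻ x, f x ∂μ) ^ 2 ≤ μ univ * ∫⁻ x, f x ^ 2 ∂μ := by
  have h := ENNReal.lintegral_mul_le_Lp_mul_Lq μ Real.HolderConjugate.two_two
    (aemeasurable_const (b := (1 : ℝ≥0∞))) hf
  simp only [Pi.mul_apply, one_mul, ENNReal.rpow_two, one_pow, lintegral_one] at h
  calc (∫⁻ x, f x ∂μ) ^ 2
      ≤ (μ univ ^ (1 / 2 : ℝ) * (∫⁻ x, f x ^ 2 ∂μ) ^ (1 / 2 : ℝ)) ^ 2 := by gcongr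
    _ = μ univ * ∫⁻ x, f x ^ 2 ∂μ := by
      rw [mul_pow, ← ENNReal.rpow_natCast, ← ENNReal.rpow_mul, ← ENNReal.rpow_natCast,
        ← ENNReal.rpow_mul]
      norm_num

theorem add_sq_le_two_mul (a b : ℝ≥0∞) : (a + b) ^ 2 ≤ 2 * a ^ 2 + 2 * b ^ 2 := by
  have h := ENNReal.rpow_add_le_mul_rpow_add_rpow a b (p := 2) (by norm_num)
  norm_num [ENNReal.rpow_two] at h
  rw [mul_add] at h
  exact h

variable {E : Type*} [NormedAddCommGroup E] [NormedSpace ℝ E]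

/-- The fundamental theorem of calculus along the segment from x to x + k, then Cauchy–Schwarz on
the unit interval. -/
theorem enorm_sub_sq_le_lintegral_fderiv {f : E → ℝ} (hf : ContDiff ℝ 1 f) (x k : E) :
    ‖f (x + k) - f x‖ₑ ^ 2 ≤
      ‖k‖ₑ ^ 2 * ∫⁻ t in Ioc (0 : ℝ) 1, ‖fderiv ℝ f (x + t • k)‖ₑ ^ 2 := by
  have hc : Continuous (fderiv ℝ f) := hf.continuous_fderiv (by simp)
  have hd (t : ℝ) : HasDerivAt (fun t : ℝ ↦ f (x + t • k)) (fderiv ℝ f (x + t • k) k) t := by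
    have h1 : HasDerivAt (fun t : ℝ ↦ x + t • k) k t := by
      simpa using ((hasDerivAt_id t).smul_const k).const_add x
    exact ((hf.differentiable (by simp)) (x + t • k)).hasFDerivAt.comp_hasDerivAt t h1
  have hint : IntervalIntegrable (fun t : ℝ ↦ fderiv ℝ f (x + t • k) k) volume 0 1 :=
    Continuous.intervalIntegrable (by fun_prop) _ _
  have h := intervalIntegral.integral_eq_sub_of_hasDerivAt (fun t _ ↦ hd t) hint
  simp only [one_smul, zero_smul, add_zero] at h
  rw [← h, intervalIntegral.integral_of_le zero_le_one]
  have hm : Measurable fun t : ℝ ↦ ‖fderiv ℝ f (x + t • k)‖ₑ := by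
    have : Continuous fun t : ℝ ↦ fderiv ℝ f (x + t • k) := by fun_prop
    exact this.enorm.measurable
  calc ‖∫ t in Ioc (0 : ℝ) 1, fderiv ℝ f (x + t • k) k‖ₑ ^ 2
      ≤ (∫⁻ t in Ioc (0 : ℝ) 1, ‖k‖ₑ * ‖fderiv ℝ f (x + t • k)‖ₑ) ^ 2 := by
        gcongr
        refine (enorm_integral_le_lintegral_enorm _).trans (lintegral_mono fun t ↦ ?_)
        rw [mul_comm]
        exact (fderiv ℝ f (x + t • k)).le_opENorm k
    _ ≤ _ := by
        rw [lintegral_const_mul _ hm, mul_pow]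
        gcongr
        refine (sq_lintegral_le _ hm.aemeasurable).trans ?_
        simp

variable [MeasurableSpace E] [BorelSpace E] [FiniteDimensional ℝ E]
  (μ : Measure E) [μ.IsAddHaarMeasure]

/-- Integrate the segment estimate in x and exchange the integrals; translation invariance removes
the shift t • k. -/
theorem lintegral_translate_sub_sq_le {f : E → ℝ} (hf : ContDiff ℝ 1 f) (k : E) :
    ∫⁻ x, ‖f (x + k) - f x‖ₑ ^ 2 ∂μ ≤ ‖k‖ₑ ^ 2 * ∫⁻ x, ‖fderiv ℝ f x‖ₑ ^ 2 ∂μ := by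
  have hc : Continuous (fderiv ℝ f) := hf.continuous_fderiv (by simp)
  have hj : Measurable fun p : E × ℝ ↦ ‖fderiv ℝ f (p.1 + p.2 • k)‖ₑ ^ 2 := by
    have : Continuous fun p : E × ℝ ↦ fderiv ℝ f (p.1 + p.2 • k) := by fun_prop
    exact this.enorm.measurable.pow_const 2
  calc ∫⁻ x, ‖f (x + k) - f x‖ₑ ^ 2 ∂μ
      ≤ ∫⁻ x, (‖k‖ₑ ^ 2 * ∫⁻ t in Ioc (0 : ℝ) 1, ‖fderiv ℝ f (x + t • k)‖ₑ ^ 2) ∂μ :=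
        lintegral_mono fun x ↦ enorm_sub_sq_le_lintegral_fderiv hf x k
    _ = ‖k‖ₑ ^ 2 * ∫⁻ t in Ioc (0 : ℝ) 1, (∫⁻ x, ‖fderiv ℝ f (x + t • k)‖ₑ ^ 2 ∂μ) := by
        rw [lintegral_const_mul _ hj.lintegral_prod_right', lintegral_lintegral_swap hj.aemeasurable]
    _ = ‖k‖ₑ ^ 2 * ∫⁻ x, ‖fderiv ℝ f x‖ₑ ^ 2 ∂μ := by
        have (t : ℝ) := lintegral_add_right_eq_self (μ := μ) (fun x ↦ ‖fderiv ℝ f x‖ₑ ^ 2) (t • k)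
        simp [this]

/-- Write the measure of the ball times f(x) as the integral over y of f(x) - f(y) plus the integral
of f(y). The first part is handled by Cauchy–Schwarz and the substitution y = x + k, since the ball
around s lies in the ball of twice the radius around x. -/
theorem enorm_sq_le_of_mem_ball {f : E → ℝ} (hf : ContDiff ℝ 1 f) {s x : E} {r : ℝ}
    (hx : x ∈ Metric.ball s r) :
    μ (Metric.ball 0 r) ^ 2 * ‖f x‖ₑ ^ 2 ≤
      2 * (μ (Metric.ball 0 r) * ∫⁻ k in Metric.ball 0 (2 * r), ‖f (x + k) - f x‖ₑ ^ 2 ∂μ) +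
      2 * ‖∫ y in Metric.ball s r, f y ∂μ‖ₑ ^ 2 := by
  have hμ : μ (Metric.ball s r) = μ (Metric.ball 0 r) := Measure.addHaar_ball_center μ s r
  have hfin : μ (Metric.ball s r) ≠ ⊤ := measure_ball_lt_top.ne
  have hi : IntegrableOn f (Metric.ball s r) μ :=
    (hf.continuous.continuousOn.integrableOn_compact
      (isCompact_closedBall s r)).mono_set Metric.ball_subset_closedBall
  have hc : IntegrableOn (fun _ ↦ f x) (Metric.ball s r) μ := integrableOn_const hfin
  have h1 : μ.real (Metric.ball s r) * f x =
      ∫ y in Metric.ball s r, (f x - f y) ∂μ + ∫ y in Metric.ball s r, f y ∂μ := by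
    rw [integral_sub hc hi]
    simp
  have h2 : μ (Metric.ball 0 r) * ‖f x‖ₑ = ‖μ.real (Metric.ball s r) * f x‖ₑ := by
    rw [enorm_mul, Measure.real, Real.enorm_of_nonneg ENNReal.toReal_nonneg,
      ENNReal.ofReal_toReal hfin, hμ]
  rw [← mul_pow, h2, h1]
  refine (pow_le_pow_left₀ zero_le (enorm_add_le _ _) 2).trans
    ((add_sq_le_two_mul _ _).trans ?_)
  gcongr
  have hm : Continuous fun y ↦ f x - f y := by
    have := hf.continuous
    fun_prop
  calc ‖∫ y in Metric.ball s r, (f x - f y) ∂μ‖ₑ ^ 2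
      ≤ (∫⁻ y in Metric.ball s r, ‖f x - f y‖ₑ ∂μ) ^ 2 := by
        gcongr
        exact enorm_integral_le_lintegral_enorm _
    _ ≤ μ (Metric.ball 0 r) * ∫⁻ y in Metric.ball s r, ‖f x - f y‖ₑ ^ 2 ∂μ := by
        refine (sq_lintegral_le _ hm.enorm.measurable.aemeasurable).trans ?_
        rw [Measure.restrict_apply_univ, hμ]
    _ ≤ _ := by
        refine mul_le_mul' le_rfl ?_
        have hsub : Metric.ball s r ⊆ Metric.ball x (2 * r) := fun y hy ↦ by
          rw [Metric.mem_ball] at *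
          have := dist_triangle_right y x s
          linarith
        refine (lintegral_mono_set hsub).trans ?_
        rw [← lintegral_indicator Metric.isOpen_ball.measurableSet,
          ← lintegral_indicator Metric.isOpen_ball.measurableSet,
          ← lintegral_add_left_eq_self _ x]
        refine lintegral_mono fun k ↦ ?_
        by_cases hk : k ∈ Metric.ball (0 : E) (2 * r)
        · have hk' : x + k ∈ Metric.ball x (2 * r) := by simpa using hk
          rw [indicator_of_mem hk, indicator_of_mem hk', ← enorm_neg, neg_sub]
        · have hk' : x + k ∉ Metric.ball x (2 * r) := by simpa using hk
          rw [indicator_of_notMem hk, indicator_of_notMem hk']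

/-- A quantitative form of the local Rellich theorem: up to a small multiple of the Dirichlet
integral, the `L²` norm is controlled by finitely many averages over balls. -/
theorem exists_lintegral_sq_le_fderiv_add_sum {K : Set E} (hK : IsCompact K) {η : ℝ}
    (hη : 0 < η) : ∃ (S : Finset E) (r : ℝ) (C : ℝ≥0), ∀ f : E → ℝ, ContDiff ℝ 1 f →
      Function.support f ⊆ K →
      ∫⁻ x, ‖f x‖ₑ ^ 2 ∂μ ≤ ENNReal.ofReal η * ∫⁻ x, ‖fderiv ℝ f x‖ₑ ^ 2 ∂μ +
        C * ∑ s ∈ S, ‖∫ y in Metric.ball s r, f y ∂μ‖ₑ ^ 2 := by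
  set d := Module.finrank ℝ E
  -- The factor 8 · 2^d · r² is what the Dirichlet integral acquires below: 2 from squaring a sum,
  -- (2r)² from the shift, and 2^d from the ratio of the volumes of the balls of radius 2r and r.
  obtain ⟨r, hr, hrη⟩ : ∃ r : ℝ, 0 < r ∧ 8 * 2 ^ d * r ^ 2 ≤ η := by
    refine ⟨√(η / (8 * 2 ^ d)), by positivity, ?_⟩
    rw [Real.sq_sqrt (by positivity)]
    field_simp
    rfl
  obtain ⟨S, -, hS⟩ := hK.elim_nhds_subcover (fun x ↦ Metric.ball x r)
    fun x _ ↦ Metric.ball_mem_nhds x hr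
  set m := μ (Metric.ball 0 r)
  have hm0 : m ≠ 0 := (Metric.measure_ball_pos μ 0 hr).ne'
  have hmt : m ≠ ⊤ := measure_ball_lt_top.ne
  have hm2 : μ (Metric.ball 0 (2 * r)) = 2 ^ d * m := by
    have := Measure.addHaar_ball_mul_of_pos μ (0 : E) (r := 2) (by norm_num) r
    rw [this, ENNReal.ofReal_pow (by norm_num)]
    norm_num
    rfl
  have hC : 2 * μ K / m ^ 2 ≠ ⊤ := by
    refine ENNReal.div_ne_top (ENNReal.mul_ne_top (by norm_num) hK.measure_lt_top.ne) ?_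
    positivity
  refine ⟨S, r, (2 * μ K / m ^ 2).toNNReal, fun f hf hfK ↦ ?_⟩
  rw [ENNReal.coe_toNNReal hC]
  set D := ∫⁻ x, ‖fderiv ℝ f x‖ₑ ^ 2 ∂μ
  set A := ∑ s ∈ S, ‖∫ y in Metric.ball s r, f y ∂μ‖ₑ ^ 2
  have hfc := hf.continuous
  have hj : Measurable fun p : E × E ↦ ‖f (p.1 + p.2) - f p.1‖ₑ ^ 2 := by
    have : Continuous fun p : E × E ↦ f (p.1 + p.2) - f p.1 := by fun_prop
    exact this.enorm.measurable.pow_const 2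
  have hpt : ∀ x ∈ K, m ^ 2 * ‖f x‖ₑ ^ 2 ≤
      2 * (m * ∫⁻ k in Metric.ball 0 (2 * r), ‖f (x + k) - f x‖ₑ ^ 2 ∂μ) + 2 * A := by
    intro x hx
    obtain ⟨s, hs, hxs⟩ := mem_iUnion₂.1 (hS hx)
    refine (enorm_sq_le_of_mem_ball μ hf hxs).trans ?_
    gcongr
    exact Finset.single_le_sum (f := fun s ↦ ‖∫ y in Metric.ball s r, f y ∂μ‖ₑ ^ 2)
      (fun _ _ ↦ zero_le) hs
  have hjm : Measurable fun x ↦ ∫⁻ k in Metric.ball 0 (2 * r), ‖f (x + k) - f x‖ₑ ^ 2 ∂μ :=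
    hj.lintegral_prod_right'
  -- After exchanging the integrals, every shift k of length below 2r costs at most (2r)² times the
  -- Dirichlet integral, and these shifts fill a ball of measure 2^d m.
  have hdouble : ∫⁻ x, ∫⁻ k in Metric.ball 0 (2 * r), ‖f (x + k) - f x‖ₑ ^ 2 ∂μ ∂μ ≤
      ENNReal.ofReal (2 * r) ^ 2 * D * (2 ^ d * m) := by
    rw [lintegral_lintegral_swap hj.aemeasurable, ← hm2, ← setLIntegral_const]
    refine setLIntegral_mono measurable_const fun k hk ↦ ?_
    refine (lintegral_translate_sub_sq_le μ hf k).trans ?_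
    gcongr
    rw [← ofReal_norm]
    gcongr
    simpa using (mem_ball_zero_iff.1 hk).le
  have hmain : m ^ 2 * ∫⁻ x, ‖f x‖ₑ ^ 2 ∂μ ≤
      2 * (m * (ENNReal.ofReal (2 * r) ^ 2 * D * (2 ^ d * m))) + 2 * A * μ K := by
    have hfm : Measurable fun x ↦ ‖f x‖ₑ ^ 2 := hfc.enorm.measurable.pow_const 2
    rw [← setLIntegral_eq_of_support_subset (s := K) (fun x hx ↦ hfK fun h0 ↦ hx (by simp [h0])),
      ← lintegral_const_mul _ hfm]
    refine (setLIntegral_mono' hK.measurableSet hpt).trans ?_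
    rw [lintegral_add_right _ measurable_const, setLIntegral_const]
    gcongr
    rw [lintegral_const_mul _ (hjm.const_mul _), lintegral_const_mul _ hjm]
    gcongr
    exact (setLIntegral_le_lintegral _ _).trans hdouble
  have hm20 : m ^ 2 ≠ 0 := by positivity
  have hm2t : m ^ 2 ≠ ⊤ := ENNReal.pow_ne_top hmt
  rw [← ENNReal.mul_le_mul_iff_right hm20 hm2t]
  refine hmain.trans ?_
  rw [mul_add]
  refine add_le_add ?_ (le_of_eq ?_)
  · have : ENNReal.ofReal (2 * r) ^ 2 * (2 * 2 ^ d) ≤ ENNReal.ofReal η := by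
      have h2 : (2 * 2 ^ d : ℝ≥0∞) = ENNReal.ofReal (2 * 2 ^ d) := by
        rw [ENNReal.ofReal_mul (by norm_num), ENNReal.ofReal_pow (by norm_num)]
        norm_num
      rw [h2, ← ENNReal.ofReal_pow (by positivity), ← ENNReal.ofReal_mul (by positivity)]
      refine ENNReal.ofReal_le_ofReal (le_trans (le_of_eq ?_) hrη)
      ring
    calc 2 * (m * (ENNReal.ofReal (2 * r) ^ 2 * D * (2 ^ d * m)))
        = m ^ 2 * ((ENNReal.ofReal (2 * r) ^ 2 * (2 * 2 ^ d)) * D) := by ring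
      _ ≤ _ := by gcongr
  · rw [← mul_assoc, ENNReal.mul_div_cancel hm20 hm2t]
    ring

end Euclidean

/-! ### Subcritical Sobolev inequalities for functions supported in a fixed compact set. -/

section EuclideanSobolev

open scoped ENNReal NNReal

theorem support_fderiv_subset_of_isClosed {E : Type*} [NormedAddCommGroup E] [NormedSpace ℝ E]
    {f : E → ℝ} {K : Set E} (hK : IsClosed K) (hf : Function.support f ⊆ K) :
    Function.support (fderiv ℝ f) ⊆ K :=
  (support_fderiv_subset ℝ).trans (closure_minimal hf hK)

/-- The derivative is also supported in the closed set K, which has finite measure, so Hölder's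
inequality applies on K. -/
theorem eLpNorm_fderiv_le_of_le {E : Type*} [NormedAddCommGroup E] [NormedSpace ℝ E]
    [MeasurableSpace E] [BorelSpace E] [FiniteDimensional ℝ E] (μ : Measure E)
    [IsFiniteMeasureOnCompacts μ] {K : Set E} (hK : IsCompact K)
    {p : ℝ≥0∞} (hp : 1 ≤ p) (hp2 : p ≤ 2) : ∃ C : ℝ≥0, ∀ f : E → ℝ, ContDiff ℝ 1 f →
      Function.support f ⊆ K → eLpNorm (fderiv ℝ f) p μ ≤ C * eLpNorm (fderiv ℝ f) 2 μ := by
  have hexp : 0 ≤ 1 / p.toReal - 1 / (2 : ℝ≥0∞).toReal := by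
    have h1 : 1 ≤ p.toReal := by
      simpa using ENNReal.toReal_mono (hp2.trans_lt ENNReal.ofNat_lt_top).ne hp
    have h2 : p.toReal ≤ (2 : ℝ≥0∞).toReal := ENNReal.toReal_mono ENNReal.ofNat_ne_top hp2
    rw [sub_nonneg]
    exact one_div_le_one_div_of_le (by linarith) h2
  generalize hc : 1 / p.toReal - 1 / (2 : ℝ≥0∞).toReal = c at hexp
  refine ⟨(μ K ^ c).toNNReal, fun f hf hfK ↦ ?_⟩
  rw [ENNReal.coe_toNNReal (ENNReal.rpow_ne_top_of_nonneg hexp hK.measure_lt_top.ne), mul_comm]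
  have hs := support_fderiv_subset_of_isClosed hK.isClosed hfK
  have hr (p : ℝ≥0∞) : eLpNorm (fderiv ℝ f) p μ = eLpNorm (fderiv ℝ f) p (μ.restrict K) := by
    rw [← eLpNorm_norm, ← eLpNorm_norm (fderiv ℝ f)]
    exact (eLpNorm_restrict_eq_of_support_subset fun x hx ↦ hs fun h0 ↦ hx (by simp [h0])).symm
  have := eLpNorm_le_eLpNorm_mul_rpow_measure_univ (μ := μ.restrict K) hp2
    (hf.continuous_fderiv (by simp)).aestronglyMeasurable
  rw [Measure.restrict_apply_univ, hc] at this
  rw [hr p, hr 2]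
  exact this

theorem enorm_le_eLpNorm_fderiv_one {f : EuclideanSpace ℝ (Fin 1) → ℝ} (hf : ContDiff ℝ 1 f)
    (hc : HasCompactSupport f) (x : EuclideanSpace ℝ (Fin 1)) :
    ‖f x‖ₑ ≤ eLpNorm (fderiv ℝ f) 1 volume := by
  set e : ℝ ≃ₗᵢ[ℝ] EuclideanSpace ℝ (Fin 1) := (OrthonormalBasis.singleton (Fin 1) ℝ).repr
  have hfe : ContDiff ℝ 1 (f ∘ e) := hf.comp e.contDiff
  have hce : HasCompactSupport (f ∘ e) := hc.comp_homeomorph e.toHomeomorph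
  have h := hce.enorm_le_lintegral_Ici_deriv hfe (e.symm x)
  simp only [Function.comp_apply, e.apply_symm_apply] at h
  refine h.trans ((setLIntegral_le_lintegral _ _).trans ?_)
  rw [eLpNorm_one_eq_lintegral_enorm, ← e.measurePreserving.lintegral_comp
    (hf.continuous_fderiv (by simp)).enorm.measurable]
  refine lintegral_mono fun t ↦ ?_
  have hd : HasDerivAt (f ∘ e) (fderiv ℝ f (e t) (e 1)) t := by
    have h2 : HasDerivAt e (e 1) t := by
      simpa using e.toContinuousLinearEquiv.toContinuousLinearMap.hasFDerivAt.hasDerivAt (x := t)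
    exact ((hf.differentiable (by simp)) (e t)).hasFDerivAt.comp_hasDerivAt t h2
  rw [hd.deriv]
  refine ((fderiv ℝ f (e t)).le_opENorm _).trans ?_
  have : ‖e 1‖ₑ = 1 := by rw [← ofReal_norm, e.norm_map]; simp
  rw [this, mul_one]

/-- The Sobolev inequality for functions supported in a given compact set, with an exponent
below the critical one. -/
theorem exists_eLpNorm_le_eLpNorm_fderiv {N : ℕ} (hN : 1 ≤ N)
    {K : Set (EuclideanSpace ℝ (Fin N))} (hK : IsCompact K) {q : ℝ≥0} (hq2 : 2 ≤ q)
    (hq : 3 ≤ N → (q : ℝ) < 2 * N / ((N : ℝ) - 2)) :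
    ∃ C : ℝ≥0, ∀ f : EuclideanSpace ℝ (Fin N) → ℝ, ContDiff ℝ 1 f → Function.support f ⊆ K →
      eLpNorm f q volume ≤ C * eLpNorm (fderiv ℝ f) 2 volume := by
  have hq0 : (2 : ℝ) ≤ q := by exact_mod_cast hq2
  obtain rfl | rfl | hN3 : N = 1 ∨ N = 2 ∨ 3 ≤ N := by omega
  · obtain ⟨C, hC⟩ := eLpNorm_fderiv_le_of_le volume hK (p := 1) le_rfl (by norm_num)
    refine ⟨C * (volume K ^ (1 / (q : ℝ))).toNNReal, fun f hf hfK ↦ ?_⟩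
    rw [ENNReal.coe_mul, ENNReal.coe_toNNReal
      (ENNReal.rpow_ne_top_of_nonneg (by positivity) hK.measure_lt_top.ne)]
    have hc : HasCompactSupport f := HasCompactSupport.of_support_subset_isCompact hK hfK
    rw [← eLpNorm_restrict_eq_of_support_subset (s := K) hfK]
    calc eLpNorm f q (volume.restrict K)
        ≤ eLpNorm f ⊤ (volume.restrict K) * volume K ^ (1 / (q : ℝ)) := by
          simpa using eLpNorm_le_eLpNorm_mul_rpow_measure_univ (μ := volume.restrict K)
            (p := (q : ℝ≥0∞)) (q := ⊤) le_top hf.continuous.aestronglyMeasurable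
      _ ≤ (C * eLpNorm (fderiv ℝ f) 2 volume) * volume K ^ (1 / (q : ℝ)) := by
          gcongr
          refine le_trans ?_ (hC f hf hfK)
          rw [eLpNorm_exponent_top]
          exact essSup_le_of_ae_le _ (.of_forall fun x ↦ enorm_le_eLpNorm_fderiv_one hf hc x)
      _ = _ := by ring
  -- In dimension 2 the exponent 2 is itself critical. This p solves 1/p - 1/2 = 1/q, so it is below
  -- 2 and has Sobolev conjugate q; compactness of K pays for the passage from the L^p to the L²
  -- norm of the derivative.
  · set p : ℝ≥0 := 2 * q / (q + 2)
    have hpr : (p : ℝ) = 2 * q / (q + 2) := by simp [p]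
    have hp1 : 1 ≤ p := by
      rw [← NNReal.coe_le_coe, hpr, NNReal.coe_one, le_div_iff₀ (by positivity)]
      linarith
    have hp2 : p < 2 := by
      rw [← NNReal.coe_lt_coe, hpr, div_lt_iff₀ (by positivity)]
      norm_num
    obtain ⟨C, hC⟩ := eLpNorm_fderiv_le_of_le volume hK (p := p) (by exact_mod_cast hp1)
      (by exact_mod_cast hp2.le)
    refine ⟨eLpNormLESNormFDerivOfLeConst ℝ volume K p q * C, fun f hf hfK ↦ ?_⟩
    refine (eLpNorm_le_eLpNorm_fderiv_of_le volume hf hfK hp1 (by simpa using hp2) ?_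
      hK.isBounded).trans ?_
    · rw [NNReal.coe_inv, hpr]
      simp
      field_simp
      linarith
    · rw [ENNReal.coe_mul, mul_assoc]
      gcongr
      exact hC f hf hfK
  -- For N ≥ 3 the gradient exponent 2 is below N, and the bound on q rearranges to 1/2 - 1/N ≤ 1/q.
  · refine ⟨eLpNormLESNormFDerivOfLeConst ℝ volume K 2 q, fun f hf hfK ↦ ?_⟩
    refine eLpNorm_le_eLpNorm_fderiv_of_le volume hf hfK (p := 2) (by norm_num)
      (by simp; exact_mod_cast hN3) ?_ hK.isBounded
    have hN' : (3 : ℝ) ≤ N := by exact_mod_cast hN3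
    have h := hq hN3
    rw [lt_div_iff₀ (by linarith)] at h
    simp
    field_simp
    linarith

end EuclideanSobolev

/-! ### Superposition operators on L^P and differentiability of integral functionals. -/

section Nemytskii

open scoped ENNReal NNReal

/-- With m = max(1, |a|, |b|) the growth bound becomes |x| ≤ 3C m^(P-1), and (P - 1)Q = P for
conjugate exponents. -/
theorem abs_rpow_conj_le {P Q : ℝ} (h : P.HolderConjugate Q) {C x a b : ℝ} (hC : 0 ≤ C)
    (hx : |x| ≤ C * (1 + |a| ^ (P - 1) + |b| ^ (P - 1))) :
    |x| ^ Q ≤ (3 * C) ^ Q * (1 + |a| ^ P + |b| ^ P) := by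
  set m := max 1 (max |a| |b|)
  have hP : 0 < P - 1 := h.sub_one_pos
  have hm1 : 1 ≤ m := le_max_left _ _
  have hma : |a| ≤ m := (le_max_left _ _).trans (le_max_right _ _)
  have hmb : |b| ≤ m := (le_max_right _ _).trans (le_max_right _ _)
  have h1 : |x| ≤ 3 * C * m ^ (P - 1) := by
    have e1 : |a| ^ (P - 1) ≤ m ^ (P - 1) := Real.rpow_le_rpow (abs_nonneg _) hma hP.le
    have e2 : |b| ^ (P - 1) ≤ m ^ (P - 1) := Real.rpow_le_rpow (abs_nonneg _) hmb hP.le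
    have e3 : 1 ≤ m ^ (P - 1) := Real.one_le_rpow hm1 hP.le
    calc |x| ≤ C * (1 + |a| ^ (P - 1) + |b| ^ (P - 1)) := hx
      _ ≤ C * (m ^ (P - 1) + m ^ (P - 1) + m ^ (P - 1)) := by gcongr
      _ = _ := by ring
  have hm0 : 0 ≤ m := zero_le_one.trans hm1
  have h2 : m ^ P ≤ 1 + |a| ^ P + |b| ^ P := by
    have ha : 0 ≤ |a| ^ P := by positivity
    have hb : 0 ≤ |b| ^ P := by positivity
    rcases max_choice 1 (max |a| |b|) with h' | h'
    · rw [show m = 1 from h', Real.one_rpow]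
      linarith
    · rcases max_choice |a| |b| with h'' | h''
      · rw [show m = |a| from h'.trans h'']
        linarith
      · rw [show m = |b| from h'.trans h'']
        linarith
  calc |x| ^ Q ≤ (3 * C * m ^ (P - 1)) ^ Q :=
        Real.rpow_le_rpow (abs_nonneg _) h1 h.symm.nonneg
    _ = (3 * C) ^ Q * m ^ P := by
        rw [Real.mul_rpow (by positivity) (by positivity), ← Real.rpow_mul hm0, h.sub_one_mul_conj]
    _ ≤ _ := by gcongr

theorem enorm_rpow_conj_le {P Q : ℝ} (h : P.HolderConjugate Q) {C x a b : ℝ} (hC : 0 ≤ C)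
    (hx : |x| ≤ C * (1 + |a| ^ (P - 1) + |b| ^ (P - 1))) :
    ‖x‖ₑ ^ Q ≤ ENNReal.ofReal ((3 * C) ^ Q) * (1 + ‖a‖ₑ ^ P) +
      ENNReal.ofReal ((3 * C) ^ Q) * ‖b‖ₑ ^ P := by
  have h1 := ENNReal.ofReal_le_ofReal (abs_rpow_conj_le h hC hx)
  rw [← mul_add]
  simp only [Real.enorm_eq_ofReal_abs]
  rw [ENNReal.ofReal_rpow_of_nonneg (abs_nonneg _) h.symm.nonneg,
    ENNReal.ofReal_rpow_of_nonneg (abs_nonneg _) h.nonneg,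
    ENNReal.ofReal_rpow_of_nonneg (abs_nonneg _) h.nonneg, ← ENNReal.ofReal_one,
    ← ENNReal.ofReal_add (by positivity) (by positivity),
    ← ENNReal.ofReal_add (by positivity) (by positivity), ← ENNReal.ofReal_mul (by positivity)]
  exact h1

variable {α : Type*} [MeasurableSpace α] {μ : Measure α}

theorem lintegral_enorm_rpow_lt_top {P : ℝ≥0} (hP : P ≠ 0) {u : α → ℝ} (hu : MemLp u P μ) :
    ∫⁻ x, ‖u x‖ₑ ^ (P : ℝ) ∂μ < ⊤ := by
  rw [← eLpNorm_nnreal_pow_eq_lintegral hP]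
  exact ENNReal.rpow_lt_top_of_nonneg P.coe_nonneg hu.2.ne

variable [IsFiniteMeasure μ]

theorem memLp_conj_of_growth {P Q : ℝ≥0} (h : P.HolderConjugate Q) {C : ℝ} (hC : 0 ≤ C)
    {k u v : α → ℝ} (hk : AEStronglyMeasurable k μ) (hu : MemLp u P μ) (hv : MemLp v P μ)
    (hx : ∀ x, |k x| ≤ C * (1 + |u x| ^ ((P : ℝ) - 1) + |v x| ^ ((P : ℝ) - 1))) :
    MemLp k Q μ := by
  refine ⟨hk, ?_⟩
  rw [eLpNorm_lt_top_iff_lintegral_rpow_enorm_lt_top (by simpa using h.symm.ne_zero) (by simp)]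
  rw [ENNReal.coe_toReal]
  refine (lintegral_mono fun x ↦ enorm_rpow_conj_le h.coe hC (hx x)).trans_lt ?_
  have hum := (hu.1.enorm.pow_const (P : ℝ))
  have hvm := (hv.1.enorm.pow_const (P : ℝ))
  rw [lintegral_add_right' _ (hvm.const_mul _), lintegral_const_mul'' _ (hum.const_add _),
    lintegral_const_mul'' _ hvm, lintegral_add_left measurable_const, lintegral_const]
  have h1 := lintegral_enorm_rpow_lt_top h.ne_zero hu
  have h2 := lintegral_enorm_rpow_lt_top h.ne_zero hv
  exact ENNReal.add_lt_top.2 ⟨ENNReal.mul_lt_top ENNReal.ofReal_lt_top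
    (ENNReal.add_lt_top.2 ⟨by simp, h1⟩), ENNReal.mul_lt_top ENNReal.ofReal_lt_top h2⟩

/-- Superposition operators of growth `P - 1` vanishing at `0` in the second variable are
continuous at `0` from `L^P` to `L^Q`, where `Q` is the conjugate exponent of `P`. -/
theorem tendsto_eLpNorm_superposition {P Q : ℝ≥0} (h : P.HolderConjugate Q) {C : ℝ} (hC : 0 ≤ C)
    {k : ℝ → ℝ → ℝ} (hkm : Measurable (Function.uncurry k))
    (hk : ∀ a b, |k a b| ≤ C * (1 + |a| ^ ((P : ℝ) - 1) + |b| ^ ((P : ℝ) - 1)))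
    (hk0 : ∀ a, Tendsto (k a) (𝓝 0) (𝓝 0)) {u : α → ℝ} (hu : MemLp u P μ) {v : ℕ → α → ℝ}
    (hv : ∀ n, AEStronglyMeasurable (v n) μ)
    (hv0 : Tendsto (fun n ↦ eLpNorm (v n) P μ) atTop (𝓝 0)) :
    Tendsto (fun n ↦ eLpNorm (fun x ↦ k (u x) (v n x)) Q μ) atTop (𝓝 0) := by
  -- Convergence in L^P yields almost everywhere convergence only along a subsequence; it suffices
  -- that each subsequence has a further one with limit 0.
  refine tendsto_of_subseq_tendsto fun ns hns ↦ ?_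
  have hv0' : Tendsto (fun n ↦ eLpNorm (v (ns n)) P μ) atTop (𝓝 0) := hv0.comp hns
  have hmeas : TendstoInMeasure μ (fun n ↦ v (ns n)) atTop (fun _ ↦ (0 : ℝ)) := by
    refine tendstoInMeasure_of_tendsto_eLpNorm (p := P) (by simpa using h.ne_zero)
      (fun n ↦ hv _) aestronglyMeasurable_const ?_
    simpa [Pi.sub_def] using hv0'
  obtain ⟨ms, hms, hae⟩ := hmeas.exists_seq_tendsto_ae
  refine ⟨ms, ?_⟩
  have hP0 : (0 : ℝ) < P := h.coe.pos
  have hQ0 : (0 : ℝ) < Q := h.coe.symm.pos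
  set c := ENNReal.ofReal ((3 * C) ^ (Q : ℝ))
  set w : ℕ → α → ℝ := fun n ↦ v (ns (ms n))
  have hw (n : ℕ) : AEStronglyMeasurable (w n) μ := hv _
  have hwm (n : ℕ) : AEMeasurable (fun x ↦ ‖w n x‖ₑ ^ (P : ℝ)) μ := (hw n).enorm.pow_const _
  have hum : AEMeasurable (fun x ↦ ‖u x‖ₑ ^ (P : ℝ)) μ := hu.1.enorm.pow_const _
  have hkw (n : ℕ) : AEMeasurable (fun x ↦ ‖k (u x) (w n x)‖ₑ ^ (Q : ℝ)) μ :=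
    (hkm.comp_aemeasurable (hu.1.aemeasurable.prodMk (hw n).aemeasurable)).enorm.pow_const _
  have hpow : Tendsto (fun n ↦ ∫⁻ x, ‖w n x‖ₑ ^ (P : ℝ) ∂μ) atTop (𝓝 0) := by
    have h1 : Tendsto (fun n ↦ eLpNorm (w n) P μ ^ (P : ℝ)) atTop (𝓝 (0 ^ (P : ℝ))) :=
      (ENNReal.continuous_rpow_const.tendsto 0).comp (hv0'.comp hms.tendsto_atTop)
    rw [ENNReal.zero_rpow_of_pos hP0] at h1
    simpa only [eLpNorm_nnreal_pow_eq_lintegral h.ne_zero] using h1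
  -- The natural bound c(1 + |u|^P) + c|w_n|^P depends on n. Truncating at its fixed part permits
  -- dominated convergence, and what is cut off is at most c|w_n|^P, whose integral tends to 0.
  have hmin : Tendsto (fun n ↦ ∫⁻ x, min (‖k (u x) (w n x)‖ₑ ^ (Q : ℝ))
      (c * (1 + ‖u x‖ₑ ^ (P : ℝ))) ∂μ) atTop (𝓝 0) := by
    have h1 := tendsto_lintegral_of_dominated_convergence' (μ := μ)
      (F := fun n x ↦ min (‖k (u x) (w n x)‖ₑ ^ (Q : ℝ)) (c * (1 + ‖u x‖ₑ ^ (P : ℝ))))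
      (f := fun _ ↦ 0) (fun x ↦ c * (1 + ‖u x‖ₑ ^ (P : ℝ)))
      (fun n ↦ (hkw n).min ((hum.const_add _).const_mul _))
      (fun n ↦ .of_forall fun x ↦ min_le_right _ _) ?_ ?_
    · simpa using h1
    · rw [lintegral_const_mul'' _ (hum.const_add _), lintegral_add_left measurable_const,
        lintegral_const]
      refine ENNReal.mul_ne_top ENNReal.ofReal_ne_top (ENNReal.add_ne_top.2 ⟨by simp, ?_⟩)
      exact (lintegral_enorm_rpow_lt_top h.ne_zero hu).ne
    · filter_upwards [hae] with x hx
      have h2 : Tendsto (fun n ↦ ‖k (u x) (w n x)‖ₑ ^ (Q : ℝ)) atTop (𝓝 0) := by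
        have h3 := (((hk0 (u x)).comp hx).enorm).ennrpow_const (Q : ℝ)
        simpa [ENNReal.zero_rpow_of_pos hQ0] using h3
      exact tendsto_of_tendsto_of_tendsto_of_le_of_le tendsto_const_nhds h2
        (fun _ ↦ zero_le) (fun n ↦ min_le_left _ _)
  have hsum : Tendsto (fun n ↦ ∫⁻ x, ‖k (u x) (w n x)‖ₑ ^ (Q : ℝ) ∂μ) atTop (𝓝 0) := by
    have h1 := hmin.add (ENNReal.Tendsto.const_mul (a := c) hpow (.inr ENNReal.ofReal_ne_top))
    rw [mul_zero, add_zero] at h1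
    refine tendsto_of_tendsto_of_tendsto_of_le_of_le tendsto_const_nhds h1
      (fun _ ↦ zero_le) fun n ↦ ?_
    dsimp only
    rw [← lintegral_const_mul'' _ (hwm n), ← lintegral_add_right' _ ((hwm n).const_mul _)]
    refine lintegral_mono fun x ↦ ?_
    rcases min_choice (‖k (u x) (w n x)‖ₑ ^ (Q : ℝ)) (c * (1 + ‖u x‖ₑ ^ (P : ℝ))) with h2 | h2
    · simp only [h2]
      exact le_self_add
    · simp only [h2]
      exact enorm_rpow_conj_le h.coe hC (hk _ _)
  have h1 : Tendsto (fun n ↦ (∫⁻ x, ‖k (u x) (w n x)‖ₑ ^ (Q : ℝ) ∂μ) ^ (1 / (Q : ℝ))) atTop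
      (𝓝 (0 ^ (1 / (Q : ℝ)))) := (ENNReal.continuous_rpow_const.tendsto 0).comp hsum
  rw [ENNReal.zero_rpow_of_pos (by positivity)] at h1
  simpa only [← eLpNorm_nnreal_eq_lintegral h.symm.ne_zero] using h1

variable {W : ℝ → ℝ} {C p : ℝ}

theorem abs_deriv_add_sub_le (hC : 0 ≤ C) (hp : 1 ≤ p)
    (hg : ∀ s, |deriv W s| ≤ C * (1 + |s| ^ (p - 1))) (a b : ℝ) :
    |deriv W (a + b) - deriv W a| ≤
      C * (2 + 2 ^ (p - 1)) * (1 + |a| ^ (p - 1) + |b| ^ (p - 1)) := by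
  have hp' : 0 ≤ p - 1 := by linarith
  have h1 : |a + b| ^ (p - 1) ≤ 2 ^ (p - 1) * (|a| ^ (p - 1) + |b| ^ (p - 1)) := by
    have ha : 0 ≤ |a| ^ (p - 1) := by positivity
    have hb : 0 ≤ |b| ^ (p - 1) := by positivity
    have h2 : |a + b| ≤ 2 * max |a| |b| := by
      have := abs_add_le a b
      have := le_max_left |a| |b|
      have := le_max_right |a| |b|
      linarith
    calc |a + b| ^ (p - 1) ≤ (2 * max |a| |b|) ^ (p - 1) :=
          Real.rpow_le_rpow (abs_nonneg _) h2 hp'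
      _ = 2 ^ (p - 1) * (max |a| |b|) ^ (p - 1) := Real.mul_rpow (by norm_num) (by positivity)
      _ ≤ _ := by
        gcongr
        rcases max_choice |a| |b| with h | h <;> rw [h] <;> linarith
  have h2 := hg (a + b)
  have h3 := hg a
  have h4 := abs_sub (deriv W (a + b)) (deriv W a)
  have ha : 0 ≤ |a| ^ (p - 1) := by positivity
  have hb : 0 ≤ |b| ^ (p - 1) := by positivity
  have h5 : (0 : ℝ) ≤ 2 ^ (p - 1) := by positivity
  calc |deriv W (a + b) - deriv W a|
      ≤ C * (1 + |a + b| ^ (p - 1)) + C * (1 + |a| ^ (p - 1)) := by linarith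
    _ = C * (2 + |a + b| ^ (p - 1) + |a| ^ (p - 1)) := by ring
    _ ≤ C * (2 + 2 ^ (p - 1) * (|a| ^ (p - 1) + |b| ^ (p - 1)) + |a| ^ (p - 1)) := by gcongr
    _ ≤ _ := by
      rw [mul_assoc]
      gcongr
      nlinarith

/-- The mean value inequality for s ↦ W(a + s) - W'(a)s on |s| ≤ |b|, whose derivative is the
increment of W' bounded in `abs_deriv_add_sub_le`. -/
theorem abs_taylor_remainder_le (hW : Differentiable ℝ W) (hC : 0 ≤ C) (hp : 1 ≤ p)
    (hg : ∀ s, |deriv W s| ≤ C * (1 + |s| ^ (p - 1))) (a b : ℝ) :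
    |W (a + b) - W a - deriv W a * b| ≤
      C * (2 + 2 ^ (p - 1)) * (1 + |a| ^ (p - 1) + |b| ^ (p - 1)) * |b| := by
  have hd (s : ℝ) : HasDerivAt (fun s ↦ W (a + s) - deriv W a * s)
      (deriv W (a + s) - deriv W a) s := by
    have h1 := (hW (a + s)).hasDerivAt.comp_const_add a s
    have h2 : HasDerivAt (fun s ↦ deriv W a * s) (deriv W a) s := by
      simpa using (hasDerivAt_id s).const_mul (deriv W a)
    exact h1.sub h2
  have hball : ∀ s ∈ Metric.closedBall (0 : ℝ) |b|, ‖deriv W (a + s) - deriv W a‖ ≤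
      C * (2 + 2 ^ (p - 1)) * (1 + |a| ^ (p - 1) + |b| ^ (p - 1)) := by
    intro s hs
    have hs' : |s| ≤ |b| := by simpa using hs
    refine (abs_deriv_add_sub_le hC hp hg a s).trans ?_
    have : |s| ^ (p - 1) ≤ |b| ^ (p - 1) :=
      Real.rpow_le_rpow (abs_nonneg _) hs' (by linarith)
    gcongr
  have h := (convex_closedBall (0 : ℝ) |b|).norm_image_sub_le_of_norm_hasDerivWithin_le
    (fun s _ ↦ (hd s).hasDerivWithinAt) hball (x := 0) (y := b) (by simp) (by simp)
  simp only [add_zero, mul_zero, sub_zero, Real.norm_eq_abs] at h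
  rwa [show W (a + b) - W a - deriv W a * b = W (a + b) - deriv W a * b - W a by ring]

theorem abs_le_of_growth (hW : Differentiable ℝ W) (hC : 0 ≤ C) (hp : 1 ≤ p)
    (hg : ∀ s, |deriv W s| ≤ C * (1 + |s| ^ (p - 1))) :
    ∃ C' : ℝ, ∀ s, |W s| ≤ C' * (1 + |s| ^ p) := by
  refine ⟨|W 0| + 2 * C, fun s ↦ ?_⟩
  have h := (convex_closedBall (0 : ℝ) |s|).norm_image_sub_le_of_norm_deriv_le
    (C := C * (1 + |s| ^ (p - 1))) (fun t _ ↦ hW t) (fun t ht ↦ ?_) (x := 0) (y := s)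
    (by simp) (by simp)
  · have h2 : |W s| ≤ |W 0| + C * (|s| + |s| ^ p) := by
      have h3 : |s| ^ (p - 1) * |s| = |s| ^ p := by
        rcases eq_or_lt_of_le (abs_nonneg s) with h0 | h0
        · rw [← h0, mul_zero, Real.zero_rpow (by linarith)]
        · rw [← Real.rpow_add_one h0.ne', sub_add_cancel]
      have h4 := abs_sub_abs_le_abs_sub (W s) (W 0)
      simp only [Real.norm_eq_abs, sub_zero] at h
      rw [mul_assoc, add_mul, one_mul, h3] at h
      linarith
    have h5 : |s| ≤ 1 + |s| ^ p := by
      rcases le_total |s| 1 with h6 | h6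
      · have : 0 ≤ |s| ^ p := by positivity
        linarith
      · have := Real.self_le_rpow_of_one_le h6 hp
        linarith
    have h6 : 0 ≤ |s| ^ p := by positivity
    have h7 : 0 ≤ |W 0| := abs_nonneg _
    calc |W s| ≤ |W 0| + C * (|s| + |s| ^ p) := h2
      _ ≤ |W 0| + C * (1 + |s| ^ p + |s| ^ p) := by gcongr
      _ ≤ _ := by nlinarith
  · refine (hg t).trans ?_
    have ht' : |t| ≤ |s| := by simpa using ht
    have : |t| ^ (p - 1) ≤ |s| ^ (p - 1) := Real.rpow_le_rpow (abs_nonneg _) ht' (by linarith)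
    gcongr

theorem integrable_of_growth (hW : Continuous W) {P : ℝ≥0} (hP : P ≠ 0)
    (hg : ∀ s, |W s| ≤ C * (1 + |s| ^ (P : ℝ))) {u : α → ℝ} (hu : MemLp u P μ) :
    Integrable (fun x ↦ W (u x)) μ := by
  have h1 : Integrable (fun x ↦ |u x| ^ (P : ℝ)) μ := by
    simpa using hu.integrable_norm_rpow (by simpa using hP) (by simp)
  exact (((integrable_const (1 : ℝ)).add h1).const_mul C).mono'
    (hW.comp_aestronglyMeasurable hu.1) (.of_forall fun x ↦ hg (u x))

/-- The integral functional of a `C¹` function whose derivative has growth `P - 1` is `C¹`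
on `L^P`. -/
theorem contDiff_one_integral_superposition (hW : ContDiff ℝ 1 W) (hC : 0 ≤ C) {P : ℝ≥0}
    (hP : 1 < P) [Fact ((1 : ℝ≥0∞) ≤ P)]
    (hg : ∀ s, |deriv W s| ≤ C * (1 + |s| ^ ((P : ℝ) - 1))) :
    ContDiff ℝ 1 fun u : Lp ℝ P μ ↦ ∫ x, W (u x) ∂μ := by
  set Q : ℝ≥0 := P.conjExponent
  have h : P.HolderConjugate Q := NNReal.HolderConjugate.conjExponent hP
  have hPr : (1 : ℝ) ≤ P := by exact_mod_cast hP.le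
  have : Fact ((1 : ℝ≥0∞) ≤ Q) := ⟨by exact_mod_cast h.symm.lt.le⟩
  have : ENNReal.HolderConjugate (Q : ℝ≥0∞) P := h.symm.coe_ennreal
  have hWd : Differentiable ℝ W := hW.differentiable (by simp)
  have hW' : Continuous (deriv W) := hW.continuous_deriv le_rfl
  have hP0 : P ≠ 0 := h.ne_zero
  obtain ⟨C', hC'⟩ := abs_le_of_growth hWd hC hPr hg
  have hint (u : Lp ℝ P μ) : Integrable (fun x ↦ W (u x)) μ :=
    integrable_of_growth hW.continuous hP0 hC' (Lp.memLp u)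
  set B := (ContinuousLinearMap.mul ℝ ℝ).lpPairing μ (Q : ℝ≥0∞) (P : ℝ≥0∞) with hB
  have hmem (u : Lp ℝ P μ) : MemLp (fun x ↦ deriv W (u x)) Q μ := by
    refine memLp_conj_of_growth h hC (hW'.comp_aestronglyMeasurable (Lp.aestronglyMeasurable u))
      (Lp.memLp u) (Lp.memLp u) fun x ↦ (hg _).trans ?_
    have : 0 ≤ |u x| ^ ((P : ℝ) - 1) := by positivity
    gcongr
    linarith
  set c := C * (2 + 2 ^ ((P : ℝ) - 1))
  have hc : 0 ≤ c := by positivity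
  -- The derivative at u is the L^Q–L^P pairing with W'(u), where Q is conjugate to P.
  refine contDiff_one_iff_hasFDerivAt.2 ⟨fun u ↦ B (hmem u).toLp, ?_, fun u ↦ ?_⟩
  · refine B.continuous.comp (continuous_iff_continuousAt.2 fun u ↦ ?_)
    refine tendsto_of_seq_tendsto fun un hun ↦ ?_
    change Tendsto (fun n ↦ (hmem (un n)).toLp) atTop (𝓝 (hmem u).toLp)
    rw [Lp.tendsto_Lp_iff_tendsto_eLpNorm'']
    have hun' := (Lp.tendsto_Lp_iff_tendsto_eLpNorm' _ _).1 hun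
    have h1 := tendsto_eLpNorm_superposition (μ := μ) h hc
      (k := fun a b ↦ deriv W (a + b) - deriv W a)
      (by
        have : Continuous fun p : ℝ × ℝ ↦ deriv W (p.1 + p.2) - deriv W p.1 := by fun_prop
        exact this.measurable)
      (fun a b ↦ abs_deriv_add_sub_le hC hPr hg a b) (fun a ↦ by
        have : Continuous fun b ↦ deriv W (a + b) - deriv W a := by fun_prop
        simpa using this.tendsto 0) (Lp.memLp u) (v := fun n ↦ ⇑(un n) - ⇑u)
      (fun n ↦ (Lp.aestronglyMeasurable _).sub (Lp.aestronglyMeasurable _)) hun'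
    refine h1.congr fun n ↦ ?_
    refine eLpNorm_congr_ae (.of_forall fun x ↦ ?_)
    simp
  · rw [hasFDerivAt_iff_tendsto]
    refine tendsto_of_seq_tendsto fun un hun ↦ ?_
    have hun' := (Lp.tendsto_Lp_iff_tendsto_eLpNorm' _ _).1 hun
    -- The Taylor remainder divided by b. Since division by zero gives 0, multiplying by b recovers
    -- the remainder for every b. As k has growth P - 1 and vanishes as b → 0, its superposition
    -- tends to 0 in L^Q, and Hölder makes the integrated remainder o(‖un n - u‖).
    set k : ℝ → ℝ → ℝ := fun a b ↦ (W (a + b) - W a - deriv W a * b) / b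
    have hkm : Measurable (Function.uncurry k) := by
      have hWc := hW.continuous
      have : Continuous fun p : ℝ × ℝ ↦ W (p.1 + p.2) - W p.1 - deriv W p.1 * p.2 := by fun_prop
      exact this.measurable.div measurable_snd
    have hk (a b : ℝ) : |k a b| ≤ c * (1 + |a| ^ ((P : ℝ) - 1) + |b| ^ ((P : ℝ) - 1)) := by
      rcases eq_or_ne b 0 with rfl | hb
      · simp only [k, div_zero, abs_zero]
        positivity
      · rw [abs_div, div_le_iff₀ (abs_pos.2 hb)]
        exact abs_taylor_remainder_le hWd hC hPr hg a b
    have hk0 (a : ℝ) : Tendsto (k a) (𝓝 0) (𝓝 0) := by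
      have h1 := (hasFDerivAt_iff_isLittleO_nhds_zero.1
        (hWd a).hasDerivAt.hasFDerivAt).tendsto_div_nhds_zero
      refine h1.congr fun b ↦ ?_
      simp [k, mul_comm]
    have hkb (a b : ℝ) : k a b * b = W (a + b) - W a - deriv W a * b := by
      rcases eq_or_ne b 0 with rfl | hb
      · simp
      · exact div_mul_cancel₀ _ hb
    have hkmem (n : ℕ) : MemLp (fun x ↦ k (u x) ((un n - u : Lp ℝ P μ) x)) Q μ :=
      memLp_conj_of_growth h hc (hkm.comp_aemeasurable ((Lp.aestronglyMeasurable u).aemeasurable.prodMk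
        (Lp.aestronglyMeasurable (un n - u)).aemeasurable)).aestronglyMeasurable
        (Lp.memLp u) (Lp.memLp (un n - u)) fun x ↦ hk _ _
    have h1 := tendsto_eLpNorm_superposition (μ := μ) h hc hkm hk hk0 (Lp.memLp u)
      (v := fun n ↦ ⇑(un n - u)) (fun n ↦ Lp.aestronglyMeasurable _)
      (hun'.congr fun n ↦ eLpNorm_congr_ae (Lp.coeFn_sub _ _).symm)
    have hrem (n : ℕ) : ∫ x, W (un n x) ∂μ - ∫ x, W (u x) ∂μ - B (hmem u).toLp (un n - u) =
        B (hkmem n).toLp (un n - u) := by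
      have hi : Integrable (fun x ↦ deriv W (u x) * (un n - u : Lp ℝ P μ) x) μ :=
        (hmem u).integrable_mul (Lp.memLp (un n - u))
      rw [hB, ContinuousLinearMap.lpPairing_eq_integral, ContinuousLinearMap.lpPairing_eq_integral,
        ← integral_sub (hint _) (hint _)]
      have e1 : ∫ x, ContinuousLinearMap.mul ℝ ℝ (MemLp.toLp _ (hmem u) x) ((un n - u : Lp ℝ P μ) x) ∂μ =
          ∫ x, deriv W (u x) * (un n - u : Lp ℝ P μ) x ∂μ := by
        refine integral_congr_ae ?_
        filter_upwards [(hmem u).coeFn_toLp] with x hx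
        rw [hx, ContinuousLinearMap.mul_apply']
      have hi2 : Integrable (fun x ↦ W (un n x) - W (u x)) μ := (hint _).sub (hint _)
      rw [e1, ← integral_sub hi2 hi]
      refine integral_congr_ae ?_
      filter_upwards [(hkmem n).coeFn_toLp, Lp.coeFn_sub (un n) u] with x hx hx2
      rw [hx, ContinuousLinearMap.mul_apply', hkb, hx2]
      simp
    have h2 : Tendsto (fun n ↦ ‖B‖ * ‖(hkmem n).toLp‖) atTop (𝓝 0) := by
      have := (ENNReal.tendsto_toReal ENNReal.zero_ne_top).comp h1
      simpa [Lp.norm_toLp] using this.const_mul ‖B‖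
    refine squeeze_zero (fun n ↦ mul_nonneg (inv_nonneg.2 (norm_nonneg _)) (norm_nonneg _))
      (fun n ↦ ?_) h2
    dsimp only [Function.comp_apply]
    rw [hrem]
    rcases eq_or_ne ‖un n - u‖ 0 with h0 | h0
    · rw [h0, inv_zero, zero_mul]
      positivity
    · rw [inv_mul_le_iff₀ (by positivity), mul_comm]
      exact B.le_opNorm₂ _ _

end Nemytskii

/-! ### Comparison of the Riemannian volume with Lebesgue measure in charts. -/

section ChartMeasure

set_option linter.unusedSectionVars false

open scoped ENNReal NNReal

variable {N : ℕ} {M : Type*} [TopologicalSpace M] [ChartedSpace (EuclideanSpace ℝ (Fin N)) M]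

theorem measurableSet_target_inter_preimage [MeasurableSpace M] [BorelSpace M] (x₀ : M) {A : Set M}
    (hA : MeasurableSet A) :
    MeasurableSet ((extChartAt (𝓡 N) x₀).target ∩ (extChartAt (𝓡 N) x₀).symm ⁻¹' A) := by
  have ht : MeasurableSet (extChartAt (𝓡 N) x₀).target :=
    (isOpen_extChartAt_target (I := 𝓡 N) x₀).measurableSet
  have h : Measurable ((extChartAt (𝓡 N) x₀).target.domRestrict (extChartAt (𝓡 N) x₀).symm) :=
    (continuousOn_extChartAt_symm (I := 𝓡 N) x₀).domRestrict.measurable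
  have := ht.subtype_image (h hA)
  convert! this using 1
  ext z
  simp [and_comm]

theorem aemeasurable_extChartAt_symm [MeasurableSpace M] [BorelSpace M] (x₀ : M)
    (μ : Measure (EuclideanSpace ℝ (Fin N))) :
    AEMeasurable (extChartAt (𝓡 N) x₀).symm (μ.restrict (extChartAt (𝓡 N) x₀).target) :=
  (continuousOn_extChartAt_symm (I := 𝓡 N) x₀).aemeasurable
    (isOpen_extChartAt_target (I := 𝓡 N) x₀).measurableSet

/-- Lebesgue measure in the coordinates of the chart around `x₀`. -/
def chartMeasure [MeasurableSpace M] (x₀ : M) : Measure M :=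
  ((volume : Measure (EuclideanSpace ℝ (Fin N))).restrict (extChartAt (𝓡 N) x₀).target).map
    (extChartAt (𝓡 N) x₀).symm

theorem chartMeasure_apply [MeasurableSpace M] [BorelSpace M] (x₀ : M) {A : Set M}
    (hA : MeasurableSet A) : chartMeasure (N := N) x₀ A =
      volume ((extChartAt (𝓡 N) x₀).target ∩ (extChartAt (𝓡 N) x₀).symm ⁻¹' A) := by
  rw [chartMeasure, Measure.map_apply_of_aemeasurable (aemeasurable_extChartAt_symm x₀ _) hA,
    Measure.restrict_apply' (isOpen_extChartAt_target (I := 𝓡 N) x₀).measurableSet, inter_comm]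

theorem isCompact_extChartAt_image {x₀ : M} {K : Set M} (hK : IsCompact K)
    (hs : K ⊆ (extChartAt (𝓡 N) x₀).source) : IsCompact (extChartAt (𝓡 N) x₀ '' K) :=
  hK.image_of_continuousOn ((continuousOn_extChartAt x₀).mono hs)

theorem extChartAt_image_subset_target {x₀ : M} {K : Set M}
    (hs : K ⊆ (extChartAt (𝓡 N) x₀).source) :
    extChartAt (𝓡 N) x₀ '' K ⊆ (extChartAt (𝓡 N) x₀).target := by
  rintro _ ⟨y, hy, rfl⟩
  exact (extChartAt (𝓡 N) x₀).map_source (hs hy)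

variable [IsManifold (𝓡 N) ∞ M]

theorem contDiffOn_coordChange (i j : M) :
    ContDiffOn ℝ ∞ (extChartAt (𝓡 N) i ∘ (extChartAt (𝓡 N) j).symm)
      ((extChartAt (𝓡 N) j).target ∩
        (extChartAt (𝓡 N) j).symm ⁻¹' (extChartAt (𝓡 N) i).source) := by
  rw [← contMDiffOn_iff_contDiffOn]
  refine (contMDiffOn_extChartAt (I := 𝓡 N) (n := ∞) (x := i)).comp
    ((contMDiffOn_extChartAt_symm (I := 𝓡 N) (n := ∞) j).mono inter_subset_left) fun z hz ↦ ?_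
  simpa using hz.2

theorem volDensity_pos (g : RMetric N M) (x₀ : M) {z : EuclideanSpace ℝ (Fin N)}
    (hz : z ∈ (extChartAt (𝓡 N) x₀).target) : 0 < volDensity g x₀ z := by
  have hs : (extChartAt (𝓡 N) x₀).symm z ∈ (chartAt (EuclideanSpace ℝ (Fin N)) x₀).source := by
    simpa using (extChartAt (𝓡 N) x₀).map_target hz
  have : gram g x₀ z = frameGram g x₀ ((extChartAt (𝓡 N) x₀).symm z) := by
    ext i j
    simp [gram, frameGram, coordVec_eq x₀ hz]
  rw [volDensity, this]
  exact Real.sqrt_pos.2 (frameGram_posDef g x₀ hs).det_pos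

section Partition

variable [T2Space M] [CompactSpace M] (g : RMetric N M)

/-- The density of the part of the volume measure carried by the chart around `x₀`. -/
def partDensity (x₀ : M) (z : EuclideanSpace ℝ (Fin N)) : ℝ :=
  partition N M x₀ ((extChartAt (𝓡 N) x₀).symm z) * volDensity g x₀ z

theorem continuousOn_partDensity (x₀ : M) :
    ContinuousOn (partDensity g x₀) (extChartAt (𝓡 N) x₀).target :=
  ((partition N M x₀).contMDiff.continuous.comp_continuousOn
    (continuousOn_extChartAt_symm x₀)).mul (continuousOn_volDensity g x₀)

theorem tsupport_partition_subset (x₀ : M) :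
    tsupport (partition N M x₀) ⊆ (extChartAt (𝓡 N) x₀).source := by
  simpa [partition] using
    (SmoothPartitionOfUnity.exists_isSubordinate_chartAt_source (𝓡 N) M).choose_spec x₀

variable (N M) in
/-- The indices of the non-zero functions of the partition of unity. -/
def partIndex : Finset M := (partition N M).locallyFinite.finite_nonempty_of_compact.toFinset

theorem partition_eq_zero {x₀ : M} (h : x₀ ∉ partIndex N M) (y : M) : partition N M x₀ y = 0 := by
  have : ∀ y, partition N M x₀ y = 0 := by
    simpa [partIndex, Set.not_nonempty_iff_eq_empty, Function.support_eq_empty_iff,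
      funext_iff] using h
  exact this y

theorem sum_partition (y : M) : ∑ i ∈ partIndex N M, partition N M i y = 1 := by
  refine (partition N M).sum_finsupport' y (mem_univ y) fun i hi ↦ ?_
  by_contra h
  exact ((partition N M).mem_finsupport _).1 hi (partition_eq_zero h y)

end Partition

variable [MeasurableSpace M] [BorelSpace M]

/-- On compact sets, the Lebesgue measures of two charts are comparable. -/
theorem exists_chartMeasure_le (i j : M) {K : Set M} (hK : IsCompact K)
    (hi : K ⊆ (extChartAt (𝓡 N) i).source) (hj : K ⊆ (extChartAt (𝓡 N) j).source) :
    ∃ C : ℝ≥0, ∀ A ⊆ K, MeasurableSet A →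
      chartMeasure (N := N) i A ≤ C * chartMeasure (N := N) j A := by
  set U := (extChartAt (𝓡 N) j).target ∩
    (extChartAt (𝓡 N) j).symm ⁻¹' (extChartAt (𝓡 N) i).source
  have hU : IsOpen U := (continuousOn_extChartAt_symm (I := 𝓡 N) j).isOpen_inter_preimage
    (isOpen_extChartAt_target (I := 𝓡 N) j) (isOpen_extChartAt_source (I := 𝓡 N) i)
  set f := extChartAt (𝓡 N) i ∘ (extChartAt (𝓡 N) j).symm
  have hf : ContDiffOn ℝ ∞ f U := contDiffOn_coordChange i j
  have hf' : ContinuousOn (fun z ↦ |(fderiv ℝ f z).det|) U :=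
    (ContinuousLinearMap.continuous_det.comp_continuousOn
      (hf.continuousOn_fderiv_of_isOpen hU (by simp))).abs
  have hKj := isCompact_extChartAt_image (N := N) hK hj
  have hKU : extChartAt (𝓡 N) j '' K ⊆ U := by
    rintro _ ⟨y, hy, rfl⟩
    refine ⟨(extChartAt (𝓡 N) j).map_source (hj hy), ?_⟩
    rw [mem_preimage, (extChartAt (𝓡 N) j).left_inv (hj hy)]
    exact hi hy
  obtain ⟨C, hC⟩ := hKj.bddAbove_image (hf'.mono hKU)
  refine ⟨C.toNNReal, fun A hAK hA ↦ ?_⟩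
  rw [chartMeasure_apply i hA, chartMeasure_apply j hA]
  set s := (extChartAt (𝓡 N) j).target ∩ (extChartAt (𝓡 N) j).symm ⁻¹' A
  have hs : MeasurableSet s := measurableSet_target_inter_preimage j hA
  have hsK : s ⊆ extChartAt (𝓡 N) j '' K := fun z hz ↦
    ⟨_, hAK hz.2, (extChartAt (𝓡 N) j).right_inv hz.1⟩
  -- An inclusion is enough: for an upper bound, the measure of an image is at most the integral of
  -- the Jacobian determinant, without injectivity. That determinant is bounded by C on the compact
  -- set of coordinates of K.
  have himg : (extChartAt (𝓡 N) i).target ∩ (extChartAt (𝓡 N) i).symm ⁻¹' A ⊆ f '' s := by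
    rintro z ⟨hz, hzA⟩
    refine ⟨extChartAt (𝓡 N) j ((extChartAt (𝓡 N) i).symm z), ⟨?_, ?_⟩, ?_⟩
    · exact (extChartAt (𝓡 N) j).map_source (hj (hAK hzA))
    · rw [mem_preimage, (extChartAt (𝓡 N) j).left_inv (hj (hAK hzA))]
      exact hzA
    · simp only [f, Function.comp_apply]
      rw [(extChartAt (𝓡 N) j).left_inv (hj (hAK hzA)), (extChartAt (𝓡 N) i).right_inv hz]
  have hd : ∀ z ∈ s, HasFDerivWithinAt f (fderiv ℝ f z) s z := fun z hz ↦
    ((hf.contDiffAt (hU.mem_nhds (hKU (hsK hz)))).differentiableAt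
      (by simp)).hasFDerivAt.hasFDerivWithinAt
  refine (measure_mono himg).trans
    ((addHaar_image_le_lintegral_abs_det_fderiv volume hs hd).trans ?_)
  rw [← setLIntegral_const]
  refine setLIntegral_mono measurable_const fun z hz ↦ ?_
  exact ENNReal.ofReal_le_ofReal (hC ⟨z, hsK hz, rfl⟩)

variable [T2Space M] [CompactSpace M] (g : RMetric N M)

/-- The part of the volume measure carried by the chart around `x₀`. -/
def volPart (x₀ : M) : Measure M :=
  (((volume : Measure (EuclideanSpace ℝ (Fin N))).restrict (extChartAt (𝓡 N) x₀).target).withDensity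
    fun z ↦ ENNReal.ofReal (partDensity g x₀ z)).map (extChartAt (𝓡 N) x₀).symm

theorem vol_eq_sum_volPart : vol g = Measure.sum (volPart g) := rfl

theorem volPart_apply (x₀ : M) {A : Set M} (hA : MeasurableSet A) : volPart g x₀ A =
    ∫⁻ z in (extChartAt (𝓡 N) x₀).target ∩ (extChartAt (𝓡 N) x₀).symm ⁻¹' A,
      ENNReal.ofReal (partDensity g x₀ z) := by
  have ht : MeasurableSet (extChartAt (𝓡 N) x₀).target :=
    (isOpen_extChartAt_target (I := 𝓡 N) x₀).measurableSet
  rw [volPart, Measure.map_apply_of_aemeasurable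
    ((aemeasurable_extChartAt_symm x₀ _).mono_ac (withDensity_absolutelyContinuous _ _)) hA,
    withDensity_apply', Measure.restrict_restrict' ht, inter_comm]

theorem volPart_eq_zero {x₀ : M} (h : x₀ ∉ partIndex N M) : volPart g x₀ = 0 := by
  have : partDensity g x₀ = 0 := by
    ext z
    simp [partDensity, partition_eq_zero h]
  simp [volPart, this]

theorem vol_apply {A : Set M} (hA : MeasurableSet A) :
    vol g A = ∑ i ∈ partIndex N M, volPart g i A := by
  rw [vol_eq_sum_volPart, Measure.sum_apply _ hA]
  exact tsum_eq_sum fun i hi ↦ by simp [volPart_eq_zero g hi]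

theorem exists_volPart_le (j : M) {K : Set M} (hK : IsCompact K)
    (hs : K ⊆ (extChartAt (𝓡 N) j).source) : ∃ C : ℝ≥0, ∀ A ⊆ K, MeasurableSet A →
      volPart g j A ≤ C * chartMeasure (N := N) j A := by
  obtain ⟨C, hC⟩ := (isCompact_extChartAt_image (N := N) hK hs).bddAbove_image
    ((continuousOn_partDensity g j).mono (extChartAt_image_subset_target hs))
  refine ⟨C.toNNReal, fun A hAK hA ↦ ?_⟩
  rw [volPart_apply g j hA, chartMeasure_apply j hA, ← setLIntegral_const]
  refine setLIntegral_mono measurable_const fun z hz ↦ ?_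
  exact ENNReal.ofReal_le_ofReal
    (hC ⟨z, ⟨_, hAK hz.2, (extChartAt (𝓡 N) j).right_inv hz.1⟩, rfl⟩)

/-- Where the partition function is positive, so is the density, because the Gram matrix is positive
definite; its inverse is then continuous and bounded on the compact set of coordinates. -/
theorem exists_chartMeasure_le_volPart (j : M) {K : Set M} (hK : IsCompact K)
    (hs : K ⊆ (extChartAt (𝓡 N) j).source) (hpos : ∀ y ∈ K, 0 < partition N M j y) :
    ∃ C : ℝ≥0, ∀ A ⊆ K, MeasurableSet A →
      chartMeasure (N := N) j A ≤ C * volPart g j A := by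
  have hp : ∀ z ∈ extChartAt (𝓡 N) j '' K, 0 < partDensity g j z := by
    rintro _ ⟨y, hy, rfl⟩
    refine mul_pos ?_ (volDensity_pos g j ((extChartAt (𝓡 N) j).map_source (hs hy)))
    rw [(extChartAt (𝓡 N) j).left_inv (hs hy)]
    exact hpos y hy
  have hc : ContinuousOn (fun z ↦ (partDensity g j z)⁻¹) (extChartAt (𝓡 N) j '' K) :=
    ((continuousOn_partDensity g j).mono (extChartAt_image_subset_target hs)).inv₀
      fun z hz ↦ (hp z hz).ne'
  obtain ⟨C, hC⟩ := (isCompact_extChartAt_image (N := N) hK hs).bddAbove_image hc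
  refine ⟨C.toNNReal, fun A hAK hA ↦ ?_⟩
  rw [volPart_apply g j hA, chartMeasure_apply j hA, ← lintegral_const_mul' _ _ ENNReal.coe_ne_top,
    ← setLIntegral_one]
  refine setLIntegral_mono' (measurableSet_target_inter_preimage j hA) fun z hz ↦ ?_
  have hzK : z ∈ extChartAt (𝓡 N) j '' K := ⟨_, hAK hz.2, (extChartAt (𝓡 N) j).right_inv hz.1⟩
  have h1 : (partDensity g j z)⁻¹ ≤ C := hC ⟨z, hzK, rfl⟩
  have h2 := hp z hzK
  change 1 ≤ ENNReal.ofReal C * _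
  rw [← ENNReal.ofReal_mul ((inv_pos.2 h2).le.trans h1), ENNReal.one_le_ofReal]
  rwa [inv_le_iff_one_le_mul₀ h2] at h1

/-- On compact subsets of a chart domain, the volume measure is bounded by a multiple of the
Lebesgue measure of the chart. -/
theorem exists_vol_restrict_le (i : M) {K : Set M} (hK : IsCompact K)
    (hs : K ⊆ (extChartAt (𝓡 N) i).source) :
    ∃ C : ℝ≥0, (vol g).restrict K ≤ C • (chartMeasure (N := N) i).restrict K := by
  have hj (j : M) : ∃ C : ℝ≥0, ∀ A ⊆ K, MeasurableSet A →
      volPart g j A ≤ C * chartMeasure (N := N) i A := by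
    -- K need not lie in the chart around j, but the j-th part of the volume is carried by the
    -- support of the j-th partition function; K' lies in both charts.
    set K' := K ∩ tsupport (partition N M j)
    have hK' : IsCompact K' := hK.inter_right (isClosed_tsupport _)
    have hj' : K' ⊆ (extChartAt (𝓡 N) j).source :=
      inter_subset_right.trans (tsupport_partition_subset j)
    obtain ⟨C₁, h₁⟩ := exists_volPart_le g j hK' hj'
    obtain ⟨C₂, h₂⟩ := exists_chartMeasure_le j i hK' hj' (inter_subset_left.trans hs)
    refine ⟨C₁ * C₂, fun A hAK hA ↦ ?_⟩
    have ht : MeasurableSet (tsupport (partition N M j)) := (isClosed_tsupport _).measurableSet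
    have hA' : MeasurableSet (A ∩ tsupport (partition N M j)) := hA.inter ht
    have hsub : A ∩ tsupport (partition N M j) ⊆ K' := inter_subset_inter_left _ hAK
    have h0 : volPart g j (A \ tsupport (partition N M j)) = 0 := by
      rw [volPart_apply g j (hA.diff ht)]
      refine setLIntegral_eq_zero (measurableSet_target_inter_preimage j (hA.diff ht)) fun z hz ↦ ?_
      rw [partDensity, image_eq_zero_of_notMem_tsupport hz.2.2, zero_mul, ENNReal.ofReal_zero,
        Pi.zero_apply]
    calc volPart g j A = volPart g j (A ∩ tsupport (partition N M j)) := by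
          rw [← measure_inter_add_sdiff A ht, h0, add_zero]
      _ ≤ C₁ * (C₂ * chartMeasure (N := N) i (A ∩ tsupport (partition N M j))) :=
          (h₁ _ hsub hA').trans (mul_le_mul' le_rfl (h₂ _ hsub hA'))
      _ ≤ C₁ * (C₂ * chartMeasure (N := N) i A) := by
          gcongr
          exact inter_subset_left
      _ = _ := by rw [ENNReal.coe_mul, mul_assoc]
  choose C hC using hj
  refine ⟨∑ j ∈ partIndex N M, C j, Measure.le_iff.2 fun A hA ↦ ?_⟩
  have hAK := hA.inter hK.measurableSet
  rw [Measure.smul_apply, Measure.restrict_apply hA, Measure.restrict_apply hA, vol_apply g hAK,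
    ENNReal.smul_def, smul_eq_mul, ENNReal.ofNNReal_finsetSum, Finset.sum_mul]
  exact Finset.sum_le_sum fun j _ ↦ hC j _ inter_subset_right hAK

/-- On compact subsets of a chart domain, the Lebesgue measure of the chart is bounded by a
multiple of the volume measure. -/
theorem exists_chartMeasure_restrict_le (i : M) {K : Set M} (hK : IsCompact K)
    (hs : K ⊆ (extChartAt (𝓡 N) i).source) :
    ∃ C : ℝ≥0, (chartMeasure (N := N) i).restrict K ≤ C • (vol g).restrict K := by
  -- The partition functions sum to 1, so at each point one of them is at least 1/n: otherwise the
  -- sum would be at most (n - 1)/n < 1. The closed sets L j therefore cover M, and on each the j-th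
  -- density is bounded away from 0 over compact sets.
  set n : ℝ := ((partIndex N M).card : ℝ) + 1
  have hn : 0 < n := by positivity
  set L : M → Set M := fun j ↦ {y | 1 / n ≤ partition N M j y}
  have hLc (j : M) : IsClosed (L j) :=
    isClosed_le continuous_const (partition N M j).contMDiff.continuous
  have hLpos (j : M) : ∀ y ∈ L j, 0 < partition N M j y := fun y hy ↦
    lt_of_lt_of_le (by positivity) hy
  have hLs (j : M) : L j ⊆ (extChartAt (𝓡 N) j).source := fun y hy ↦
    tsupport_partition_subset j (subset_tsupport _ (hLpos j y hy).ne')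
  have hcov (y : M) : ∃ j ∈ partIndex N M, y ∈ L j := by
    by_contra! h
    have h1 : ∑ i ∈ partIndex N M, partition N M i y ≤ ∑ i ∈ partIndex N M, 1 / n :=
      Finset.sum_le_sum fun j hj ↦ (not_le.1 (h j hj)).le
    rw [sum_partition, Finset.sum_const, nsmul_eq_mul, mul_one_div, le_div_iff₀ hn] at h1
    simp only [n] at h1
    linarith
  have hj (j : M) : ∃ C : ℝ≥0, ∀ A ⊆ K ∩ L j, MeasurableSet A →
      chartMeasure (N := N) i A ≤ C * volPart g j A := by
    have hK' : IsCompact (K ∩ L j) := hK.inter_right (hLc j)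
    have hj' : K ∩ L j ⊆ (extChartAt (𝓡 N) j).source := inter_subset_right.trans (hLs j)
    obtain ⟨C₁, h₁⟩ := exists_chartMeasure_le_volPart g j hK' hj' fun y hy ↦ hLpos j y hy.2
    obtain ⟨C₂, h₂⟩ := exists_chartMeasure_le i j hK' (inter_subset_left.trans hs) hj'
    refine ⟨C₂ * C₁, fun A hAK hA ↦ (h₂ A hAK hA).trans ?_⟩
    rw [ENNReal.coe_mul, mul_assoc]
    exact mul_le_mul' le_rfl (h₁ A hAK hA)
  choose C hC using hj
  refine ⟨∑ j ∈ partIndex N M, C j, Measure.le_iff.2 fun A hA ↦ ?_⟩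
  have hAK := hA.inter hK.measurableSet
  rw [Measure.smul_apply, Measure.restrict_apply hA, Measure.restrict_apply hA,
    ENNReal.smul_def, smul_eq_mul, ENNReal.ofNNReal_finsetSum, Finset.sum_mul]
  have hsub : A ∩ K ⊆ ⋃ j ∈ partIndex N M, (A ∩ K) ∩ L j := fun y hy ↦ by
    obtain ⟨j, hj, hyj⟩ := hcov y
    exact mem_biUnion hj ⟨hy, hyj⟩
  refine (measure_mono hsub).trans ((measure_biUnion_finset_le _ _).trans ?_)
  refine Finset.sum_le_sum fun j hj ↦ ?_
  refine (hC j _ (inter_subset_inter_left _ inter_subset_right)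
    (hAK.inter (hLc j).measurableSet)).trans (mul_le_mul' le_rfl ?_)
  calc volPart g j (A ∩ K ∩ L j) ≤ volPart g j (A ∩ K) := measure_mono inter_subset_left
    _ ≤ vol g (A ∩ K) := by
      rw [vol_eq_sum_volPart]
      exact Measure.le_iff'.1 (Measure.le_sum (volPart g) j) _

end ChartMeasure

/-! ### Localization of smooth functions by the partition of unity, and their derivatives in charts.
-/

section Localization

set_option linter.unusedSectionVars false

open scoped ENNReal NNReal

variable {N : ℕ} {M : Type*} [TopologicalSpace M] [ChartedSpace (EuclideanSpace ℝ (Fin N)) M]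
  [IsManifold (𝓡 N) ∞ M]

theorem contDiffOn_comp_extChartAt_symm {u : M → ℝ} (hu : ContMDiff (𝓡 N) 𝓘(ℝ, ℝ) ∞ u) (i : M) :
    ContDiffOn ℝ ∞ (u ∘ (extChartAt (𝓡 N) i).symm) (extChartAt (𝓡 N) i).target := by
  rw [← contMDiffOn_iff_contDiffOn]
  exact hu.comp_contMDiffOn (contMDiffOn_extChartAt_symm (I := 𝓡 N) (n := ∞) i)

variable (g : RMetric N M)

theorem fderiv_comp_extChartAt_symm {u : M → ℝ} (hu : ContMDiff (𝓡 N) 𝓘(ℝ, ℝ) ∞ u) (i : M)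
    {z : EuclideanSpace ℝ (Fin N)} (hz : z ∈ (extChartAt (𝓡 N) i).target) (k : Fin N) :
    fderiv ℝ (u ∘ (extChartAt (𝓡 N) i).symm) z (EuclideanSpace.single k 1) =
      g.inner ((extChartAt (𝓡 N) i).symm z) (gradient g u ((extChartAt (𝓡 N) i).symm z))
        (coordVec i z k) := by
  have h1 : MDifferentiableAt 𝓘(ℝ, EuclideanSpace ℝ (Fin N)) (𝓡 N) (extChartAt (𝓡 N) i).symm z :=
    ((contMDiffOn_extChartAt_symm (I := 𝓡 N) (n := ∞) i).contMDiffAt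
      ((isOpen_extChartAt_target (I := 𝓡 N) i).mem_nhds hz)).mdifferentiableAt (by simp)
  have h2 : MDifferentiableAt (𝓡 N) 𝓘(ℝ, ℝ) u ((extChartAt (𝓡 N) i).symm z) :=
    hu.mdifferentiable (by simp) _
  refine Eq.trans ?_ (inner_gradient g u _ _).symm
  rw [← mfderiv_eq_fderiv, mfderiv_comp z h2 h1]
  rfl

/-- The length `|∇u|` of the gradient. -/
def gradNorm (u : M → ℝ) (x : M) : ℝ := √(g.inner x (gradient g u x) (gradient g u x))

theorem abs_inner_gradient_le (u : M → ℝ) (x : M) (v : TangentSpace (𝓡 N) x) :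
    |g.inner x (gradient g u x) v| ≤ gradNorm g u x * √(g.inner x v v) := by
  let _ : RiemannianBundle (fun x : M ↦ TangentSpace (𝓡 N) x) := ⟨g.toRiemannianMetric⟩
  rw [gradNorm, ← Real.sqrt_mul (metric_self_nonneg g x _)]
  refine Real.abs_le_sqrt ?_
  rw [sq]
  exact real_inner_mul_inner_self_le (gradient g u x) v

theorem norm_le_sum_single (L : EuclideanSpace ℝ (Fin N) →L[ℝ] ℝ) :
    ‖L‖ ≤ ∑ k, |L (EuclideanSpace.single k 1)| := by
  refine L.opNorm_le_bound (Finset.sum_nonneg fun _ _ ↦ abs_nonneg _) fun v ↦ ?_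
  have hv : v = ∑ k, v k • EuclideanSpace.single k (1 : ℝ) := by
    ext j
    simp [Finset.sum_apply, Pi.single_apply]
  conv_lhs => rw [hv, map_sum]
  rw [Finset.sum_mul]
  refine (norm_sum_le _ _).trans (Finset.sum_le_sum fun k _ ↦ ?_)
  rw [map_smul, norm_smul, mul_comm]
  exact mul_le_mul_of_nonneg_left (PiLp.norm_apply_le v k) (abs_nonneg _)

/-- The sum of the lengths of the coordinate vector fields. -/
def coordLength (i : M) (z : EuclideanSpace ℝ (Fin N)) : ℝ := ∑ k, √(gram g i z k k)

theorem continuousOn_coordLength (i : M) :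
    ContinuousOn (coordLength g i) (extChartAt (𝓡 N) i).target := by
  refine continuousOn_finsetSum _ fun k _ ↦ Real.continuous_sqrt.comp_continuousOn ?_
  have h2 := (continuousOn_inner_constSec g i (EuclideanSpace.single k 1)
    (EuclideanSpace.single k 1)).comp (continuousOn_extChartAt_symm (I := 𝓡 N) i) fun z hz ↦ by
      simpa using (extChartAt (𝓡 N) i).map_target hz
  refine h2.congr fun z hz ↦ ?_
  simp [gram, coordVec_eq i hz]
  rfl

/-- Each partial derivative is the g-product of ∇u with a coordinate vector field, so Cauchy–Schwarz
for g bounds it by |∇u| times the length of that field. -/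
theorem norm_fderiv_comp_extChartAt_symm_le {u : M → ℝ} (hu : ContMDiff (𝓡 N) 𝓘(ℝ, ℝ) ∞ u) (i : M)
    {z : EuclideanSpace ℝ (Fin N)} (hz : z ∈ (extChartAt (𝓡 N) i).target) :
    ‖fderiv ℝ (u ∘ (extChartAt (𝓡 N) i).symm) z‖ ≤
      coordLength g i z * gradNorm g u ((extChartAt (𝓡 N) i).symm z) := by
  refine (norm_le_sum_single _).trans ?_
  rw [coordLength, Finset.sum_mul]
  refine Finset.sum_le_sum fun k _ ↦ ?_
  rw [fderiv_comp_extChartAt_symm g hu i hz, mul_comm]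
  exact abs_inner_gradient_le g u _ _

variable [T2Space M] [CompactSpace M]

/-- The part `ρᵢ u` of `u` in the coordinates of the chart around `i`, extended by zero. -/
def localize (i : M) (u : M → ℝ) : EuclideanSpace ℝ (Fin N) → ℝ :=
  (extChartAt (𝓡 N) i).target.indicator fun z ↦
    partition N M i ((extChartAt (𝓡 N) i).symm z) * u ((extChartAt (𝓡 N) i).symm z)

variable (N) in
/-- The coordinates of the support of the function `ρᵢ` of the partition of unity. -/
def coordSupport (i : M) : Set (EuclideanSpace ℝ (Fin N)) :=
  extChartAt (𝓡 N) i '' tsupport (partition N M i)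

theorem isCompact_coordSupport (i : M) : IsCompact (coordSupport N i) :=
  isCompact_extChartAt_image (isClosed_tsupport _).isCompact (tsupport_partition_subset i)

theorem coordSupport_subset_target (i : M) : coordSupport N i ⊆ (extChartAt (𝓡 N) i).target :=
  extChartAt_image_subset_target (tsupport_partition_subset i)

theorem support_localize_subset (i : M) (u : M → ℝ) :
    Function.support (localize (N := N) i u) ⊆ coordSupport N i := by
  intro z hz
  have hzt : z ∈ (extChartAt (𝓡 N) i).target := by
    by_contra h
    exact hz (indicator_of_notMem h _)
  rw [Function.mem_support, localize, indicator_of_mem hzt] at hz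
  exact ⟨_, subset_tsupport _ (left_ne_zero_of_mul hz), (extChartAt (𝓡 N) i).right_inv hzt⟩

theorem localize_eqOn (i : M) (u : M → ℝ) : EqOn (localize i u)
    ((partition N M i ∘ (extChartAt (𝓡 N) i).symm) * (u ∘ (extChartAt (𝓡 N) i).symm))
    (extChartAt (𝓡 N) i).target := fun z hz ↦ by
  rw [localize, indicator_of_mem hz]
  rfl

/-- Inside the target it is a product of smooth functions. Any other point has a neighbourhood
missing the compact set `coordSupport`, and the function vanishes there. -/
theorem contDiff_localize (i : M) {u : M → ℝ} (hu : ContMDiff (𝓡 N) 𝓘(ℝ, ℝ) ∞ u) :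
    ContDiff ℝ ∞ (localize (N := N) i u) := by
  rw [contDiff_iff_contDiffAt]
  intro z
  by_cases hz : z ∈ (extChartAt (𝓡 N) i).target
  · have hn := (isOpen_extChartAt_target (I := 𝓡 N) i).mem_nhds hz
    have h := ((contDiffOn_comp_extChartAt_symm (partition N M i).contMDiff i).mul
      (contDiffOn_comp_extChartAt_symm hu i)).contDiffAt hn
    exact h.congr_of_eventuallyEq ((localize_eqOn i u).eventuallyEq_of_mem hn)
  · have hn : (coordSupport N i)ᶜ ∈ 𝓝 z := (isCompact_coordSupport i).isClosed.isOpen_compl.mem_nhds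
      fun h ↦ hz (coordSupport_subset_target i h)
    refine (contDiffAt_const (c := (0 : ℝ))).congr_of_eventuallyEq ?_
    filter_upwards [hn] with w hw
    by_contra h
    exact hw (support_localize_subset i u h)

/-- The product rule: on the compact coordinate support, both the derivative of the partition
function and the lengths of the coordinate fields are bounded. -/
theorem exists_norm_fderiv_localize_le (i : M) : ∃ C : ℝ≥0, ∀ u : M → ℝ,
    ContMDiff (𝓡 N) 𝓘(ℝ, ℝ) ∞ u → ∀ z ∈ coordSupport N i, ‖fderiv ℝ (localize i u) z‖ ≤
      C * (|u ((extChartAt (𝓡 N) i).symm z)| + gradNorm g u ((extChartAt (𝓡 N) i).symm z)) := by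
  have hsub := coordSupport_subset_target (N := N) i
  have ho := isOpen_extChartAt_target (I := 𝓡 N) i
  have hρ := contDiffOn_comp_extChartAt_symm (partition N M i).contMDiff i
  obtain ⟨C₁, h₁⟩ := (isCompact_coordSupport (N := N) i).bddAbove_image
    ((continuousOn_coordLength g i).mono hsub)
  obtain ⟨C₂, h₂⟩ := (isCompact_coordSupport (N := N) i).bddAbove_image
    (((hρ.continuousOn_fderiv_of_isOpen ho (by simp)).mono hsub).norm)
  refine ⟨(max C₁ C₂).toNNReal, fun u hu z hz ↦ ?_⟩
  have hzt := hsub hz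
  have hn := ho.mem_nhds hzt
  have hu' := contDiffOn_comp_extChartAt_symm hu i
  set y := (extChartAt (𝓡 N) i).symm z
  have hG : 0 ≤ gradNorm g u y := Real.sqrt_nonneg _
  rw [((localize_eqOn i u).eventuallyEq_of_mem hn).fderiv_eq,
    fderiv_mul ((hρ.contDiffAt hn).differentiableAt (by simp))
      ((hu'.contDiffAt hn).differentiableAt (by simp))]
  have e1 : ‖fderiv ℝ (u ∘ (extChartAt (𝓡 N) i).symm) z‖ ≤ max C₁ C₂ * gradNorm g u y := by
    refine (norm_fderiv_comp_extChartAt_symm_le g hu i hzt).trans ?_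
    exact mul_le_mul_of_nonneg_right ((h₁ ⟨z, hz, rfl⟩).trans (le_max_left _ _)) hG
  have e2 : ‖fderiv ℝ (partition N M i ∘ (extChartAt (𝓡 N) i).symm) z‖ ≤ max C₁ C₂ :=
    (h₂ ⟨z, hz, rfl⟩).trans (le_max_right _ _)
  have hC : 0 ≤ max C₁ C₂ := (norm_nonneg _).trans e2
  have e3 : |partition N M i y| ≤ 1 := by
    rw [abs_of_nonneg ((partition N M).nonneg i y)]
    exact (partition N M).le_one i y
  rw [Real.coe_toNNReal _ hC]
  refine (norm_add_le _ _).trans ?_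
  rw [norm_smul, norm_smul]
  calc ‖partition N M i y‖ * ‖fderiv ℝ (u ∘ (extChartAt (𝓡 N) i).symm) z‖ +
        ‖u y‖ * ‖fderiv ℝ (partition N M i ∘ (extChartAt (𝓡 N) i).symm) z‖
      ≤ 1 * (max C₁ C₂ * gradNorm g u y) + |u y| * max C₁ C₂ := by
        gcongr
        · exact e3
        · exact le_rfl
    _ = _ := by ring

theorem localize_add (i : M) (u v : M → ℝ) :
    localize (N := N) i (u + v) = localize i u + localize i v := by
  ext z
  by_cases hz : z ∈ (extChartAt (𝓡 N) i).target
  · simp only [localize, indicator_of_mem hz, Pi.add_apply]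
    ring
  · simp only [localize, indicator_of_notMem hz, Pi.add_apply, add_zero]

theorem localize_smul (i : M) (c : ℝ) (u : M → ℝ) :
    localize (N := N) i (c • u) = c • localize i u := by
  ext z
  by_cases hz : z ∈ (extChartAt (𝓡 N) i).target
  · simp only [localize, indicator_of_mem hz, Pi.smul_apply, smul_eq_mul]
    ring
  · simp only [localize, indicator_of_notMem hz, Pi.smul_apply, smul_zero]

variable [MeasurableSpace M] [BorelSpace M]

theorem lintegral_enorm_sq_smoothFn (φ : SmoothFn g) :
    ∫⁻ x, ENNReal.ofReal (φ.fn x ^ 2 + gradNorm g φ.fn x ^ 2) ∂(vol g) = ‖φ‖ₑ ^ 2 := by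
  have h1 : Integrable (fun x ↦ φ.fn x ^ 2) (vol g) :=
    integrable_of_continuous g (φ.contMDiff.continuous.pow 2)
  have h2 : Integrable (fun x ↦ g.inner x (gradient g φ.fn x) (gradient g φ.fn x)) (vol g) :=
    integrable_of_continuous g (continuous_inner_gradient g φ.contMDiff φ.contMDiff)
  have h3 (x : M) : gradNorm g φ.fn x ^ 2 = g.inner x (gradient g φ.fn x) (gradient g φ.fn x) :=
    Real.sq_sqrt (metric_self_nonneg g x _)
  simp only [h3]
  have h4 : Integrable (fun x ↦ φ.fn x ^ 2 +
      g.inner x (gradient g φ.fn x) (gradient g φ.fn x)) (vol g) := h1.add h2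
  rw [← ofReal_integral_eq_lintegral_ofReal h4
    (.of_forall fun x ↦ add_nonneg (sq_nonneg _) (metric_self_nonneg g x _)),
    integral_add h1 h2, ← norm_sq_smoothFn, ENNReal.ofReal_pow (norm_nonneg _), ofReal_norm]

theorem continuous_gradNorm {u : M → ℝ} (hu : ContMDiff (𝓡 N) 𝓘(ℝ, ℝ) ∞ u) :
    Continuous (gradNorm g u) :=
  Real.continuous_sqrt.comp (continuous_inner_gradient g hu hu)

/-- Links the H¹ norm to Euclidean gradients: square the pointwise bound, integrate it, and dominate
chart Lebesgue measure by the volume on the support of the partition function. -/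
theorem exists_eLpNorm_fderiv_localize_le (i : M) : ∃ C : ℝ≥0, ∀ φ : SmoothFn g,
    eLpNorm (fderiv ℝ (localize (N := N) i φ.fn)) 2 volume ≤ C * ‖φ‖ₑ := by
  obtain ⟨C₁, h₁⟩ := exists_norm_fderiv_localize_le g i
  obtain ⟨C₂, h₂⟩ := exists_chartMeasure_restrict_le g i
    (isClosed_tsupport (partition N M i)).isCompact (tsupport_partition_subset i)
  refine ⟨NNReal.sqrt (2 * C₁ ^ 2 * C₂), fun φ ↦ ?_⟩
  set F : M → ℝ≥0∞ := fun x ↦ ENNReal.ofReal (φ.fn x ^ 2 + gradNorm g φ.fn x ^ 2)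
  have hF : Measurable F := by
    have h1 := φ.contMDiff.continuous
    have h2 := continuous_gradNorm g φ.contMDiff
    exact (ENNReal.continuous_ofReal.comp ((h1.pow 2).add (h2.pow 2))).measurable
  have hK := (isCompact_coordSupport (N := N) i).measurableSet
  have hpt : ∀ z ∈ coordSupport N i, ‖fderiv ℝ (localize (N := N) i φ.fn) z‖ₑ ^ 2 ≤
      (2 * C₁ ^ 2 : ℝ≥0) * F ((extChartAt (𝓡 N) i).symm z) := by
    intro z hz
    rw [← ofReal_norm, ← ENNReal.ofReal_pow (norm_nonneg _), ← ENNReal.ofReal_coe_nnreal,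
      ← ENNReal.ofReal_mul NNReal.zero_le_coe]
    refine ENNReal.ofReal_le_ofReal ?_
    have := h₁ φ.fn φ.contMDiff z hz
    set a := φ.fn ((extChartAt (𝓡 N) i).symm z)
    set b := gradNorm g φ.fn ((extChartAt (𝓡 N) i).symm z)
    calc ‖fderiv ℝ (localize (N := N) i φ.fn) z‖ ^ 2 ≤ (C₁ * (|a| + b)) ^ 2 := by gcongr
      _ = C₁ ^ 2 * (|a| + b) ^ 2 := by ring
      _ ≤ C₁ ^ 2 * (2 * (|a| ^ 2 + b ^ 2)) := by
        gcongr
        nlinarith [sq_nonneg (|a| - b)]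
      _ = _ := by
        rw [sq_abs]
        push_cast
        ring
  have hmain : ∫⁻ z, ‖fderiv ℝ (localize (N := N) i φ.fn) z‖ₑ ^ 2 ≤
      (2 * C₁ ^ 2 * C₂ : ℝ≥0) * ‖φ‖ₑ ^ 2 := by
    have hs := support_fderiv_subset_of_isClosed (isCompact_coordSupport i).isClosed
      (support_localize_subset (N := N) i φ.fn)
    rw [← setLIntegral_eq_of_support_subset (s := coordSupport N i)
      (fun x hx ↦ hs fun h0 ↦ hx (by simp only [← ofReal_norm, h0, norm_zero]; simp))]
    calc ∫⁻ z in coordSupport N i, ‖fderiv ℝ (localize (N := N) i φ.fn) z‖ₑ ^ 2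
        ≤ ∫⁻ z in coordSupport N i, (2 * C₁ ^ 2 : ℝ≥0) * F ((extChartAt (𝓡 N) i).symm z) :=
          setLIntegral_mono' hK hpt
      _ = (2 * C₁ ^ 2 : ℝ≥0) * ∫⁻ z in coordSupport N i, F ((extChartAt (𝓡 N) i).symm z) :=
          lintegral_const_mul' _ _ ENNReal.coe_ne_top
      _ ≤ (2 * C₁ ^ 2 : ℝ≥0) * ∫⁻ x in tsupport (partition N M i), F x ∂(chartMeasure (N := N) i) := by
          gcongr
          rw [← lintegral_indicator (isClosed_tsupport _).measurableSet, chartMeasure,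
            lintegral_map' (hF.indicator (isClosed_tsupport _).measurableSet).aemeasurable
              (aemeasurable_extChartAt_symm i _), ← lintegral_indicator hK,
            ← lintegral_indicator (isOpen_extChartAt_target (I := 𝓡 N) i).measurableSet]
          refine lintegral_mono fun z ↦ ?_
          by_cases hz : z ∈ coordSupport N i
          · obtain ⟨y, hy, rfl⟩ := id hz
            have hy' : (extChartAt (𝓡 N) i).symm (extChartAt (𝓡 N) i y) = y :=
              (extChartAt (𝓡 N) i).left_inv (tsupport_partition_subset i hy)
            rw [indicator_of_mem hz, indicator_of_mem (coordSupport_subset_target i hz),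
              indicator_of_mem (by rwa [hy'])]
          · rw [indicator_of_notMem hz]
            exact zero_le
      _ ≤ (2 * C₁ ^ 2 : ℝ≥0) * (C₂ * ∫⁻ x, F x ∂(vol g)) := by
          refine mul_le_mul' le_rfl ((lintegral_mono' h₂ le_rfl).trans ?_)
          rw [lintegral_smul_measure, ENNReal.smul_def, smul_eq_mul]
          exact mul_le_mul' le_rfl (setLIntegral_le_lintegral _ _)
      _ = _ := by
          rw [lintegral_enorm_sq_smoothFn, ENNReal.coe_mul (2 * C₁ ^ 2) C₂, mul_assoc]
  have h2 : eLpNorm (fderiv ℝ (localize (N := N) i φ.fn)) 2 volume ^ 2 =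
      ∫⁻ z, ‖fderiv ℝ (localize (N := N) i φ.fn) z‖ₑ ^ 2 := by
    have := eLpNorm_nnreal_pow_eq_lintegral (μ := volume) (p := 2)
      (f := fderiv ℝ (localize (N := N) i φ.fn)) (by norm_num)
    simpa using this
  refine (ENNReal.pow_le_pow_left_iff two_ne_zero).1 ?_
  rw [h2, mul_pow, ← ENNReal.coe_pow, NNReal.sq_sqrt]
  exact hmain

end Localization

/-! ### Compactness expressed by norm bounds modulo finitely many functionals. -/

section CompactBound

open scoped ENNReal NNReal

variable {E : Type*} [SeminormedAddCommGroup E] [NormedSpace ℝ E]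

/-- The function `n` is controlled by an arbitrarily small multiple of the norm, up to finitely
many continuous linear functionals. -/
def HasCompactBound (n : E → ℝ≥0∞) : Prop :=
  ∀ η : ℝ≥0, 0 < η → ∃ (T : Finset (E →L[ℝ] ℝ)) (C : ℝ≥0), ∀ x,
    n x ≤ η * ‖x‖ₑ + C * ∑ l ∈ T, ‖l x‖ₑ

theorem HasCompactBound.of_le {n m : E → ℝ≥0∞} (hm : HasCompactBound m) (c : ℝ≥0)
    (h : ∀ x, n x ≤ c * m x) : HasCompactBound n := by
  intro η hη
  -- The summand 1 covers the case c = 0.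
  obtain ⟨T, C, hT⟩ := hm (η / (c + 1)) (by positivity)
  refine ⟨T, c * C, fun x ↦ (h x).trans ?_⟩
  calc c * m x ≤ c * ((η / (c + 1) : ℝ≥0) * ‖x‖ₑ + C * ∑ l ∈ T, ‖l x‖ₑ) := by
        gcongr
        exact hT x
    _ = (c * (η / (c + 1)) : ℝ≥0) * ‖x‖ₑ + (c * C : ℝ≥0) * ∑ l ∈ T, ‖l x‖ₑ := by
        rw [ENNReal.coe_mul, ENNReal.coe_mul]
        ring
    _ ≤ _ := by
        gcongr
        rw [mul_div_assoc', div_le_iff₀ (by positivity), mul_comm]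
        gcongr
        exact le_self_add

theorem HasCompactBound.add {n m : E → ℝ≥0∞} (hn : HasCompactBound n) (hm : HasCompactBound m) :
    HasCompactBound (fun x ↦ n x + m x) := by
  classical
  intro η hη
  obtain ⟨T₁, C₁, h₁⟩ := hn (η / 2) (by positivity)
  obtain ⟨T₂, C₂, h₂⟩ := hm (η / 2) (by positivity)
  refine ⟨T₁ ∪ T₂, C₁ + C₂, fun x ↦ (add_le_add (h₁ x) (h₂ x)).trans ?_⟩
  have e₁ : ∑ l ∈ T₁, ‖l x‖ₑ ≤ ∑ l ∈ T₁ ∪ T₂, ‖l x‖ₑ :=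
    Finset.sum_le_sum_of_subset Finset.subset_union_left
  have e₂ : ∑ l ∈ T₂, ‖l x‖ₑ ≤ ∑ l ∈ T₁ ∪ T₂, ‖l x‖ₑ :=
    Finset.sum_le_sum_of_subset Finset.subset_union_right
  calc (η / 2 : ℝ≥0) * ‖x‖ₑ + C₁ * ∑ l ∈ T₁, ‖l x‖ₑ +
        ((η / 2 : ℝ≥0) * ‖x‖ₑ + C₂ * ∑ l ∈ T₂, ‖l x‖ₑ)
      = ((η / 2 + η / 2 : ℝ≥0) * ‖x‖ₑ) + (C₁ * ∑ l ∈ T₁, ‖l x‖ₑ + C₂ * ∑ l ∈ T₂, ‖l x‖ₑ) := by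
        rw [ENNReal.coe_add]
        ring
    _ ≤ η * ‖x‖ₑ + (C₁ * ∑ l ∈ T₁ ∪ T₂, ‖l x‖ₑ + C₂ * ∑ l ∈ T₁ ∪ T₂, ‖l x‖ₑ) := by
        rw [add_halves]
        gcongr
    _ = _ := by rw [ENNReal.coe_add, add_mul]

theorem HasCompactBound.zero : HasCompactBound (fun _ : E ↦ (0 : ℝ≥0∞)) :=
  fun _ _ ↦ ⟨∅, 0, fun _ ↦ zero_le⟩

theorem HasCompactBound.sum {ι : Type*} (s : Finset ι) {n : ι → E → ℝ≥0∞}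
    (h : ∀ i ∈ s, HasCompactBound (n i)) : HasCompactBound (fun x ↦ ∑ i ∈ s, n i x) := by
  classical
  induction s using Finset.induction_on with
  | empty => simpa using HasCompactBound.zero
  | insert i s hi ih =>
    simp only [Finset.sum_insert hi]
    exact (h i (Finset.mem_insert_self i s)).add (ih fun j hj ↦ h j (Finset.mem_insert_of_mem hj))

/-- A continuous linear map whose norm has a compact bound maps balls to totally bounded sets. -/
theorem HasCompactBound.totallyBounded {F : Type*} [NormedAddCommGroup F] [NormedSpace ℝ F]
    {T : E →L[ℝ] F} (h : HasCompactBound fun x ↦ ‖T x‖ₑ) (R : ℝ) :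
    TotallyBounded (T '' Metric.closedBall 0 R) := by
  rw [Metric.totallyBounded_iff]
  intro ε hε
  -- The tolerance ε/(4R) used below requires R > 0; for R ≤ 0 the ball lies in the unit ball.
  wlog hR : 0 < R generalizing R
  · obtain ⟨t, ht, hs⟩ := this 1 one_pos
    refine ⟨t, ht, (image_mono (Metric.closedBall_subset_closedBall ?_)).trans hs⟩
    linarith [not_lt.1 hR]
  obtain ⟨S, C, hS⟩ := h (ε / (4 * R)).toNNReal (by simpa using by positivity)
  -- The finitely many functionals send the ball to a bounded set in finite dimension, which has a
  -- finite δ-net. Pulling the net back to points c y of the ball gives errors of at most ε/2 from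
  -- the norm term and ε/4 from the functionals.
  set L : E →L[ℝ] (S → ℝ) := ContinuousLinearMap.pi fun l ↦ l.1
  have htb : TotallyBounded (L '' Metric.closedBall 0 R) :=
    ((L.lipschitz.isBounded_image Metric.isBounded_closedBall).isCompact_closure.totallyBounded).subset
      subset_closure
  set δ : ℝ := ε / (4 * (C + 1) * (S.card + 1)) with hδ
  have hδ0 : 0 < δ := by positivity
  obtain ⟨t, hts, htf, htc⟩ := Metric.finite_approx_of_totallyBounded htb δ hδ0
  have hts' : ∀ y ∈ t, ∃ x, x ∈ Metric.closedBall (0 : E) R ∧ L x = y := fun y hy ↦ hts hy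
  choose! c hc using hts'
  refine ⟨(fun y ↦ T (c y)) '' t, htf.image _, ?_⟩
  rintro _ ⟨x, hx, rfl⟩
  obtain ⟨y, hyt, hy⟩ := mem_iUnion₂.1 (htc ⟨x, hx, rfl⟩)
  refine mem_iUnion₂.2 ⟨T (c y), ⟨y, hyt, rfl⟩, ?_⟩
  have h1 := hS (x - c y)
  have hxc : ‖x - c y‖ ≤ 2 * R := by
    have e1 : ‖x‖ ≤ R := by simpa using hx
    have e2 : ‖c y‖ ≤ R := by simpa using (hc y hyt).1
    have := norm_sub_le x (c y)
    linarith
  have hl : ∀ l ∈ S, ‖l (x - c y)‖ₑ ≤ ENNReal.ofReal δ := by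
    intro l hl
    rw [← ofReal_norm]
    refine ENNReal.ofReal_le_ofReal ?_
    have e1 : ‖L x - y‖ ≤ δ := by
      rw [← dist_eq_norm]
      exact (Metric.mem_ball.1 hy).le
    rw [← (hc y hyt).2, ← map_sub] at e1
    exact (norm_le_pi_norm (L (x - c y)) ⟨l, hl⟩).trans e1
  have h2 : ‖T (x - c y)‖ₑ ≤ ENNReal.ofReal (3 / 4 * ε) := by
    refine h1.trans ?_
    calc ((ε / (4 * R)).toNNReal : ℝ≥0∞) * ‖x - c y‖ₑ + C * ∑ l ∈ S, ‖l (x - c y)‖ₑ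
        ≤ ENNReal.ofReal (ε / (4 * R)) * ENNReal.ofReal (2 * R) +
          C * ∑ l ∈ S, ENNReal.ofReal δ := by
          gcongr with l hl'
          · exact le_rfl
          · rw [← ofReal_norm]
            exact ENNReal.ofReal_le_ofReal hxc
          · exact hl l hl'
      _ = ENNReal.ofReal (ε / (4 * R) * (2 * R) + C * (S.card * δ)) := by
          rw [Finset.sum_const, nsmul_eq_mul, ENNReal.ofReal_add (by positivity) (by positivity),
            ENNReal.ofReal_mul (by positivity), ENNReal.ofReal_mul (p := (C : ℝ)) (by positivity),
            ENNReal.ofReal_mul (by positivity)]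
          simp
      _ ≤ ENNReal.ofReal (3 / 4 * ε) := by
          refine ENNReal.ofReal_le_ofReal ?_
          have e1 : ε / (4 * R) * (2 * R) = ε / 2 := by field_simp; norm_num
          have e2 : (C : ℝ) * (S.card * δ) ≤ ε / 4 := by
            have hC : (0 : ℝ) ≤ C := C.2
            have hc : (0 : ℝ) ≤ S.card := by positivity
            calc (C : ℝ) * (S.card * δ) ≤ (C + 1) * ((S.card + 1) * δ) := by gcongr <;> linarith
              _ = ε / 4 := by
                rw [hδ]
                field_simp
          linarith
  rw [Metric.mem_ball, dist_eq_norm, ← map_sub]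
  rw [← ofReal_norm, ENNReal.ofReal_le_ofReal_iff (by positivity)] at h2
  linarith

end CompactBound

/-! ### Sobolev and Rellich inequalities for smooth functions on M. -/

section GlobalSobolev

set_option linter.unusedSectionVars false

open scoped ENNReal NNReal

theorem sum_sq_le_sq_sum {ι : Type*} (s : Finset ι) (f : ι → ℝ≥0∞) :
    ∑ i ∈ s, f i ^ 2 ≤ (∑ i ∈ s, f i) ^ 2 := by
  classical
  induction s using Finset.induction_on with
  | empty => simp
  | insert i s hi ih =>
    rw [Finset.sum_insert hi, Finset.sum_insert hi, add_sq]
    refine add_le_add ?_ ih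
    exact le_self_add

theorem eLpNorm_two_sq {α F : Type*} [MeasurableSpace α] {μ : Measure α} [NormedAddCommGroup F]
    (f : α → F) : eLpNorm f 2 μ ^ 2 = ∫⁻ x, ‖f x‖ₑ ^ 2 ∂μ := by
  have := eLpNorm_nnreal_pow_eq_lintegral (μ := μ) (p := 2) (f := f) (by norm_num)
  simpa using this

variable {N : ℕ} {M : Type*} [TopologicalSpace M] [ChartedSpace (EuclideanSpace ℝ (Fin N)) M]
  [IsManifold (𝓡 N) ∞ M] [T2Space M] [CompactSpace M] [MeasurableSpace M] [BorelSpace M]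
  (g : RMetric N M)

/-- The passage from M back to coordinates: the volume is dominated by chart Lebesgue measure on the
support of the partition function, and a factor C on the measure becomes C^(1/q) on the norm. -/
theorem exists_eLpNorm_partition_mul_le (i : M) (q : ℝ≥0) : ∃ C : ℝ≥0,
    ∀ u : M → ℝ, Continuous u → eLpNorm (fun x ↦ partition N M i x * u x) q (vol g) ≤
      C * eLpNorm (localize (N := N) i u) q volume := by
  set K := tsupport (partition N M i)
  obtain ⟨C, hC⟩ := exists_vol_restrict_le g i
    (isClosed_tsupport (partition N M i)).isCompact (tsupport_partition_subset i)
  refine ⟨C ^ (1 / (q : ℝ)), fun u hu ↦ ?_⟩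
  have hcont : Continuous fun x ↦ partition N M i x * u x :=
    (partition N M i).contMDiff.continuous.mul hu
  have hsupp : (Function.support fun x ↦ partition N M i x * u x) ⊆ K := fun x hx ↦
    subset_tsupport _ (left_ne_zero_of_mul hx)
  have ht : MeasurableSet (extChartAt (𝓡 N) i).target :=
    (isOpen_extChartAt_target (I := 𝓡 N) i).measurableSet
  calc eLpNorm (fun x ↦ partition N M i x * u x) q (vol g)
      = eLpNorm (fun x ↦ partition N M i x * u x) q ((vol g).restrict K) :=
        (eLpNorm_restrict_eq_of_support_subset hsupp).symm
    _ ≤ eLpNorm (fun x ↦ partition N M i x * u x) q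
        (C • (chartMeasure (N := N) i).restrict K) := eLpNorm_mono_measure _ hC
    _ = (C ^ (1 / (q : ℝ)) : ℝ≥0) * eLpNorm (fun x ↦ partition N M i x * u x) q
        ((chartMeasure (N := N) i).restrict K) := by
        rw [eLpNorm_smul_measure_of_ne_top' (by simp)]
        simp [ENNReal.smul_def]
    _ ≤ (C ^ (1 / (q : ℝ)) : ℝ≥0) * eLpNorm (fun x ↦ partition N M i x * u x) q
        (chartMeasure (N := N) i) := by
        refine mul_le_mul' le_rfl (eLpNorm_mono_measure _ Measure.restrict_le_self)
    _ = (C ^ (1 / (q : ℝ)) : ℝ≥0) * eLpNorm (localize (N := N) i u) q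
        (volume.restrict (extChartAt (𝓡 N) i).target) := by
        rw [chartMeasure, eLpNorm_map_measure hcont.aestronglyMeasurable
          (aemeasurable_extChartAt_symm i _)]
        congr 1
        refine eLpNorm_congr_ae ((ae_restrict_iff' ht).2 (.of_forall fun z hz ↦ ?_))
        rw [localize_eqOn i u hz]
        rfl
    _ ≤ _ := mul_le_mul' le_rfl (eLpNorm_mono_measure _ Measure.restrict_le_self)

theorem eLpNorm_le_sum_partition {u : M → ℝ} (hu : Continuous u) {q : ℝ≥0∞} (hq : 1 ≤ q) :
    eLpNorm u q (vol g) ≤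
      ∑ i ∈ partIndex N M, eLpNorm (fun x ↦ partition N M i x * u x) q (vol g) := by
  have h : u = ∑ i ∈ partIndex N M, fun x ↦ partition N M i x * u x := by
    ext x
    rw [Finset.sum_apply, ← Finset.sum_mul, sum_partition, one_mul]
  conv_lhs => rw [h]
  exact eLpNorm_sum_le (fun i _ ↦
    ((partition N M i).contMDiff.continuous.mul hu).aestronglyMeasurable) hq

/-- The Sobolev inequality for smooth functions on a compact manifold. -/
theorem exists_eLpNorm_smoothFn_le (hN : 1 ≤ N) {q : ℝ≥0} (hq2 : 2 ≤ q)
    (hq : 3 ≤ N → (q : ℝ) < 2 * N / ((N : ℝ) - 2)) :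
    ∃ C : ℝ≥0, ∀ φ : SmoothFn g, eLpNorm φ.fn q (vol g) ≤ C * ‖φ‖ₑ := by
  have h (i : M) : ∃ C : ℝ≥0, ∀ φ : SmoothFn g,
      eLpNorm (fun x ↦ partition N M i x * φ.fn x) q (vol g) ≤ C * ‖φ‖ₑ := by
    obtain ⟨C₁, h₁⟩ := exists_eLpNorm_partition_mul_le g i q
    obtain ⟨C₂, h₂⟩ := exists_eLpNorm_le_eLpNorm_fderiv hN (isCompact_coordSupport (N := N) i) hq2 hq
    obtain ⟨C₃, h₃⟩ := exists_eLpNorm_fderiv_localize_le g i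
    refine ⟨C₁ * C₂ * C₃, fun φ ↦ (h₁ φ.fn φ.contMDiff.continuous).trans ?_⟩
    rw [ENNReal.coe_mul, ENNReal.coe_mul, mul_assoc, mul_assoc]
    refine mul_le_mul' le_rfl ((h₂ _ ((contDiff_localize i φ.contMDiff).of_le (by simp))
      (support_localize_subset i _)).trans ?_)
    exact mul_le_mul' le_rfl (h₃ φ)
  choose C hC using h
  refine ⟨∑ i ∈ partIndex N M, C i, fun φ ↦ ?_⟩
  refine (eLpNorm_le_sum_partition g φ.contMDiff.continuous
    (by exact_mod_cast (one_le_two.trans hq2))).trans ?_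
  rw [ENNReal.ofNNReal_finsetSum, Finset.sum_mul]
  exact Finset.sum_le_sum fun i _ ↦ hC i φ

theorem integrable_localize (i : M) (φ : SmoothFn g) :
    Integrable (localize (N := N) i φ.fn) volume :=
  (contDiff_localize i φ.contMDiff).continuous.integrable_of_hasCompactSupport
    (HasCompactSupport.of_support_subset_isCompact (isCompact_coordSupport i)
      (support_localize_subset i _))

theorem exists_eLpNorm_localize_le (hN : 1 ≤ N) (i : M) : ∃ C : ℝ≥0, ∀ φ : SmoothFn g,
    eLpNorm (localize (N := N) i φ.fn) 2 volume ≤ C * ‖φ‖ₑ := by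
  obtain ⟨C₂, h₂⟩ := exists_eLpNorm_le_eLpNorm_fderiv hN (isCompact_coordSupport (N := N) i)
    (q := 2) le_rfl (fun h ↦ by
      have : (3 : ℝ) ≤ N := by exact_mod_cast h
      rw [lt_div_iff₀ (by linarith)]
      push_cast
      linarith)
  obtain ⟨C₃, h₃⟩ := exists_eLpNorm_fderiv_localize_le g i
  refine ⟨C₂ * C₃, fun φ ↦ ?_⟩
  rw [ENNReal.coe_mul, mul_assoc]
  exact (h₂ _ ((contDiff_localize i φ.contMDiff).of_le (by simp))
    (support_localize_subset i _)).trans (mul_le_mul' le_rfl (h₃ φ))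

/-- These integrals over balls are the functionals of the compact bound; they are continuous for the
H¹ norm by Cauchy–Schwarz on the ball and the L² bound on the localized function. -/
theorem exists_clm_setIntegral_localize (hN : 1 ≤ N) (i : M) (s : EuclideanSpace ℝ (Fin N)) (r : ℝ) :
    ∃ l : SmoothFn g →L[ℝ] ℝ, ∀ φ, l φ = ∫ z in Metric.ball s r, localize i φ.fn z := by
  obtain ⟨C, hC⟩ := exists_eLpNorm_localize_le g hN i
  refine ⟨LinearMap.mkContinuous
    { toFun := fun φ ↦ ∫ z in Metric.ball s r, localize i φ.fn z
      map_add' := fun φ ψ ↦ ?_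
      map_smul' := fun c φ ↦ ?_ }
    (NNReal.sqrt (volume (Metric.ball s r)).toNNReal * C) fun φ ↦ ?_, fun φ ↦ rfl⟩
  · rw [← integral_add (integrable_localize g i φ).integrableOn
      (integrable_localize g i ψ).integrableOn]
    exact integral_congr_ae (.of_forall fun z ↦
      congrFun (localize_add (N := N) i φ.fn ψ.fn) z)
  · rw [RingHom.id_apply, smul_eq_mul, ← integral_const_mul]
    exact integral_congr_ae (.of_forall fun z ↦ congrFun (localize_smul (N := N) i c φ.fn) z)
  · have h1 : ‖∫ z in Metric.ball s r, localize i φ.fn z‖ₑ ≤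
        (NNReal.sqrt (volume (Metric.ball s r)).toNNReal * C : ℝ≥0) * ‖φ‖ₑ := by
      refine (ENNReal.pow_le_pow_left_iff two_ne_zero).1 ?_
      have hm : AEMeasurable (fun z ↦ ‖localize (N := N) i φ.fn z‖ₑ)
          (volume.restrict (Metric.ball s r)) :=
        (contDiff_localize i φ.contMDiff).continuous.enorm.measurable.aemeasurable
      calc ‖∫ z in Metric.ball s r, localize i φ.fn z‖ₑ ^ 2
          ≤ (∫⁻ z in Metric.ball s r, ‖localize i φ.fn z‖ₑ) ^ 2 := by
            gcongr
            exact enorm_integral_le_lintegral_enorm _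
        _ ≤ volume (Metric.ball s r) * ∫⁻ z in Metric.ball s r, ‖localize i φ.fn z‖ₑ ^ 2 := by
            simpa using sq_lintegral_le _ hm
        _ ≤ volume (Metric.ball s r) * eLpNorm (localize i φ.fn) 2 volume ^ 2 := by
            rw [eLpNorm_two_sq]
            exact mul_le_mul' le_rfl (setLIntegral_le_lintegral _ _)
        _ ≤ volume (Metric.ball s r) * (C * ‖φ‖ₑ) ^ 2 := by
            gcongr
            exact hC φ
        _ = _ := by
            rw [ENNReal.coe_mul, mul_assoc, mul_pow _ (C * ‖φ‖ₑ), ← ENNReal.coe_pow, NNReal.sq_sqrt,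
              ENNReal.coe_toNNReal measure_ball_lt_top.ne]
    rw [enorm_eq_nnnorm, enorm_eq_nnnorm, ← ENNReal.coe_mul, ENNReal.coe_le_coe] at h1
    exact_mod_cast h1

/-- The `L²` norm has a compact bound on smooth functions with the `H¹` norm: this is the Rellich
theorem. -/
theorem hasCompactBound_eLpNorm_two (hN : 1 ≤ N) :
    HasCompactBound fun φ : SmoothFn g ↦ eLpNorm φ.fn 2 (vol g) := by
  classical
  have h (i : M) : HasCompactBound fun φ : SmoothFn g ↦
      eLpNorm (localize (N := N) i φ.fn) 2 volume := by
    obtain ⟨C₁, h₁⟩ := exists_eLpNorm_fderiv_localize_le g i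
    intro η hη
    -- The Euclidean estimate is for squared norms, hence the squared tolerance; the division by C₁
    -- + 1 absorbs the constant comparing Euclidean gradients with the H¹ norm.
    obtain ⟨S, r, C, hS⟩ := exists_lintegral_sq_le_fderiv_add_sum volume
      (isCompact_coordSupport (N := N) i) (η := ((η / (C₁ + 1)) ^ 2 : ℝ≥0))
      (by positivity)
    choose l hl using fun s ↦ exists_clm_setIntegral_localize g hN i s r
    -- Distinct centres may give the same functional and merge in the image; the factor `S.card`
    -- compensates for the lost multiplicity.
    refine ⟨S.image l, NNReal.sqrt C * S.card, fun φ ↦ ?_⟩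
    have e1 := hS _ ((contDiff_localize i φ.contMDiff).of_le (by simp))
      (support_localize_subset i φ.fn)
    rw [← eLpNorm_two_sq, ← eLpNorm_two_sq, ENNReal.ofReal_coe_nnreal] at e1
    set D := eLpNorm (fderiv ℝ (localize (N := N) i φ.fn)) 2 volume
    have e2 : ∑ s ∈ S, ‖∫ y in Metric.ball s r, localize i φ.fn y‖ₑ ≤
        S.card * ∑ l ∈ S.image l, ‖l φ‖ₑ := by
      rw [← nsmul_eq_mul, ← Finset.sum_const]
      refine Finset.sum_le_sum fun s hs ↦ ?_
      rw [← hl]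
      exact Finset.single_le_sum (f := fun l : SmoothFn g →L[ℝ] ℝ ↦ ‖l φ‖ₑ)
        (fun _ _ ↦ zero_le) (Finset.mem_image_of_mem l hs)
    set A := ∑ s ∈ S, ‖∫ y in Metric.ball s r, localize i φ.fn y‖ₑ
    have e3 : eLpNorm (localize (N := N) i φ.fn) 2 volume ≤
        (η / (C₁ + 1) : ℝ≥0) * D + NNReal.sqrt C * A := by
      refine (ENNReal.pow_le_pow_left_iff two_ne_zero).1 (e1.trans ?_)
      calc (((η / (C₁ + 1)) ^ 2 : ℝ≥0) : ℝ≥0∞) * D ^ 2 +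
            C * ∑ s ∈ S, ‖∫ y in Metric.ball s r, localize i φ.fn y‖ₑ ^ 2
          ≤ ((η / (C₁ + 1) : ℝ≥0) * D) ^ 2 + (NNReal.sqrt C * A) ^ 2 := by
            rw [mul_pow, mul_pow, ← ENNReal.coe_pow, ← ENNReal.coe_pow, NNReal.sq_sqrt]
            gcongr
            exact sum_sq_le_sq_sum _ _
        _ ≤ _ := by
            rw [add_sq]
            gcongr
            exact le_self_add
    refine e3.trans ?_
    have e4 : ((η / (C₁ + 1) : ℝ≥0) : ℝ≥0∞) * D ≤ η * ‖φ‖ₑ := by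
      refine (mul_le_mul' le_rfl (h₁ φ)).trans ?_
      rw [← mul_assoc, ← ENNReal.coe_mul]
      gcongr
      rw [div_mul_eq_mul_div, div_le_iff₀ (by positivity)]
      gcongr
      exact le_self_add
    refine add_le_add e4 ?_
    rw [ENNReal.coe_mul, mul_assoc]
    exact mul_le_mul' le_rfl e2
  have hsum : HasCompactBound fun φ : SmoothFn g ↦
      ∑ i ∈ partIndex N M, eLpNorm (fun x ↦ partition N M i x * φ.fn x) 2 (vol g) := by
    refine HasCompactBound.sum _ fun i _ ↦ ?_
    obtain ⟨C, hC⟩ := exists_eLpNorm_partition_mul_le g i 2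
    exact (h i).of_le C fun φ ↦ hC φ.fn φ.contMDiff.continuous
  refine hsum.of_le 1 fun φ ↦ ?_
  rw [ENNReal.coe_one, one_mul]
  exact eLpNorm_le_sum_partition g φ.contMDiff.continuous one_le_two

end GlobalSobolev

/-! ### Embeddings, compactness and interpolation on the completed space H¹(M). -/

section SobolevSpace

open scoped ENNReal NNReal

variable {N : ℕ} {M : Type*} [TopologicalSpace M] [ChartedSpace (EuclideanSpace ℝ (Fin N)) M]
  [IsManifold (𝓡 N) ∞ M] [T2Space M] [CompactSpace M] [MeasurableSpace M] [BorelSpace M]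
  (g : RMetric N M)

theorem exists_seq_smoothFn_tendsto (u : H1 g) :
    ∃ φ : ℕ → SmoothFn g, Tendsto (fun n ↦ (φ n : H1 g)) atTop (𝓝 u) := by
  obtain ⟨x, hx, hu⟩ := mem_closure_iff_seq_limit.1
    (UniformSpace.Completion.denseRange_coe (α := SmoothFn g) u)
  choose φ hφ using hx
  exact ⟨φ, by simpa only [hφ] using hu⟩

/-- The Sobolev inequality on `H¹(M)`. -/
theorem exists_eLpNorm_fn_le (hN : 1 ≤ N) {q : ℝ≥0} (hq2 : 2 ≤ q)
    (hq : 3 ≤ N → (q : ℝ) < 2 * N / ((N : ℝ) - 2)) :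
    ∃ C : ℝ≥0, ∀ u : H1 g, eLpNorm u.fn q (vol g) ≤ C * ‖u‖ₑ := by
  obtain ⟨C, hC⟩ := exists_eLpNorm_smoothFn_le g hN hq2 hq
  refine ⟨C, fun u ↦ ?_⟩
  obtain ⟨φ, hφ⟩ := exists_seq_smoothFn_tendsto g u
  -- Smooth approximants converge in L², hence almost everywhere along a subsequence; Fatou's lemma
  -- then carries the L^q bound to the limit.
  have h1 : Tendsto (fun n ↦ toL2 g (φ n : H1 g)) atTop (𝓝 (toL2 g u)) :=
    ((toL2 g).continuous.tendsto u).comp hφ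
  have hm := tendstoInMeasure_of_tendsto_eLpNorm two_ne_zero
    (fun n ↦ Lp.aestronglyMeasurable _) (Lp.aestronglyMeasurable _)
    ((Lp.tendsto_Lp_iff_tendsto_eLpNorm' _ _).1 h1)
  obtain ⟨k, hk, hae⟩ := hm.exists_seq_tendsto_ae
  have h2 (n : ℕ) : eLpNorm (toL2 g (φ n : H1 g)) q (vol g) ≤ C * ‖(φ n : H1 g)‖ₑ := by
    rw [toL2_coe, eLpNorm_congr_ae (memLp_smoothFn g (φ n)).coeFn_toLp,
      UniformSpace.Completion.enorm_coe]
    exact hC (φ n)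
  have h3 : Tendsto (fun n ↦ (C : ℝ≥0∞) * ‖(φ (k n) : H1 g)‖ₑ) atTop (𝓝 (C * ‖u‖ₑ)) :=
    ENNReal.Tendsto.const_mul ((hφ.comp hk.tendsto_atTop).enorm) (.inr ENNReal.coe_ne_top)
  calc eLpNorm u.fn q (vol g)
      ≤ liminf (fun n ↦ eLpNorm (toL2 g (φ (k n) : H1 g)) q (vol g)) atTop :=
        Lp.eLpNorm_lim_le_liminf_eLpNorm (fun n ↦ Lp.aestronglyMeasurable _) _ hae
    _ ≤ liminf (fun n ↦ (C : ℝ≥0∞) * ‖(φ (k n) : H1 g)‖ₑ) atTop :=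
        liminf_le_liminf (.of_forall fun n ↦ h2 (k n))
    _ = C * ‖u‖ₑ := h3.liminf_eq

theorem exists_clm_toLp (hN : 1 ≤ N) {q : ℝ≥0} (hq2 : 2 ≤ q) [Fact ((1 : ℝ≥0∞) ≤ q)]
    (hq : 3 ≤ N → (q : ℝ) < 2 * N / ((N : ℝ) - 2)) :
    ∃ T : H1 g →L[ℝ] Lp ℝ q (vol g), ∀ u, T u =ᵐ[vol g] u.fn := by
  obtain ⟨C, hC⟩ := exists_eLpNorm_fn_le g hN hq2 hq
  have hmem (u : H1 g) : MemLp u.fn q (vol g) :=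
    ⟨Lp.aestronglyMeasurable _, (hC u).trans_lt (ENNReal.mul_lt_top (by simp) (by simp))⟩
  refine ⟨LinearMap.mkContinuous
    { toFun := fun u ↦ (hmem u).toLp
      map_add' := fun u v ↦ ?_
      map_smul' := fun c u ↦ ?_ } C fun u ↦ ?_, fun u ↦ (hmem u).coeFn_toLp⟩
  · rw [← MemLp.toLp_add]
    refine MemLp.toLp_congr _ _ ?_
    simp only [H1.fn, map_add]
    exact Lp.coeFn_add _ _
  · rw [RingHom.id_apply, ← MemLp.toLp_const_smul]
    refine MemLp.toLp_congr _ _ ?_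
    simp only [H1.fn, map_smul]
    exact Lp.coeFn_smul _ _
  · change ‖(hmem u).toLp‖ ≤ _
    rw [Lp.norm_toLp]
    refine (ENNReal.toReal_mono (ENNReal.mul_ne_top (by simp) (by simp)) (hC u)).trans ?_
    simp

/-- The Rellich theorem: bounded sequences of `H¹(M)` have subsequences which are Cauchy
in `L²(M)`. -/
theorem exists_subseq_cauchySeq_toL2 (hN : 1 ≤ N) {u : ℕ → H1 g} {R : ℝ} (hu : ∀ n, ‖u n‖ ≤ R) :
    ∃ k : ℕ → ℕ, StrictMono k ∧ CauchySeq fun n ↦ toL2 g (u (k n)) := by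
  have hcb : HasCompactBound fun φ : SmoothFn g ↦ ‖smoothToL2 g φ‖ₑ := by
    refine (hasCompactBound_eLpNorm_two g hN).of_le 1 fun φ ↦ ?_
    rw [ENNReal.coe_one, one_mul]
    exact (Lp.enorm_toLp (memLp_smoothFn g φ)).le
  -- Smooth approximants of an element of norm at most R need only have norm below R + 1 eventually.
  have htb := hcb.totallyBounded (R + 1)
  have hK : IsCompact (closure (smoothToL2 g '' Metric.closedBall 0 (R + 1))) :=
    htb.closure.isCompact_of_isClosed isClosed_closure
  have hmem (n : ℕ) : toL2 g (u n) ∈ closure (smoothToL2 g '' Metric.closedBall 0 (R + 1)) := by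
    obtain ⟨φ, hφ⟩ := exists_seq_smoothFn_tendsto g (u n)
    refine mem_closure_of_tendsto (((toL2 g).continuous.tendsto (u n)).comp hφ) ?_
    filter_upwards [hφ.norm.eventually_lt_const ((hu n).trans_lt (lt_add_one R))] with m hm
    refine ⟨φ m, ?_, (toL2_coe g (φ m)).symm⟩
    rw [UniformSpace.Completion.norm_coe] at hm
    simpa using hm.le
  obtain ⟨v, -, k, hk, hv⟩ := hK.tendsto_subseq hmem
  exact ⟨k, hk, hv.cauchySeq⟩

/-- Split at the threshold s with s^(q-p) = 1/δ: below it t^(p-2) ≤ s^(p-2), and above it t^p ≤ δ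
t^q. -/
theorem rpow_le_add_mul_sq {p q δ : ℝ} (hp : 2 < p) (hpq : p < q) (hδ : 0 < δ) :
    ∃ C : ℝ, 0 ≤ C ∧ ∀ t : ℝ, 0 ≤ t → t ^ p ≤ δ * t ^ q + C * t ^ 2 := by
  set s := δ⁻¹ ^ (1 / (q - p))
  have hs : 0 < s := by positivity
  refine ⟨s ^ (p - 2), by positivity, fun t ht ↦ ?_⟩
  rcases eq_or_lt_of_le ht with rfl | ht0
  · rw [Real.zero_rpow (by linarith), Real.zero_rpow (by linarith)]
    simp
  rcases le_total t s with h | h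
  · have h1 : t ^ p = t ^ (p - 2) * t ^ 2 := by
      rw [← Real.rpow_natCast t 2, ← Real.rpow_add ht0]
      norm_num
    have h2 : t ^ (p - 2) ≤ s ^ (p - 2) := Real.rpow_le_rpow ht h (by linarith)
    have h3 : 0 ≤ δ * t ^ q := by positivity
    rw [h1]
    nlinarith [sq_nonneg t, mul_le_mul_of_nonneg_right h2 (sq_nonneg t)]
  · have h1 : t ^ q = t ^ p * t ^ (q - p) := by
      rw [← Real.rpow_add ht0]
      norm_num
    have h2 : δ⁻¹ ≤ t ^ (q - p) := by
      have h3 := Real.rpow_le_rpow hs.le h (by linarith : 0 ≤ q - p)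
      rwa [← Real.rpow_mul (by positivity), one_div_mul_cancel (by linarith), Real.rpow_one] at h3
    have h3 : t ^ p ≤ δ * t ^ q := by
      rw [h1]
      have h4 : 1 ≤ δ * t ^ (q - p) := by rwa [inv_le_iff_one_le_mul₀' hδ] at h2
      calc t ^ p = t ^ p * 1 := (mul_one _).symm
        _ ≤ t ^ p * (δ * t ^ (q - p)) := by gcongr
        _ = _ := by ring
    have : 0 ≤ s ^ (p - 2) * t ^ 2 := by positivity
    linarith

/-- Interpolation: between `L²` and a larger exponent, smallness in `L²` of functions bounded in
`L^q` gives smallness in `L^p`. -/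
theorem tendsto_eLpNorm_of_interpolation {α ι : Type*} [MeasurableSpace α] {μ : Measure α}
    {p q : ℝ≥0} (hp : 2 < p) (hpq : p < q) {l : Filter ι} {f : ι → α → ℝ}
    (hf : ∀ i, AEStronglyMeasurable (f i) μ) {R : ℝ≥0} (hR : ∀ i, eLpNorm (f i) q μ ≤ R)
    (h2 : Tendsto (fun i ↦ eLpNorm (f i) 2 μ) l (𝓝 0)) :
    Tendsto (fun i ↦ eLpNorm (f i) p μ) l (𝓝 0) := by
  have hp0 : p ≠ 0 := (lt_trans (by norm_num) hp).ne'
  have hq0 : q ≠ 0 := ((lt_trans (by norm_num) hp).trans hpq).ne'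
  have hpr : (2 : ℝ) < p := by exact_mod_cast hp
  -- The pointwise inequality, integrated. Afterwards δ is fixed first to make the L^q term small,
  -- and then the L² term tends to 0 with its constant frozen.
  have hkey (δ : ℝ) (hδ : 0 < δ) : ∃ C : ℝ≥0, ∀ i, eLpNorm (f i) p μ ^ (p : ℝ) ≤
      ENNReal.ofReal δ * (R : ℝ≥0∞) ^ (q : ℝ) + C * eLpNorm (f i) 2 μ ^ 2 := by
    obtain ⟨C, hC0, hC⟩ := rpow_le_add_mul_sq hpr (by exact_mod_cast hpq : (p : ℝ) < q) hδ
    refine ⟨C.toNNReal, fun i ↦ ?_⟩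
    have hpt (x : α) : ‖f i x‖ₑ ^ (p : ℝ) ≤ ENNReal.ofReal δ * ‖f i x‖ₑ ^ (q : ℝ) +
        (C.toNNReal : ℝ≥0∞) * ‖f i x‖ₑ ^ 2 := by
      have h := ENNReal.ofReal_le_ofReal (hC _ (abs_nonneg (f i x)))
      simp only [Real.enorm_eq_ofReal_abs]
      rw [ENNReal.ofReal_rpow_of_nonneg (abs_nonneg _) p.coe_nonneg,
        ENNReal.ofReal_rpow_of_nonneg (abs_nonneg _) q.coe_nonneg, ← ENNReal.ofReal_pow (abs_nonneg _)]
      change _ ≤ _ + ENNReal.ofReal C * _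
      rwa [← ENNReal.ofReal_mul hδ.le, ← ENNReal.ofReal_mul hC0, ← ENNReal.ofReal_add
        (by positivity) (by positivity)]
    have hm (r : ℝ) : AEMeasurable (fun x ↦ ‖f i x‖ₑ ^ r) μ := (hf i).enorm.pow_const _
    calc eLpNorm (f i) p μ ^ (p : ℝ) = ∫⁻ x, ‖f i x‖ₑ ^ (p : ℝ) ∂μ :=
          eLpNorm_nnreal_pow_eq_lintegral hp0
      _ ≤ ∫⁻ x, (ENNReal.ofReal δ * ‖f i x‖ₑ ^ (q : ℝ) +
            (C.toNNReal : ℝ≥0∞) * ‖f i x‖ₑ ^ 2) ∂μ := lintegral_mono hpt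
      _ = ENNReal.ofReal δ * eLpNorm (f i) q μ ^ (q : ℝ) + C.toNNReal * eLpNorm (f i) 2 μ ^ 2 := by
          rw [lintegral_add_left' ((hm _).const_mul _), lintegral_const_mul'' _ (hm _),
            lintegral_const_mul' _ _ ENNReal.coe_ne_top, eLpNorm_nnreal_pow_eq_lintegral hq0,
            eLpNorm_two_sq]
      _ ≤ _ := by
          gcongr
          exact hR i
  have hpow : Tendsto (fun i ↦ eLpNorm (f i) p μ ^ (p : ℝ)) l (𝓝 0) := by
    rw [ENNReal.tendsto_nhds_zero]
    intro ε hε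
    obtain ⟨δ, hδ, hδε⟩ : ∃ δ : ℝ, 0 < δ ∧ ENNReal.ofReal δ * (R : ℝ≥0∞) ^ (q : ℝ) ≤ ε / 2 := by
      have h1 : Tendsto (fun δ : ℝ ↦ ENNReal.ofReal δ * (R : ℝ≥0∞) ^ (q : ℝ)) (𝓝[>] 0) (𝓝 0) := by
        have h3 : Tendsto (fun δ : ℝ ↦ ENNReal.ofReal δ) (𝓝[>] 0) (𝓝 0) := by
          simpa using (ENNReal.continuous_ofReal.tendsto 0).mono_left nhdsWithin_le_nhds
        simpa using ENNReal.Tendsto.mul_const h3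
          (.inr (ENNReal.rpow_ne_top_of_nonneg q.coe_nonneg ENNReal.coe_ne_top))
      obtain ⟨δ, h3, h4⟩ := ((ENNReal.tendsto_nhds_zero.1 h1 (ε / 2) (by simpa using hε.ne')).and
        self_mem_nhdsWithin).exists
      exact ⟨δ, h4, h3⟩
    obtain ⟨C, hC⟩ := hkey δ hδ
    have h3 : Tendsto (fun i ↦ C * eLpNorm (f i) 2 μ ^ 2) l (𝓝 0) := by
      have h4 := ENNReal.Tendsto.const_mul (a := (C : ℝ≥0∞)) (ENNReal.Tendsto.pow (n := 2) h2) (.inr ENNReal.coe_ne_top)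
      simpa using h4
    filter_upwards [ENNReal.tendsto_nhds_zero.1 h3 (ε / 2) (by simpa using hε.ne')] with i hi
    calc eLpNorm (f i) p μ ^ (p : ℝ) ≤ ε / 2 + ε / 2 := (hC i).trans (add_le_add hδε hi)
      _ = ε := ENNReal.add_halves ε
  have hp' : (0 : ℝ) < p := by linarith
  have h3 : Tendsto (fun i ↦ (eLpNorm (f i) p μ ^ (p : ℝ)) ^ (p : ℝ)⁻¹) l
      (𝓝 (0 ^ (p : ℝ)⁻¹)) := (ENNReal.continuous_rpow_const.tendsto 0).comp hpow
  rw [ENNReal.zero_rpow_of_pos (by positivity)] at h3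
  simpa only [ENNReal.rpow_rpow_inv hp'.ne'] using h3

theorem dirichlet_nonneg (u : H1 g) : 0 ≤ dirichlet g u := by
  induction u using UniformSpace.Completion.induction_on with
  | hp => exact isClosed_le continuous_const (continuous_dirichlet g)
  | ih φ =>
    rw [dirichlet_coe]
    exact integral_nonneg fun x ↦ metric_self_nonneg g x _

/-- The volume is finite, so the integral is the L² product with the constant 1. This makes the
constraint closed. -/
theorem continuous_integral_fn : Continuous fun u : H1 g ↦ ∫ x, u.fn x ∂(vol g) := by
  have h (u : H1 g) : ∫ x, u.fn x ∂(vol g) =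
      inner ℝ (indicatorConstLp 2 MeasurableSet.univ (measure_ne_top (vol g) univ) (1 : ℝ))
        (toL2 g u) := by
    rw [L2.inner_indicatorConstLp_one, setIntegral_univ]
    rfl
  simp only [h]
  fun_prop

theorem norm_sq_toL2 (u : H1 g) : ‖toL2 g u‖ ^ 2 = ∫ x, u.fn x ^ 2 ∂(vol g) := by
  rw [← real_inner_self_eq_norm_sq, L2.inner_def]
  exact integral_congr_ae (.of_forall fun x ↦ by simp [H1.fn, sq])

end SobolevSpace

/-! ### Growth and coercivity of the potential. -/

section Potential

open scoped ENNReal NNReal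

variable {N : ℕ} {W : ℝ → ℝ}

/-- The given growth exponent may be 2 or less; raising it above 2 while leaving room for a larger
subcritical q makes interpolation between L² and L^q available. -/
theorem DoubleWell.exists_exponents (hW : DoubleWell N W) : ∃ p q : ℝ≥0, 2 < p ∧ p < q ∧
    (3 ≤ N → (q : ℝ) < 2 * N / ((N : ℝ) - 2)) ∧
    ∃ C : ℝ, 0 ≤ C ∧ ∀ s, |deriv W s| ≤ C * (1 + |s| ^ ((p : ℝ) - 1)) := by
  obtain ⟨p₀, A, B, hp₀, hA, hB, hg⟩ := hW.growth
  obtain ⟨p, q, hp2, hpp, hpq, hq⟩ : ∃ p q : ℝ, 2 < p ∧ p₀ ≤ p ∧ p < q ∧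
      (3 ≤ N → q < 2 * N / ((N : ℝ) - 2)) := by
    by_cases hN : 3 ≤ N
    · have hN' : (3 : ℝ) ≤ N := by exact_mod_cast hN
      have h2 : 2 < 2 * N / ((N : ℝ) - 2) := by
        rw [lt_div_iff₀ (by linarith)]
        linarith
      obtain ⟨q, h3, h4⟩ := exists_between (max_lt h2 (hp₀ hN))
      obtain ⟨p, h5, h6⟩ := exists_between h3
      exact ⟨p, q, (le_max_left _ _).trans_lt h5, ((le_max_right _ _).trans_lt h5).le, h6,
        fun _ ↦ h4⟩
    · exact ⟨max 2 p₀ + 1, max 2 p₀ + 2, by linarith [le_max_left 2 p₀],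
        by linarith [le_max_right 2 p₀], by linarith, fun h ↦ absurd h hN⟩
  have hc : Continuous (deriv W) := hW.contDiff.continuous_deriv (by norm_num)
  -- For |s| ≤ 1 a larger exponent gives a smaller power, so the growth bound cannot be used there;
  -- continuity supplies the bound D instead.
  obtain ⟨D, hD⟩ := (isCompact_closedBall (0 : ℝ) 1).exists_bound_of_continuousOn hc.continuousOn
  have hD0 : 0 ≤ D := (norm_nonneg _).trans (hD 0 (by simp))
  lift q to ℝ≥0 using by linarith
  lift p to ℝ≥0 using by linarith
  refine ⟨p, q, by exact_mod_cast hp2, by exact_mod_cast hpq, hq, D + A + B, by positivity,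
    fun s ↦ ?_⟩
  · have hs : 0 ≤ |s| ^ ((p : ℝ) - 1) := by positivity
    rcases le_total |s| 1 with h1 | h1
    · have h2 : |deriv W s| ≤ D := hD s (by simpa using h1)
      nlinarith [mul_nonneg (add_nonneg (add_nonneg hD0 hA.le) hB.le) hs]
    · have h2 : |s| ^ (p₀ - 1) ≤ |s| ^ ((p : ℝ) - 1) := Real.rpow_le_rpow_of_exponent_le h1 (by linarith)
      have h3 := hg s
      nlinarith [mul_nonneg (add_nonneg hD0 hA.le) hs, mul_le_mul_of_nonneg_left h2 hB.le]

/-- Coercivity from p₁ > 2: beyond max(t₀, 1) one has t² ≤ |t|^p₁, which the lower bound on W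
controls. -/
theorem DoubleWell.exists_sq_le (hW : DoubleWell N W) :
    ∃ a b : ℝ, 0 ≤ a ∧ 0 ≤ b ∧ ∀ t, t ^ 2 ≤ a + b * W t := by
  obtain ⟨c₁, c₂, t₀, p₁, p₂, hc₁, -, -, hp₁, -, -, -, hb⟩ := hW.bounds
  refine ⟨max t₀ 1 ^ 2, c₁⁻¹, by positivity, by positivity, fun t ↦ ?_⟩
  have hWt : 0 ≤ c₁⁻¹ * W t := mul_nonneg (by positivity) (hW.nonneg t)
  rcases le_total |t| (max t₀ 1) with h | h
  · have : t ^ 2 ≤ max t₀ 1 ^ 2 := sq_le_sq' (by linarith [(abs_le.1 h).1]) (abs_le.1 h).2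
    linarith
  · have h1 := (hb t ((le_max_left _ _).trans h)).1
    have h2 : t ^ 2 ≤ |t| ^ p₁ := by
      rw [← sq_abs, ← Real.rpow_natCast]
      exact Real.rpow_le_rpow_of_exponent_le ((le_max_right _ _).trans h) (by push_cast; linarith)
    have h3 : |t| ^ p₁ ≤ c₁⁻¹ * W t := by
      rw [inv_mul_eq_div, le_div_iff₀ hc₁, mul_comm]
      exact h1.le
    have : 0 ≤ max t₀ 1 ^ 2 := by positivity
    linarith

end Potential

/-! ### Derivative of the Dirichlet integral and boundedness of energy sublevels. -/

section Energy

open scoped ENNReal NNReal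

variable {N : ℕ} {M : Type*} [TopologicalSpace M] [ChartedSpace (EuclideanSpace ℝ (Fin N)) M]
  [IsManifold (𝓡 N) ∞ M] [T2Space M] [CompactSpace M] [MeasurableSpace M] [BorelSpace M]
  (g : RMetric N M)

/-- The bilinear form of the Dirichlet integral. -/
def dirichletForm (u : H1 g) : H1 g →L[ℝ] ℝ :=
  innerSL ℝ u - (innerSL ℝ (toL2 g u)).comp (toL2 g)

theorem dirichletForm_apply (u v : H1 g) :
    dirichletForm g u v = inner ℝ u v - inner ℝ (toL2 g u) (toL2 g v) := rfl

theorem dirichletForm_sub_self (u v : H1 g) :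
    dirichletForm g u (u - v) - dirichletForm g v (u - v) = dirichlet g (u - v) := by
  simp only [dirichletForm_apply, dirichlet, ← real_inner_self_eq_norm_sq, map_sub, inner_sub_left,
    inner_sub_right]
  ring

theorem hasFDerivAt_dirichlet (u : H1 g) :
    HasFDerivAt (dirichlet g) ((2 : ℝ) • dirichletForm g u) u := by
  have h1 := (hasStrictFDerivAt_norm_sq u).hasFDerivAt
  have h2 := (hasStrictFDerivAt_norm_sq (toL2 g u)).hasFDerivAt.comp u (toL2 g).hasFDerivAt
  refine (h1.sub h2).congr_fderiv ?_
  ext v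
  simp [dirichletForm_apply, mul_sub]

theorem contDiff_dirichlet : ContDiff ℝ 1 (dirichlet g) :=
  (contDiff_norm_sq ℝ).sub ((contDiff_norm_sq ℝ).comp (toL2 g).contDiff)

/-- Sequences that are bounded in `H¹(M)` and Cauchy in `L²(M)` are Cauchy in `L^p(M)`. -/
theorem cauchySeq_toLp_of_cauchySeq_toL2 {p q : ℝ≥0} (hp : 2 < p) (hpq : p < q)
    [Fact ((1 : ℝ≥0∞) ≤ p)] {T : H1 g →L[ℝ] Lp ℝ p (vol g)} (hT : ∀ u, T u =ᵐ[vol g] u.fn)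
    {C : ℝ≥0} (hC : ∀ u : H1 g, eLpNorm u.fn q (vol g) ≤ C * ‖u‖ₑ) {u : ℕ → H1 g} {R : ℝ}
    (hu : ∀ n, ‖u n‖ ≤ R) (hc : CauchySeq fun n ↦ toL2 g (u n)) :
    CauchySeq fun n ↦ T (u n) := by
  -- Stated over pairs of indices, the Cauchy property is smallness of differences, to which
  -- interpolation applies directly.
  rw [cauchySeq_iff_tendsto_dist_atTop_0] at hc ⊢
  have h2 : Tendsto (fun i : ℕ × ℕ ↦ eLpNorm (u i.1 - u i.2).fn 2 (vol g)) atTop (𝓝 0) := by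
    have h1 := (ENNReal.continuous_ofReal.tendsto 0).comp hc
    rw [ENNReal.ofReal_zero] at h1
    refine h1.congr fun i ↦ ?_
    rw [Function.comp_apply, dist_eq_norm, ← map_sub, ofReal_norm]
    exact Lp.enorm_def _
  have hR (i : ℕ × ℕ) : eLpNorm (u i.1 - u i.2).fn q (vol g) ≤ (C * (2 * R).toNNReal : ℝ≥0) := by
    refine (hC _).trans ?_
    rw [ENNReal.coe_mul]
    gcongr
    rw [← ofReal_norm]
    refine ENNReal.ofReal_le_ofReal ((norm_sub_le _ _).trans ?_)
    linarith [hu i.1, hu i.2]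
  have h3 := tendsto_eLpNorm_of_interpolation hp hpq
    (fun i : ℕ × ℕ ↦ Lp.aestronglyMeasurable (toL2 g (u i.1 - u i.2))) hR h2
  have h4 := (ENNReal.tendsto_toReal ENNReal.zero_ne_top).comp h3
  refine h4.congr fun i ↦ ?_
  rw [Function.comp_apply, dist_eq_norm, ← map_sub, Lp.norm_def, eLpNorm_congr_ae (hT _)]
  rfl

theorem isClosed_constraint (V : ℝ) : IsClosed (constraint g V : Set (H1 g)) :=
  isClosed_eq (continuous_integral_fn g) continuous_const

/-- Both terms of the energy are nonnegative, so each is at most B: one bounds the Dirichlet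
integral, the other the integral of W, and hence the L² norm by coercivity. -/
theorem norm_le_of_energy_le {W : ℝ → ℝ} (hW : DoubleWell N W)
    (hint : ∀ u : H1 g, Integrable (fun x ↦ W (u.fn x)) (vol g)) {ε : ℝ} (hε : 0 < ε) (B : ℝ) :
    ∃ R : ℝ, ∀ u : H1 g, energy g W ε u ≤ B → ‖u‖ ≤ R := by
  obtain ⟨a, b, ha, hb, hab⟩ := hW.exists_sq_le
  refine ⟨√(2 * B / ε + (a * (vol g).real univ + b * (ε * B))), fun u hu ↦ ?_⟩
  refine Real.le_sqrt_of_sq_le ?_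
  have hD := dirichlet_nonneg g u
  have hI : 0 ≤ ∫ x, W (u.fn x) ∂(vol g) := integral_nonneg fun x ↦ hW.nonneg _
  have h1 : ε / 2 * dirichlet g u + 1 / ε * ∫ x, W (u.fn x) ∂(vol g) ≤ B := hu
  have h2 : dirichlet g u ≤ 2 * B / ε := by
    have : 0 ≤ 1 / ε * ∫ x, W (u.fn x) ∂(vol g) := by positivity
    rw [le_div_iff₀ hε]
    linarith
  have h3 : ∫ x, W (u.fn x) ∂(vol g) ≤ ε * B := by
    have h4 : 0 ≤ ε / 2 * dirichlet g u := by positivity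
    have h5 : 1 / ε * ∫ x, W (u.fn x) ∂(vol g) ≤ B := by linarith
    rwa [one_div, inv_mul_le_iff₀ hε] at h5
  have h4 : ‖toL2 g u‖ ^ 2 ≤ a * (vol g).real univ + b * ∫ x, W (u.fn x) ∂(vol g) := by
    have h5 : ∫ x, (a + b * W (u.fn x)) ∂(vol g) =
        a * (vol g).real univ + b * ∫ x, W (u.fn x) ∂(vol g) := by
      rw [integral_add (integrable_const _) ((hint u).const_mul b), integral_const_mul,
        integral_const, smul_eq_mul, mul_comm a]
    rw [norm_sq_toL2, ← h5]
    exact integral_mono (Lp.memLp (toL2 g u)).integrable_sq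
      ((integrable_const _).add ((hint u).const_mul b)) fun x ↦ hab _
  have h5 : ‖u‖ ^ 2 = dirichlet g u + ‖toL2 g u‖ ^ 2 := by
    rw [dirichlet]
    ring
  have h6 : b * ∫ x, W (u.fn x) ∂(vol g) ≤ b * (ε * B) := by gcongr
  linarith

end Energy

/-! ### Differentials of restrictions to affine subspaces. -/

section PalaisSmaleLemmas

variable {H : Type*} [NormedAddCommGroup H] [InnerProductSpace ℝ H]

theorem differential_restrict_apply (A : AffineSubspace ℝ H) {f : H → ℝ} (hf : Differentiable ℝ f)
    (u : A) (w : A.direction) :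
    differential A (fun u ↦ f u) u w = fderiv ℝ f u w := by
  have h1 : HasFDerivAt (fun w : A.direction ↦ (w : H) + (u : H)) A.direction.subtypeL 0 :=
    A.direction.subtypeL.hasFDerivAt.add_const (u : H)
  have h2 : HasFDerivAt f (fderiv ℝ f u) (((0 : A.direction) : H) + (u : H)) := by
    simpa using (hf (u : H)).hasFDerivAt
  have h3 := h2.comp (0 : A.direction) h1
  have h4 : differential A (fun u ↦ f u) u = (fderiv ℝ f u).comp A.direction.subtypeL := h3.fderiv
  rw [h4]
  rfl

end PalaisSmaleLemmas

/-! ### The Palais–Smale condition for compact perturbations of the Dirichlet integral. -/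

section Main

open scoped ENNReal NNReal

variable {N : ℕ} {M : Type*} [TopologicalSpace M] [ChartedSpace (EuclideanSpace ℝ (Fin N)) M]
  [IsManifold (𝓡 N) ∞ M] [T2Space M] [CompactSpace M] [MeasurableSpace M] [BorelSpace M]
  (g : RMetric N M)

/-- The Palais–Smale condition for functionals `ε/2 ∫ |∇u|² + Φ(T u)`, where `T` maps bounded
sequences that are Cauchy in `L²` to Cauchy sequences, on closed affine subspaces on which
sublevel sets are bounded. -/
theorem palaisSmale_of_compact (hN : 1 ≤ N) {F : Type*} [NormedAddCommGroup F] [NormedSpace ℝ F]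
    [CompleteSpace F] (T : H1 g →L[ℝ] F)
    (hT : ∀ (u : ℕ → H1 g) (R : ℝ), (∀ n, ‖u n‖ ≤ R) → CauchySeq (fun n ↦ toL2 g (u n)) →
      CauchySeq fun n ↦ T (u n)) {Φ : F → ℝ} (hΦ : ContDiff ℝ 1 Φ) {ε : ℝ} (hε : 0 < ε)
    (hbdd : ∀ B : ℝ, ∃ R : ℝ, ∀ u, ε / 2 * dirichlet g u + Φ (T u) ≤ B → ‖u‖ ≤ R)
    (A : AffineSubspace ℝ (H1 g)) (hA : IsClosed (A : Set (H1 g))) :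
    PalaisSmale A fun u ↦ ε / 2 * dirichlet g u + Φ (T u) := by
  set J : H1 g → ℝ := fun u ↦ ε / 2 * dirichlet g u + Φ (T u) with hJ
  have hJd (u : H1 g) : HasFDerivAt J
      ((ε / 2) • (2 : ℝ) • dirichletForm g u + (fderiv ℝ Φ (T u)).comp T) u :=
    ((hasFDerivAt_dirichlet g u).const_mul (ε / 2)).add
      (((hΦ.differentiable (by simp)) (T u)).hasFDerivAt.comp u T.hasFDerivAt)
  have hJdiff : Differentiable ℝ J := fun u ↦ (hJd u).differentiableAt
  rintro u ⟨⟨c, hc⟩, hd⟩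
  obtain ⟨B, hB⟩ := hc.bddAbove_range
  obtain ⟨R, hR⟩ := hbdd B
  have huR (n : ℕ) : ‖(u n : H1 g)‖ ≤ R := hR _ (hB ⟨n, rfl⟩)
  obtain ⟨k, hk, hk2⟩ := exists_subseq_cauchySeq_toL2 g hN huR
  have hTk := hT _ R (fun n ↦ huR (k n)) hk2
  obtain ⟨y, hy⟩ := cauchySeq_tendsto_of_complete hTk
  -- T turns the L²-Cauchy subsequence into a convergent one, and continuity of the derivative of Φ
  -- transfers this to the dual.
  have hΦk : CauchySeq fun n ↦ fderiv ℝ Φ (T (u (k n))) :=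
    (((hΦ.continuous_fderiv (by simp)).tendsto y).comp hy).cauchySeq
  have hdk : Tendsto (fun n ↦ ‖differential A (fun u ↦ J u) (u (k n))‖) atTop (𝓝 0) :=
    hd.comp hk.tendsto_atTop
  set d : ℕ → ℝ := fun n ↦ ‖differential A (fun u ↦ J u) (u (k n))‖
  set w : ℕ × ℕ → H1 g := fun i ↦ (u (k i.1) : H1 g) - u (k i.2)
  have hwR (i : ℕ × ℕ) : ‖w i‖ ≤ 2 * R := by
    refine (norm_sub_le _ _).trans ?_
    linarith [huR (k i.1), huR (k i.2)]
  have hR0 : 0 ≤ R := (norm_nonneg _).trans (huR 0)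
  have hw (i : ℕ × ℕ) : ε * dirichlet g (w i) ≤ (d i.1 + d i.2) * (2 * R) +
      ‖fderiv ℝ Φ (T (u (k i.1))) - fderiv ℝ Φ (T (u (k i.2)))‖ * (‖T‖ * (2 * R)) := by
    -- The differentials are small only on tangent vectors; the difference of two points of A is
    -- one, so no Lagrange multiplier appears.
    have hwA : w i ∈ A.direction := A.vsub_mem_direction (u (k i.1)).2 (u (k i.2)).2
    have e1 (n : ℕ) : |fderiv ℝ J (u n) (w i)| ≤
        ‖differential A (fun u ↦ J u) (u n)‖ * (2 * R) := by
      rw [← differential_restrict_apply A hJdiff (u n) ⟨w i, hwA⟩]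
      rw [← Real.norm_eq_abs]
      refine ((differential A (fun u ↦ J u) (u n)).le_opNorm ⟨w i, hwA⟩).trans ?_
      exact mul_le_mul_of_nonneg_left (hwR i) (norm_nonneg _)
    have e2 (v : H1 g) : fderiv ℝ J v (w i) =
        ε * dirichletForm g v (w i) + fderiv ℝ Φ (T v) (T (w i)) := by
      rw [(hJd v).fderiv]
      simp only [add_apply, smul_apply, smul_eq_mul, ContinuousLinearMap.comp_apply]
      ring
    have e3 : |(fderiv ℝ Φ (T (u (k i.1))) - fderiv ℝ Φ (T (u (k i.2)))) (T (w i))| ≤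
        ‖fderiv ℝ Φ (T (u (k i.1))) - fderiv ℝ Φ (T (u (k i.2)))‖ * (‖T‖ * (2 * R)) := by
      rw [← Real.norm_eq_abs]
      refine ((fderiv ℝ Φ (T (u (k i.1))) - fderiv ℝ Φ (T (u (k i.2)))).le_opNorm
        (T (w i))).trans ?_
      refine mul_le_mul_of_nonneg_left ((T.le_opNorm _).trans ?_) (norm_nonneg _)
      exact mul_le_mul_of_nonneg_left (hwR i) (norm_nonneg _)
    rw [sub_apply] at e3
    -- Subtracting the two derivatives at w isolates the Dirichlet integral, by
    -- `dirichletForm_sub_self`.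
    have e4 : ε * dirichlet g (w i) = fderiv ℝ J (u (k i.1)) (w i) - fderiv ℝ J (u (k i.2)) (w i) -
        (fderiv ℝ Φ (T (u (k i.1))) (T (w i)) - fderiv ℝ Φ (T (u (k i.2))) (T (w i))) := by
      rw [e2, e2, ← dirichletForm_sub_self g (u (k i.1) : H1 g) (u (k i.2))]
      ring
    rw [e4]
    have e5 := abs_le.1 (e1 (k i.1))
    have e6 := abs_le.1 (e1 (k i.2))
    have e7 := abs_le.1 e3
    simp only [d]
    linarith
  have hlim : Tendsto (fun i : ℕ × ℕ ↦ ε⁻¹ * ((d i.1 + d i.2) * (2 * R) +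
      ‖fderiv ℝ Φ (T (u (k i.1))) - fderiv ℝ Φ (T (u (k i.2)))‖ * (‖T‖ * (2 * R))) +
      ‖toL2 g (w i)‖ ^ 2) atTop (𝓝 0) := by
    have f1 : Tendsto (fun i : ℕ × ℕ ↦ d i.1) atTop (𝓝 0) := by
      rw [← prod_atTop_atTop_eq]
      exact hdk.comp tendsto_fst
    have f2 : Tendsto (fun i : ℕ × ℕ ↦ d i.2) atTop (𝓝 0) := by
      rw [← prod_atTop_atTop_eq]
      exact hdk.comp tendsto_snd
    have f3 := cauchySeq_iff_tendsto_dist_atTop_0.1 hΦk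
    have f4 := cauchySeq_iff_tendsto_dist_atTop_0.1 hk2
    simp only [dist_eq_norm, ← map_sub (toL2 g)] at f3 f4
    have f5 := ((((f1.add f2).mul_const (2 * R)).add
      (f3.mul_const (‖T‖ * (2 * R)))).const_mul ε⁻¹).add (f4.pow 2)
    simpa [w] using f5
  have hcauchy : CauchySeq fun n ↦ (u (k n) : H1 g) := by
    rw [cauchySeq_iff_tendsto_dist_atTop_0]
    have f1 : Tendsto (fun i ↦ ‖w i‖ ^ 2) atTop (𝓝 0) := by
      refine squeeze_zero (fun i ↦ sq_nonneg _) (fun i ↦ ?_) hlim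
      have f2 : ‖w i‖ ^ 2 = dirichlet g (w i) + ‖toL2 g (w i)‖ ^ 2 := by
        rw [dirichlet]
        ring
      rw [f2]
      gcongr
      rw [← div_eq_inv_mul, le_div_iff₀ hε, mul_comm]
      exact hw i
    have f3 := (Real.continuous_sqrt.tendsto 0).comp f1
    rw [Real.sqrt_zero] at f3
    refine f3.congr fun i ↦ ?_
    rw [Function.comp_apply, Real.sqrt_sq (norm_nonneg _), dist_eq_norm]
  obtain ⟨v, hv⟩ := cauchySeq_tendsto_of_complete hcauchy
  have hvA : v ∈ A := hA.mem_of_tendsto hv (.of_forall fun n ↦ (u (k n)).2)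
  exact ⟨⟨v, hvA⟩, k, hk, tendsto_subtype_rng.2 hv⟩

end Main

end CahnHilliard

end

/-! ### Regularity and the Palais–Smale condition for the constrained energy. -/

theorem proposition4p7 {N : ℕ} (hN : 1 ≤ N) {M : Type*} [TopologicalSpace M] [T2Space M]
    [CompactSpace M] [ChartedSpace (EuclideanSpace ℝ (Fin N)) M] [IsManifold (𝓡 N) ∞ M]
    [MeasurableSpace M] [BorelSpace M] (g : CahnHilliard.RMetric N M)
    (W : ℝ → ℝ) (hW : CahnHilliard.DoubleWell N W) (ε V : ℝ) (hε : 0 < ε) (hV : 0 < V) :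
    (∀ u : CahnHilliard.H1 g, Integrable (fun x ↦ W (u.fn x)) (CahnHilliard.vol g)) ∧
    ContDiff ℝ 1 (CahnHilliard.energy g W ε) ∧
    CahnHilliard.PalaisSmale (CahnHilliard.constraint g V)
      (fun u ↦ CahnHilliard.energy g W ε u) := by
  obtain ⟨p, q, hp2, hpq, hq, C, hC, hg⟩ := hW.exists_exponents
  have hW1 : ContDiff ℝ 1 W := hW.contDiff.of_le one_le_two
  have hp1 : 1 < p := one_lt_two.trans hp2
  have : Fact ((1 : ENNReal) ≤ p) := ⟨by exact_mod_cast hp1.le⟩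
  obtain ⟨T, hT⟩ := CahnHilliard.exists_clm_toLp g hN hp2.le
    fun h ↦ (NNReal.coe_lt_coe.2 hpq).trans (hq h)
  obtain ⟨D, hD⟩ := CahnHilliard.exists_eLpNorm_fn_le g hN (hp2.trans hpq).le hq
  obtain ⟨C', hC'⟩ := CahnHilliard.abs_le_of_growth (hW1.differentiable (by simp)) hC
    (by exact_mod_cast hp1.le) hg
  have hint (u : CahnHilliard.H1 g) : Integrable (fun x ↦ W (u.fn x)) (CahnHilliard.vol g) :=
    CahnHilliard.integrable_of_growth hW1.continuous (zero_lt_one.trans hp1).ne' hC'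
      ((memLp_congr_ae (hT u)).1 (Lp.memLp (T u)))
  set Φ : Lp ℝ p (CahnHilliard.vol g) → ℝ := fun u ↦ 1 / ε * ∫ x, W (u x) ∂(CahnHilliard.vol g)
  have hΦ : ContDiff ℝ 1 Φ :=
    contDiff_const.mul (CahnHilliard.contDiff_one_integral_superposition hW1 hC hp1 hg)
  -- The energy integrates W along the L² representative of u, and Φ along the L^p class T u; these
  -- agree almost everywhere.
  have hE : CahnHilliard.energy g W ε = fun u ↦ ε / 2 * CahnHilliard.dirichlet g u + Φ (T u) := by
    ext u
    have h : ∫ x, W (u.fn x) ∂(CahnHilliard.vol g) = ∫ x, W (T u x) ∂(CahnHilliard.vol g) :=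
      integral_congr_ae ((hT u).mono fun x hx ↦ by simp only [hx])
    rw [CahnHilliard.energy, h]
  refine ⟨hint, ?_, ?_⟩
  · rw [hE]
    exact (contDiff_const.mul (CahnHilliard.contDiff_dirichlet g)).add (hΦ.comp T.contDiff)
  · have hb := CahnHilliard.norm_le_of_energy_le g hW hint hε
    rw [hE] at hb ⊢
    exact CahnHilliard.palaisSmale_of_compact g hN T (fun u R hu hc ↦
      CahnHilliard.cauchySeq_toLp_of_cauchySeq_toL2 g hp2 hpq hT hD hu hc) hΦ hε hb _
      (CahnHilliard.isClosed_constraint g V)
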